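/- Let $k\ge 3$ be an integer. For $n\ge 1$ and $p\in(0,1]$ let $[n]_p$ be the random subset of $[n]=\{1,\dots,n\}$ in which each element is included independently with probability $p$, and let $X=X_{k,n,p}$ be the number of arithmetic progressions of length $k$ in $[n]_p$, i.e. of $k$-element sets $\{a,a+d,\dots,a+(k-1)d\}\subseteq [n]_p$ with $d\ge 1$. Thus $X_{k,n,1}$ is the number of arithmetic progressions of length $k$ in $[n]$. Put $\mu=\mathbb{E}X$, $\varphi(x)=(1+x)\log(1+x)-x$ and $$\Phi(\varepsilon)=\min\Bigl\{\frac{\varphi(\varepsilon)\mu^2}{\operatorname{Var}X},\ \sqrt{\varepsilon\mu}\,\log(1/p)\Bigr\}.$$ There are an integer $n_0\ge 1$ and a real number $\alpha>1/(6k)$, depending only on $k$, such that for every $\gamma\in(0,1)$ there are constants $c,C>0$, depending only on $\gamma$ and $k$, with the following property: for all $n\ge n_0$, all $p\in(0,1-\gamma]$ and all $\varepsilon\ge n^{-\alpha}$ satisfying $\Phi(\varepsilon)\ge 1$, $$\mathbf 1_{\{1\le(1+\varepsilon)\mu\le X_{k,n,1}\}}\exp\bigl(-C\,\Phi(\varepsilon)\bigr)\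 \le\ \mathbb{P}\bigl(X\ge(1+\varepsilon)\mu\bigr)\ \le\ \exp\bigl(-c\,\Phi(\varepsilon)\bigr).$$ -/

import Mathlib

open MeasureTheory ProbabilityTheory

noncomputable section

/-- `A` is an arithmetic progression of length `k`, viewed as a `k`-element set
`{a, a + d, …, a + (k - 1) d}` with common difference `d ≥ 1`. -/
def IsAP (k : ℕ) (A : Finset ℕ) : Prop :=
  ∃ a d : ℕ, 0 < d ∧ A = (Finset.range k).image (fun i => a + i * d)

open Classical in
/-- The set of all arithmetic progressions of length `k` that are contained in `{1, …, n}`. -/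
def apSets (k n : ℕ) : Finset (Finset ℕ) :=
  (Finset.Icc 1 n).powerset.filter (fun A : Finset ℕ => IsAP k A)

open Classical in
/-- The number of arithmetic progressions of length `k` in `{1, …, n}` all of whose elements lie
in the set `R`; for `R ⊆ {1, …, n}` this is the number of `k`-term progressions in `R`. -/
def apCount (k n : ℕ) (R : Set ℕ) : ℝ :=
  (((apSets k n).filter (fun A : Finset ℕ => (A : Set ℕ) ⊆ R)).card : ℝ)

/-- The law of the binomial random subset `[n]_p` of `[n] = {1, …, n}`: every element of `[n]` is
included independently with probability `p`. -/
def randomSubset (n : ℕ) (p : unitInterval) : Measure (Set ℕ) :=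
  setBernoulli (Set.Icc 1 n) p

/-- The mean `μ = 𝔼 X` of the number `X` of `k`-term progressions in `[n]_p`. -/
def apMean (k n : ℕ) (p : unitInterval) : ℝ :=
  ∫ R, apCount k n R ∂(randomSubset n p)

/-- The variance of the number `X` of `k`-term progressions in `[n]_p`. -/
def apVar (k n : ℕ) (p : unitInterval) : ℝ :=
  variance (apCount k n) (randomSubset n p)

/-- The upper tail `ℙ(X ≥ x)` of the number `X` of `k`-term progressions in `[n]_p`. -/
def apUpperTail (k n : ℕ) (p : unitInterval) (x : ℝ) : ℝ :=
  (randomSubset n p).real {R | x ≤ apCount k n R}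

/-- `φ(x) = (1 + x) log (1 + x) - x`. -/
def phi (x : ℝ) : ℝ := (1 + x) * Real.log (1 + x) - x

/-- `Φ(ε) = min {φ(ε) μ² / Var X, √(ε μ) log (1/p)}`. -/
def bigPhi (k n : ℕ) (p : unitInterval) (ε : ℝ) : ℝ :=
  min (phi ε * apMean k n p ^ 2 / apVar k n p)
    (Real.sqrt (ε * apMean k n p) * Real.log (1 / (p : ℝ)))

end

/-! Write Q = √(εμ), L = log(1/p), λ = n p^(k-1), the order of the mean degree of a point, and Ξ for
the pair sum `famXi`; Var X lies between (1-p)Ξ and Ξ. A large X has two sources: a global excess,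
with the Gaussian or Poisson exponent φ(ε)μ²/Var X, or a cluster of order Q points, such as an
interval, which carries εμ extra progressions by itself and costs p to a power of order Q.

Upper bound. A subfamily of the progressions in R in which every member meets at most Δ others
contains many tuples of pairwise disjoint members. The expected number of such q-tuples is at most
the q-th power of the mean, so Markov's inequality gives a Chernoff bound whose exponent is divided
by Δ (`binPr_sparse_subfamily_le`). This settles families with all degrees below a threshold r,
chosen so that the exponent is still of order Φ. Larger degrees are peeled off at the dyadic scales
D = 2^i r: either some point has degree at least about Q, or at some scale at least θ_i progressions
form stars with average size at least D, or the sparse remainder still exceeds (1 + ε/2)μ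
(`exists_stars_or_sparse`). A union bound over all star centres would be too expensive when D is
small. Sampling the centres with density 1/D (`exists_star_sample`) leaves stars with boundedly many
conflicts, so that each sampled centre gains about D log(D/λ) in the exponent. This beats the
entropy log n of its position (`exists_le_mul_log_div_lam`, the place where ε ≥ n^(-1/16) enters),
and the leftover gain θ_i/D · log(D/λ) has order at least Φ (`exists_mul_le_mul_log_div_lam`).

Lower bound. Planting an interval of length of order Q and applying Harris's inequality to the other
progressions gives exp(-C Q L) (`exists_clustering_bound`). For the other exponent, only
progressions with exactly one point in the last stretch J of [n] are boosted. Once R outside J is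
exposed, their number is a linear statistic of R ∩ J, with weights `linkDeg`. For small ε the
density on the points of positive weight is raised by a factor 1 + O(ε), and Cauchy–Schwarz compares
the two measures (`exists_small_bound`). For ε bounded below, either Q L is already O(φ(ε)μ²/Var X),
so the interval suffices, or μ ≤ np and there are order μ/p points of positive weight; then forcing
2(1+ε)μ of them into R has the Poisson cost (`exists_large_bound`). -/

/-! ### Finite calculus of the binomial random subset -/

/-- The expectation of `f` over the binomial random subset of a finite set `V`. -/
noncomputable def binEx (V : Finset ℕ) (p : ℝ) (f : Finset ℕ → ℝ) : ℝ :=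
  ∑ S ∈ V.powerset, p ^ S.card * (1 - p) ^ (V.card - S.card) * f S

open Classical in
/-- The probability of an event for the binomial random subset of a finite set `V`. -/
noncomputable def binPr (V : Finset ℕ) (p : ℝ) (P : Finset ℕ → Prop) : ℝ :=
  binEx V p fun S => if P S then 1 else 0

lemma binEx_empty (p : ℝ) (f : Finset ℕ → ℝ) : binEx ∅ p f = f ∅ := by simp [binEx]

/-- Conditioning on whether the new point is present; every induction over the ground set below
rests on this recursion. -/
lemma binEx_insert {V : Finset ℕ} {a : ℕ} (ha : a ∉ V) (p : ℝ) (f : Finset ℕ → ℝ) :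
    binEx (insert a V) p f
      = p * binEx V p (fun S => f (insert a S)) + (1 - p) * binEx V p f := by
  unfold binEx
  rw [Finset.sum_powerset_insert ha, add_comm, Finset.mul_sum, Finset.mul_sum]
  congr 1
  · refine Finset.sum_congr rfl fun S hS => ?_
    have hS' := Finset.mem_powerset.1 hS
    have : a ∉ S := fun h => ha (hS' h)
    rw [Finset.card_insert_of_notMem ha, Finset.card_insert_of_notMem this, Nat.add_sub_add_right]
    ring
  · refine Finset.sum_congr rfl fun S hS => ?_
    have hS' := Finset.card_le_card (Finset.mem_powerset.1 hS)
    rw [Finset.card_insert_of_notMem ha, Nat.sub_add_comm hS']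
    ring

lemma binEx_add (V : Finset ℕ) (p : ℝ) (f g : Finset ℕ → ℝ) :
    binEx V p (fun S => f S + g S) = binEx V p f + binEx V p g := by
  simp [binEx, mul_add, Finset.sum_add_distrib]

lemma binEx_sub (V : Finset ℕ) (p : ℝ) (f g : Finset ℕ → ℝ) :
    binEx V p (fun S => f S - g S) = binEx V p f - binEx V p g := by
  simp [binEx, mul_sub, Finset.sum_sub_distrib]

lemma binEx_const_mul (V : Finset ℕ) (p c : ℝ) (f : Finset ℕ → ℝ) :
    binEx V p (fun S => c * f S) = c * binEx V p f := by
  unfold binEx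
  rw [Finset.mul_sum]
  exact Finset.sum_congr rfl fun _ _ => by ring

lemma binEx_mul_const (V : Finset ℕ) (p c : ℝ) (f : Finset ℕ → ℝ) :
    binEx V p (fun S => f S * c) = binEx V p f * c := by
  simp_rw [mul_comm _ c]
  exact binEx_const_mul V p c f

lemma binEx_sum {ι : Type*} (I : Finset ι) (V : Finset ℕ) (p : ℝ) (f : ι → Finset ℕ → ℝ) :
    binEx V p (fun S => ∑ i ∈ I, f i S) = ∑ i ∈ I, binEx V p (f i) := by
  unfold binEx
  rw [Finset.sum_comm]
  exact Finset.sum_congr rfl fun _ _ => by rw [Finset.mul_sum]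

lemma binEx_const (V : Finset ℕ) (p c : ℝ) : binEx V p (fun _ => c) = c := by
  induction V using Finset.induction_on with
  | empty => simp [binEx_empty]
  | insert a V ha ih => rw [binEx_insert ha, ih]; ring

lemma binEx_congr {V : Finset ℕ} {p : ℝ} {f g : Finset ℕ → ℝ} (h : ∀ S ⊆ V, f S = g S) :
    binEx V p f = binEx V p g :=
  Finset.sum_congr rfl fun S hS => by rw [h S (Finset.mem_powerset.1 hS)]

lemma binEx_mono {V : Finset ℕ} {p : ℝ} (h0 : 0 ≤ p) (h1 : p ≤ 1) {f g : Finset ℕ → ℝ}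
    (h : ∀ S ⊆ V, f S ≤ g S) : binEx V p f ≤ binEx V p g :=
  Finset.sum_le_sum fun S hS => mul_le_mul_of_nonneg_left (h S (Finset.mem_powerset.1 hS))
    (mul_nonneg (pow_nonneg h0 _) (pow_nonneg (sub_nonneg.2 h1) _))

lemma binEx_nonneg {V : Finset ℕ} {p : ℝ} (h0 : 0 ≤ p) (h1 : p ≤ 1) {f : Finset ℕ → ℝ}
    (h : ∀ S ⊆ V, 0 ≤ f S) : 0 ≤ binEx V p f := by
  rw [← binEx_const V p 0]
  exact binEx_mono h0 h1 h

lemma binEx_union {V W : Finset ℕ} (h : Disjoint V W) (p : ℝ) (f : Finset ℕ → ℝ) :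
    binEx (V ∪ W) p f = binEx V p (fun S => binEx W p (fun T => f (S ∪ T))) := by
  induction V using Finset.induction_on generalizing f with
  | empty => simp [binEx_empty]
  | insert a V ha ih =>
    rw [Finset.disjoint_insert_left] at h
    have ha' : a ∉ V ∪ W := by simp [ha, h.1]
    rw [Finset.insert_union, binEx_insert ha', binEx_insert ha, ih h.2, ih h.2]
    simp_rw [Finset.insert_union]

/-- Coordinates outside `U` integrate out, by splitting `V` into its parts inside and outside `U`.
-/
lemma binEx_inter (V U : Finset ℕ) (p : ℝ) (f : Finset ℕ → ℝ) :
    binEx V p (fun S => f (S ∩ U)) = binEx (V ∩ U) p f := by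
  have h : Disjoint (V ∩ U) (V \ U) := by
    rw [Finset.disjoint_left]; intro x; simp; tauto
  have hV : V = (V ∩ U) ∪ (V \ U) := by
    ext x; simp; tauto
  conv_lhs => rw [hV]
  rw [binEx_union h]
  refine binEx_congr fun S hS => ?_
  rw [← binEx_const (V \ U) p (f S)]
  refine binEx_congr fun T hT => ?_
  congr 1
  ext x
  have := @hS x
  have := @hT x
  simp at *
  tauto

lemma binPr_nonneg {V : Finset ℕ} {p : ℝ} (h0 : 0 ≤ p) (h1 : p ≤ 1) (P : Finset ℕ → Prop) :
    0 ≤ binPr V p P :=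
  binEx_nonneg h0 h1 fun S _ => by split_ifs <;> norm_num

lemma binPr_mono {V : Finset ℕ} {p : ℝ} (h0 : 0 ≤ p) (h1 : p ≤ 1) {P P' : Finset ℕ → Prop}
    (h : ∀ S ⊆ V, P S → P' S) : binPr V p P ≤ binPr V p P' :=
  binEx_mono h0 h1 fun S hS => by
    have := h S hS
    split_ifs <;> first | tauto | norm_num

lemma binPr_or_le {V : Finset ℕ} {p : ℝ} (h0 : 0 ≤ p) (h1 : p ≤ 1) (P P' : Finset ℕ → Prop) :
    binPr V p (fun S => P S ∨ P' S) ≤ binPr V p P + binPr V p P' := by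
  unfold binPr
  rw [← binEx_add]
  exact binEx_mono h0 h1 fun S _ => by split_ifs <;> first | tauto | norm_num

open Classical in
lemma binPr_exists_le {ι : Type*} {V : Finset ℕ} {p : ℝ} (h0 : 0 ≤ p) (h1 : p ≤ 1) (I : Finset ι)
    (P : ι → Finset ℕ → Prop) :
    binPr V p (fun S => ∃ i ∈ I, P i S) ≤ ∑ i ∈ I, binPr V p (P i) := by
  unfold binPr
  rw [← binEx_sum]
  refine binEx_mono h0 h1 fun S _ => ?_
  have hn : ∀ i ∈ I, (0 : ℝ) ≤ if P i S then 1 else 0 := fun i _ => by split_ifs <;> norm_num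
  split_ifs with h
  · obtain ⟨i, hi, hP⟩ := h
    refine le_trans ?_ (Finset.single_le_sum hn hi)
    simp [hP]
  · exact Finset.sum_nonneg hn

lemma binPr_not (V : Finset ℕ) (p : ℝ) (P : Finset ℕ → Prop) :
    binPr V p (fun S => ¬ P S) = 1 - binPr V p P := by
  unfold binPr
  rw [eq_sub_iff_add_eq, ← binEx_add]
  conv_rhs => rw [← binEx_const V p 1]
  exact binEx_congr fun S _ => by by_cases h : P S <;> simp [h]

lemma binPr_subset {V B : Finset ℕ} (h : B ⊆ V) (p : ℝ) :
    binPr V p (fun S => B ⊆ S) = p ^ B.card := by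
  have h' : binPr V p (fun S => B ⊆ S) = binEx V p (fun S => if B ⊆ S ∩ B then 1 else 0) := by
    unfold binPr
    refine binEx_congr fun S _ => ?_
    simp [Finset.subset_inter_iff]
  rw [h', binEx_inter V B p (fun T => if B ⊆ T then 1 else 0), Finset.inter_eq_right.2 h]
  unfold binEx
  rw [Finset.sum_eq_single B]
  · simp
  · intro S hS hne
    have : ¬ B ⊆ S := fun hh => hne (Finset.Subset.antisymm (Finset.mem_powerset.1 hS) hh)
    simp [this]
  · simp

lemma binEx_subset_ite {V B : Finset ℕ} (h : B ⊆ V) (p : ℝ) :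
    binEx V p (fun S => if B ⊆ S then 1 else 0) = p ^ B.card := by
  rw [← binPr_subset h p]
  unfold binPr
  exact binEx_congr fun S _ => by congr

/-- Markov's inequality. -/
lemma binPr_markov {V : Finset ℕ} {p : ℝ} (h0 : 0 ≤ p) (h1 : p ≤ 1) {f : Finset ℕ → ℝ}
    (hf : ∀ S ⊆ V, 0 ≤ f S) {t : ℝ} (ht : 0 < t) :
    binPr V p (fun S => t ≤ f S) ≤ binEx V p f / t := by
  rw [le_div_iff₀ ht]
  unfold binPr
  rw [← binEx_mul_const]
  refine binEx_mono h0 h1 fun S hS => ?_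
  split_ifs with h
  · simpa using h
  · simpa using hf S hS

/-- The variance over the binomial random subset. -/
noncomputable def binVar (V : Finset ℕ) (p : ℝ) (f : Finset ℕ → ℝ) : ℝ :=
  binEx V p fun S => (f S - binEx V p f) ^ 2

lemma binVar_nonneg {V : Finset ℕ} {p : ℝ} (h0 : 0 ≤ p) (h1 : p ≤ 1) (f : Finset ℕ → ℝ) :
    0 ≤ binVar V p f := binEx_nonneg h0 h1 fun _ _ => sq_nonneg _

lemma binVar_eq (V : Finset ℕ) (p : ℝ) (f : Finset ℕ → ℝ) :
    binVar V p f = binEx V p (fun S => f S ^ 2) - binEx V p f ^ 2 := by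
  have : binVar V p f = binEx V p (fun S => (f S ^ 2 - (2 * binEx V p f) * f S)
      + binEx V p f ^ 2) := binEx_congr fun S _ => by ring
  rw [this, binEx_add, binEx_sub, binEx_const_mul, binEx_const]
  ring

/-- Cantelli's inequality for the upper tail. -/
lemma binPr_cantelli {V : Finset ℕ} {p : ℝ} (h0 : 0 ≤ p) (h1 : p ≤ 1) (f : Finset ℕ → ℝ)
    {t v : ℝ} (ht : 0 < t) (hv : binVar V p f ≤ v) :
    binPr V p (fun S => binEx V p f + t ≤ f S) ≤ v / (v + t ^ 2) := by
  set m := binEx V p f with hm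
  have hv0 : 0 ≤ v := (binVar_nonneg h0 h1 f).trans hv
  have hpos : 0 < v + t ^ 2 := by positivity
  -- Markov's inequality for the square of `f - m + v / t`; the shift `v / t` is the optimal one.
  have key : binPr V p (fun S => m + t ≤ f S) * (t + v / t) ^ 2
      ≤ binEx V p (fun S => (f S - m) ^ 2 + (2 * (v / t)) * (f S - m) + (v / t) ^ 2) := by
    unfold binPr
    rw [← binEx_mul_const]
    refine binEx_mono h0 h1 fun S _ => ?_
    have hq : 0 ≤ v / t := by positivity
    split_ifs with h
    · nlinarith
    · nlinarith [sq_nonneg (f S - m + v / t)]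
  have e : binEx V p (fun S => (f S - m) ^ 2 + (2 * (v / t)) * (f S - m) + (v / t) ^ 2)
      = binVar V p f + (v / t) ^ 2 := by
    rw [binEx_add, binEx_add, binEx_const_mul, binEx_sub, binEx_const, binEx_const, ← hm]
    simp [binVar, ← hm]
  rw [e] at key
  rw [le_div_iff₀ hpos]
  have h2 : (t + v / t) ^ 2 = (v + t ^ 2) * ((v + t ^ 2) / t ^ 2) := by field_simp; ring
  have h3 : v + (v / t) ^ 2 = v * ((v + t ^ 2) / t ^ 2) := by field_simp; ring
  have h4 : 0 < (v + t ^ 2) / t ^ 2 := by positivity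
  refine le_of_mul_le_mul_right ?_ h4
  calc _ = binPr V p (fun S => m + t ≤ f S) * (t + v / t) ^ 2 := by rw [h2]; ring
    _ ≤ binVar V p f + (v / t) ^ 2 := key
    _ ≤ v + (v / t) ^ 2 := by linarith
    _ = _ := h3

/-- Cantelli's inequality, in the form of a lower bound. -/
lemma le_binPr_cantelli {V : Finset ℕ} {p : ℝ} (h0 : 0 ≤ p) (h1 : p ≤ 1) (f : Finset ℕ → ℝ)
    {t v : ℝ} (ht : 0 < t) (hv : binVar V p f ≤ v) :
    t ^ 2 / (v + t ^ 2) ≤ binPr V p (fun S => binEx V p f - t ≤ f S) := by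
  have hv0 : 0 ≤ v := (binVar_nonneg h0 h1 f).trans hv
  have hneg : binEx V p (fun S => (-1) * f S) = - binEx V p f := by
    rw [binEx_const_mul]; ring
  have hvar : binVar V p (fun S => (-1) * f S) ≤ v := by
    refine le_trans (le_of_eq ?_) hv
    unfold binVar
    rw [hneg]
    exact binEx_congr fun S _ => by ring
  have h := binPr_cantelli h0 h1 (fun S => (-1) * f S) ht hvar
  have h' : 1 - binPr V p (fun S => binEx V p (fun S => (-1) * f S) + t ≤ (-1) * f S)
      ≤ binPr V p (fun S => binEx V p f - t ≤ f S) := by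
    rw [← binPr_not]
    refine binPr_mono h0 h1 fun S _ hS => ?_
    rw [hneg] at hS
    linarith
  have : t ^ 2 / (v + t ^ 2) = 1 - v / (v + t ^ 2) := by
    have : 0 < v + t ^ 2 := by positivity
    field_simp; ring
  linarith

/-- Harris's inequality. -/
lemma binEx_harris {V : Finset ℕ} {p : ℝ} (h0 : 0 ≤ p) (h1 : p ≤ 1) {f g : Finset ℕ → ℝ}
    (hf : Monotone f) (hg : Monotone g) :
    binEx V p f * binEx V p g ≤ binEx V p (fun S => f S * g S) := by
  induction V using Finset.induction_on generalizing f g with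
  | empty => simp [binEx_empty]
  | insert a V ha ih =>
    rw [binEx_insert ha, binEx_insert ha, binEx_insert ha]
    have hins : Monotone fun S : Finset ℕ => insert a S := fun S T h => Finset.insert_subset_insert a h
    have i1 := ih (hf.comp hins) (hg.comp hins)
    have i2 := ih hf hg
    have f1 : binEx V p f ≤ binEx V p (fun S => f (insert a S)) :=
      binEx_mono h0 h1 fun S _ => hf (Finset.subset_insert a S)
    have g1 : binEx V p g ≤ binEx V p (fun S => g (insert a S)) :=
      binEx_mono h0 h1 fun S _ => hg (Finset.subset_insert a S)
    simp only [Function.comp_def] at i1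
    have hq : 0 ≤ 1 - p := by linarith
    -- Beyond the two inductive inequalities, what remains is p(1-p) times the product of the
    -- increments of `f` and `g` in the new coordinate, and both increments are nonnegative.
    nlinarith [mul_le_mul_of_nonneg_left i1 h0, mul_le_mul_of_nonneg_left i2 hq,
      mul_nonneg (mul_nonneg h0 hq) (mul_nonneg (sub_nonneg.2 f1) (sub_nonneg.2 g1))]

lemma binPr_harris {V : Finset ℕ} {p : ℝ} (h0 : 0 ≤ p) (h1 : p ≤ 1) {P P' : Finset ℕ → Prop}
    (hP : ∀ S T, S ⊆ T → P S → P T) (hP' : ∀ S T, S ⊆ T → P' S → P' T) :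
    binPr V p P * binPr V p P' ≤ binPr V p (fun S => P S ∧ P' S) := by
  classical
  have mono : ∀ Q : Finset ℕ → Prop, (∀ S T, S ⊆ T → Q S → Q T) →
      Monotone (fun S => if Q S then (1 : ℝ) else 0) := by
    intro Q hQ S T h
    have := hQ S T h
    dsimp only
    split_ifs <;> first | tauto | norm_num
  refine le_trans (binEx_harris h0 h1 (mono P hP) (mono P' hP')) (le_of_eq ?_)
  refine binEx_congr fun S _ => ?_
  by_cases hS : P S <;> by_cases hS' : P' S <;> simp [hS, hS']


/-! ### Families of sets: second moments and disjoint tuples -/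

section Families
variable {ι : Type*}

/-- The number of members of the family `b i`, `i ∈ I`, that are contained in `S`. -/
noncomputable def famCount (I : Finset ι) (b : ι → Finset ℕ) (S : Finset ℕ) : ℝ :=
  ∑ i ∈ I, if b i ⊆ S then 1 else 0

lemma famCount_eq_card (I : Finset ι) (b : ι → Finset ℕ) (S : Finset ℕ) :
    famCount I b S = ((I.filter fun i => b i ⊆ S).card : ℝ) := by
  simp [famCount]

lemma famCount_nonneg (I : Finset ι) (b : ι → Finset ℕ) (S : Finset ℕ) : 0 ≤ famCount I b S := by
  rw [famCount_eq_card]; positivity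

lemma famCount_mono (I : Finset ι) (b : ι → Finset ℕ) {S T : Finset ℕ} (h : S ⊆ T) :
    famCount I b S ≤ famCount I b T := by
  rw [famCount_eq_card, famCount_eq_card]
  exact_mod_cast Finset.card_le_card
    (Finset.monotone_filter_right _ fun i _ hi => Finset.Subset.trans hi h)

/-- The expected number of members of the family in the random set. -/
noncomputable def famMean (I : Finset ι) (b : ι → Finset ℕ) (p : ℝ) : ℝ :=
  ∑ i ∈ I, p ^ (b i).card

/-- The sum of `ℙ(b i ∪ b j ⊆ R)` over all pairs of intersecting members of the family. -/
noncomputable def famXi (I : Finset ι) (b : ι → Finset ℕ) (p : ℝ) : ℝ :=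
  ∑ i ∈ I, ∑ j ∈ I, if Disjoint (b i) (b j) then 0 else p ^ (b i ∪ b j).card

lemma binEx_famCount {V : Finset ℕ} {I : Finset ι} {b : ι → Finset ℕ} (h : ∀ i ∈ I, b i ⊆ V)
    (p : ℝ) : binEx V p (famCount I b) = famMean I b p := by
  unfold famCount famMean
  rw [binEx_sum]
  exact Finset.sum_congr rfl fun i hi => binEx_subset_ite (h i hi) p

lemma binEx_famCount_sq {V : Finset ℕ} {I : Finset ι} {b : ι → Finset ℕ} (h : ∀ i ∈ I, b i ⊆ V)
    (p : ℝ) : binEx V p (fun S => famCount I b S ^ 2)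
      = ∑ i ∈ I, ∑ j ∈ I, p ^ (b i ∪ b j).card := by
  have : ∀ S, famCount I b S ^ 2 = ∑ i ∈ I, ∑ j ∈ I, if b i ∪ b j ⊆ S then 1 else 0 := by
    intro S
    rw [sq, famCount, Finset.sum_mul_sum]
    refine Finset.sum_congr rfl fun i _ => Finset.sum_congr rfl fun j _ => ?_
    simp only [Finset.union_subset_iff]
    by_cases h1 : b i ⊆ S <;> by_cases h2 : b j ⊆ S <;> simp [h1, h2]
  simp_rw [this]
  rw [binEx_sum]
  refine Finset.sum_congr rfl fun i hi => ?_
  rw [binEx_sum]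
  exact Finset.sum_congr rfl fun j hj =>
    binEx_subset_ite (Finset.union_subset (h i hi) (h j hj)) p

lemma binVar_famCount {V : Finset ℕ} {I : Finset ι} {b : ι → Finset ℕ} (h : ∀ i ∈ I, b i ⊆ V)
    (p : ℝ) : binVar V p (famCount I b)
      = ∑ i ∈ I, ∑ j ∈ I, (p ^ (b i ∪ b j).card - p ^ ((b i).card + (b j).card)) := by
  rw [binVar_eq, binEx_famCount_sq h, binEx_famCount h, famMean, sq, Finset.sum_mul_sum,
    ← Finset.sum_sub_distrib]
  refine Finset.sum_congr rfl fun i _ => ?_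
  rw [← Finset.sum_sub_distrib]
  exact Finset.sum_congr rfl fun j _ => by rw [pow_add]

lemma famCov_nonneg (A B : Finset ℕ) {p : ℝ} (h0 : 0 ≤ p) (h1 : p ≤ 1) :
    0 ≤ p ^ (A ∪ B).card - p ^ (A.card + B.card) :=
  sub_nonneg.2 (pow_le_pow_of_le_one h0 h1 (Finset.card_union_le A B))

/-- All covariances of containment indicators are nonnegative, so discarding members can only lower
the variance. -/
lemma binVar_famCount_mono {V : Finset ℕ} {I I' : Finset ι} {b : ι → Finset ℕ} (hI : I' ⊆ I)
    (h : ∀ i ∈ I, b i ⊆ V) {p : ℝ} (h0 : 0 ≤ p) (h1 : p ≤ 1) :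
    binVar V p (famCount I' b) ≤ binVar V p (famCount I b) := by
  rw [binVar_famCount h, binVar_famCount fun i hi => h i (hI hi)]
  refine (Finset.sum_le_sum fun i _ => Finset.sum_le_sum_of_subset_of_nonneg hI
    fun j _ _ => famCov_nonneg _ _ h0 h1).trans ?_
  exact Finset.sum_le_sum_of_subset_of_nonneg hI
    fun i _ _ => Finset.sum_nonneg fun j _ => famCov_nonneg _ _ h0 h1

lemma binVar_famCount_le_xi {V : Finset ℕ} {I : Finset ι} {b : ι → Finset ℕ}
    (h : ∀ i ∈ I, b i ⊆ V) {p : ℝ} (h0 : 0 ≤ p) :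
    binVar V p (famCount I b) ≤ famXi I b p := by
  rw [binVar_famCount h]
  refine Finset.sum_le_sum fun i _ => Finset.sum_le_sum fun j _ => ?_
  split_ifs with hd
  · rw [Finset.card_union_of_disjoint hd, sub_self]
  · have : 0 ≤ p ^ ((b i).card + (b j).card) := pow_nonneg h0 _
    linarith

/-- For an intersecting pair the product of the two probabilities has at least one extra factor `p`,
so the covariance keeps a proportion at least 1 - p of the joint probability. -/
lemma xi_le_binVar_famCount {V : Finset ℕ} {I : Finset ι} {b : ι → Finset ℕ}
    (h : ∀ i ∈ I, b i ⊆ V) {p : ℝ} (h0 : 0 ≤ p) (h1 : p ≤ 1) :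
    (1 - p) * famXi I b p ≤ binVar V p (famCount I b) := by
  rw [binVar_famCount h, famXi, Finset.mul_sum]
  refine Finset.sum_le_sum fun i _ => ?_
  rw [Finset.mul_sum]
  refine Finset.sum_le_sum fun j _ => ?_
  split_ifs with hd
  · rw [mul_zero]; exact famCov_nonneg _ _ h0 h1
  · have hlt : (b i ∪ b j).card + 1 ≤ (b i).card + (b j).card := by
      rw [← Finset.card_union_add_card_inter]
      have := Finset.card_pos.2 (Finset.not_disjoint_iff_nonempty_inter.1 hd)
      omega
    have := pow_le_pow_of_le_one h0 h1 hlt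
    rw [pow_succ] at this
    linarith

open Classical in
/-- The number of `q`-tuples of members of the family that are contained in `S`, pairwise disjoint
and disjoint from `U`. -/
noncomputable def tupleCount (I : Finset ι) (b : ι → Finset ℕ) :
    ℕ → Finset ℕ → Finset ℕ → ℝ
  | 0, _, _ => 1
  | q + 1, U, S => ∑ α ∈ I, if Disjoint (b α) U ∧ b α ⊆ S then tupleCount I b q (U ∪ b α) S else 0

lemma tupleCount_nonneg (I : Finset ι) (b : ι → Finset ℕ) (q : ℕ) (U S : Finset ℕ) :
    0 ≤ tupleCount I b q U S := by
  induction q generalizing U with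
  | zero => simp [tupleCount]
  | succ q ih =>
    rw [tupleCount]
    refine Finset.sum_nonneg fun α _ => ?_
    split_ifs
    · exact ih _
    · exact le_rfl

/-- Disjoint sets are contained in R independently, so each further member of the tuple costs at
most one factor of the mean. The indicator of `U ⊆ S` records the members already chosen and makes
the induction close. -/
lemma binEx_tupleCount_le {V : Finset ℕ} {I : Finset ι} {b : ι → Finset ℕ}
    (h : ∀ i ∈ I, b i ⊆ V) {p : ℝ} (h0 : 0 ≤ p) (q : ℕ) {U : Finset ℕ} (hU : U ⊆ V) :
    binEx V p (fun S => if U ⊆ S then tupleCount I b q U S else 0)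
      ≤ p ^ U.card * famMean I b p ^ q := by
  induction q generalizing U with
  | zero => simp [tupleCount, binEx_subset_ite hU]
  | succ q ih =>
    have e : ∀ S, (if U ⊆ S then tupleCount I b (q + 1) U S else 0)
        = ∑ α ∈ I, if Disjoint (b α) U then
            (if U ∪ b α ⊆ S then tupleCount I b q (U ∪ b α) S else 0) else 0 := by
      intro S
      rw [tupleCount]
      split_ifs with hS
      · refine Finset.sum_congr rfl fun α _ => ?_
        by_cases hd : Disjoint (b α) U <;> by_cases hb : b α ⊆ S <;>
          simp [hd, hb, hS, Finset.union_subset_iff]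
      · symm
        refine Finset.sum_eq_zero fun α _ => ?_
        simp [hS, Finset.union_subset_iff]
    simp_rw [e]
    rw [binEx_sum, pow_succ', ← mul_assoc, famMean, Finset.mul_sum, Finset.sum_mul]
    refine Finset.sum_le_sum fun α hα => ?_
    have hm : 0 ≤ famMean I b p := Finset.sum_nonneg fun i _ => pow_nonneg h0 _
    by_cases hd : Disjoint (b α) U
    · simp only [hd, if_true]
      refine (ih (Finset.union_subset hU (h α hα))).trans (le_of_eq ?_)
      rw [Finset.card_union_of_disjoint hd.symm, pow_add]; rfl
    · simp only [hd, if_false, binEx_const]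
      have := pow_nonneg hm q
      unfold famMean at this
      positivity

open Classical in
-- Greedy choice: after `j` members at most `j * Δ` of `E` are blocked, so at least `y` choices
-- remain at each of the `q` steps.
lemma pow_le_tupleCount {I E : Finset ι} {b : ι → Finset ℕ} {S : Finset ℕ} (hE : E ⊆ I)
    (hS : ∀ α ∈ E, b α ⊆ S) {Δ y : ℝ} (hΔ0 : 0 ≤ Δ) (hy : 0 ≤ y)
    (hΔ : ∀ α ∈ E, ((E.filter fun β => ¬ Disjoint (b β) (b α)).card : ℝ) ≤ Δ)
    (q j : ℕ) (U : Finset ℕ) (hU : ((E.filter fun β => ¬ Disjoint (b β) U).card : ℝ) ≤ j * Δ)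
    (hx : y + ((j + q : ℝ) - 1) * Δ ≤ E.card) :
    y ^ q ≤ tupleCount I b q U S := by
  induction q generalizing j U with
  | zero => simp [tupleCount]
  | succ q ih =>
    rw [tupleCount]
    have hsplit := Finset.card_filter_add_card_filter_not (s := E) (fun β => Disjoint (b β) U)
    have hcard : y ≤ ((E.filter fun β => Disjoint (b β) U).card : ℝ) := by
      have h2 : ((E.filter fun β => Disjoint (b β) U).card : ℝ)
        + ((E.filter fun β => ¬ Disjoint (b β) U).card : ℝ) = E.card := by exact_mod_cast hsplit
      push_cast at hx
      have : 0 ≤ (q : ℝ) * Δ := by positivity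
      nlinarith
    calc y ^ (q + 1) = y * y ^ q := by ring
      _ ≤ ((E.filter fun β => Disjoint (b β) U).card : ℝ) * y ^ q :=
          mul_le_mul_of_nonneg_right hcard (pow_nonneg hy _)
      _ = ∑ α ∈ E.filter (fun β => Disjoint (b β) U), y ^ q := by simp
      _ ≤ ∑ α ∈ E.filter (fun β => Disjoint (b β) U),
            (if Disjoint (b α) U ∧ b α ⊆ S then tupleCount I b q (U ∪ b α) S else 0) := by
          refine Finset.sum_le_sum fun α hα => ?_
          rw [Finset.mem_filter] at hα
          rw [if_pos ⟨hα.2, hS α hα.1⟩]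
          refine ih (j + 1) (U ∪ b α) ?_ ?_
          · have hsub : (E.filter fun β => ¬ Disjoint (b β) (U ∪ b α))
                ⊆ (E.filter fun β => ¬ Disjoint (b β) U)
                  ∪ (E.filter fun β => ¬ Disjoint (b β) (b α)) := by
              intro β hβ
              simp only [Finset.mem_filter, Finset.mem_union, Finset.disjoint_union_right] at *
              tauto
            have h3 := (Finset.card_le_card hsub).trans (Finset.card_union_le _ _)
            have h4 : ((E.filter fun β => ¬ Disjoint (b β) (U ∪ b α)).card : ℝ)
              ≤ ((E.filter fun β => ¬ Disjoint (b β) U).card : ℝ)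
                + ((E.filter fun β => ¬ Disjoint (b β) (b α)).card : ℝ) := by exact_mod_cast h3
            have := hΔ α hα.1
            push_cast
            linarith
          · push_cast at hx ⊢
            linarith
      _ ≤ _ := Finset.sum_le_sum_of_subset_of_nonneg ((Finset.filter_subset _ _).trans hE)
          fun α _ _ => by
            split_ifs
            · exact tupleCount_nonneg _ _ _ _ _
            · exact le_rfl

open Classical in
/-- A Chernoff-type bound for the largest subfamily in which every member meets at most `Δ` members
(itself included). -/
lemma binPr_sparse_subfamily_le {V : Finset ℕ} {I : Finset ι} {b : ι → Finset ℕ}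
    (h : ∀ i ∈ I, b i ⊆ V) {p : ℝ} (h0 : 0 ≤ p) (h1 : p ≤ 1) {Δ x y : ℝ} (hΔ0 : 0 ≤ Δ)
    (hy : 0 < y) (q : ℕ) (hx : y + ((q : ℝ) - 1) * Δ ≤ x) :
    binPr V p (fun S => ∃ E ⊆ I, (∀ α ∈ E, b α ⊆ S) ∧
      (∀ α ∈ E, ((E.filter fun β => ¬ Disjoint (b β) (b α)).card : ℝ) ≤ Δ) ∧ x ≤ E.card)
      ≤ (famMean I b p / y) ^ q := by
  have hyq : 0 < y ^ q := pow_pos hy q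
  rw [div_pow, le_div_iff₀ hyq]
  have key := binEx_tupleCount_le h h0 q (Finset.empty_subset V)
  simp only [Finset.empty_subset, if_true, Finset.card_empty, pow_zero, one_mul] at key
  refine le_trans ?_ key
  unfold binPr
  rw [← binEx_mul_const]
  refine binEx_mono h0 h1 fun S _ => ?_
  split_ifs with hS
  · obtain ⟨E, hE, hb, hd, hc⟩ := hS
    rw [one_mul]
    refine pow_le_tupleCount hE hb hΔ0 hy.le hd q 0 ∅ ?_ ?_
    · simp
    · push_cast
      linarith
  · rw [zero_mul]
    exact tupleCount_nonneg _ _ _ _ _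

open Classical in
-- The disjoint-tuple bound with y = x/2 and tuple length ⌈x/(2Δ)⌉: half of `x` is spent on blocked
-- members.
lemma binPr_sparse_subfamily_le_rpow {V : Finset ℕ} {I : Finset ι} {b : ι → Finset ℕ}
    (h : ∀ i ∈ I, b i ⊆ V) {p : ℝ} (h0 : 0 ≤ p) (h1 : p ≤ 1) {Δ x ρ : ℝ} (hΔ0 : 0 < Δ)
    (hx : 0 < x) (hρ0 : 0 < ρ) (hρ1 : ρ ≤ 1) (hm : 2 * famMean I b p ≤ ρ * x) :
    binPr V p (fun S => ∃ E ⊆ I, (∀ α ∈ E, b α ⊆ S) ∧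
      (∀ α ∈ E, ((E.filter fun β => ¬ Disjoint (b β) (b α)).card : ℝ) ≤ Δ) ∧ x ≤ E.card)
      ≤ ρ ^ (x / (2 * Δ)) := by
  have hq : ((⌈x / (2 * Δ)⌉₊ : ℝ) - 1) * Δ ≤ x / 2 := by
    have h3 := Nat.ceil_lt_add_one (a := x / (2 * Δ)) (by positivity)
    have : (⌈x / (2 * Δ)⌉₊ : ℝ) - 1 ≤ x / (2 * Δ) := by linarith
    calc _ ≤ x / (2 * Δ) * Δ := mul_le_mul_of_nonneg_right this hΔ0.le
      _ = x / 2 := by field_simp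
  refine (binPr_sparse_subfamily_le h h0 h1 hΔ0.le (half_pos hx) ⌈x / (2 * Δ)⌉₊
    (by linarith)).trans ?_
  have hm0 : 0 ≤ famMean I b p := Finset.sum_nonneg fun i _ => pow_nonneg h0 _
  have hr : famMean I b p / (x / 2) ≤ ρ := by
    rw [div_le_iff₀ (half_pos hx)]; linarith
  calc _ ≤ ρ ^ ⌈x / (2 * Δ)⌉₊ := pow_le_pow_left₀ (by positivity) hr _
    _ = ρ ^ (⌈x / (2 * Δ)⌉₊ : ℝ) := (Real.rpow_natCast _ _).symm
    _ ≤ _ := Real.rpow_le_rpow_of_exponent_ge hρ0 hρ1 (Nat.le_ceil _)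

end Families

/-! ### Change of density and binomial point masses -/

/-- A change of measure from the density `p` to the density `p'`. -/
lemma binPr_tilt {V : Finset ℕ} {p p' : ℝ} (h0 : 0 < p) (h1 : p < 1) (h1' : p' ≤ 1)
    (P : Finset ℕ → Prop) :
    binPr V p' P ^ 2 ≤ binPr V p P * (1 + (p' - p) ^ 2 / (p * (1 - p))) ^ V.card := by
  classical
  have hq : 0 < 1 - p := by linarith
  have hq' : 0 ≤ 1 - p' := by linarith
  set w : Finset ℕ → ℝ := fun S => p ^ S.card * (1 - p) ^ (V.card - S.card) with hw
  set w' : Finset ℕ → ℝ := fun S => p' ^ S.card * (1 - p') ^ (V.card - S.card) with hw'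
  have hwpos : ∀ S, 0 < w S := fun S => by positivity
  -- The second moment of the likelihood ratio; it factorises over coordinates. Cauchy–Schwarz
  -- against it ends the proof.
  have e2 : ∑ S ∈ V.powerset, w' S ^ 2 / w S
      = (1 + (p' - p) ^ 2 / (p * (1 - p))) ^ V.card := by
    have h3 : 1 + (p' - p) ^ 2 / (p * (1 - p)) = p' ^ 2 / p + (1 - p') ^ 2 / (1 - p) := by
      field_simp; ring
    rw [h3, ← Finset.sum_pow_mul_eq_add_pow]
    refine Finset.sum_congr rfl fun S _ => ?_
    simp only [hw, hw', div_pow]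
    generalize 1 - p' = c
    field_simp
    rw [pow_right_comm p', pow_right_comm c]
  have e1 : binPr V p P = ∑ S ∈ V.powerset, w S * (if P S then 1 else 0) := by
    unfold binPr binEx; exact Finset.sum_congr rfl fun S _ => by congr
  have e0 : binPr V p' P = ∑ S ∈ V.powerset, w' S * (if P S then 1 else 0) := by
    unfold binPr binEx; exact Finset.sum_congr rfl fun S _ => by congr
  rw [e0, e1, ← e2]
  refine Finset.sum_sq_le_sum_mul_sum_of_sq_le_mul _ (fun S _ => ?_) (fun S _ => ?_)
    (fun S _ => le_of_eq ?_)
  · split_ifs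
    · simpa using (hwpos S).le
    · simp
  · have := hwpos S
    positivity
  · have := (hwpos S).ne'
    split_ifs
    · field_simp
    · simp

lemma le_binPr_card_inter {V U : Finset ℕ} (hU : U ⊆ V) {p : ℝ} (h0 : 0 ≤ p) (h1 : p ≤ 1)
    (M : ℕ) :
    (U.card.choose M : ℝ) * (p ^ M * (1 - p) ^ (U.card - M))
      ≤ binPr V p (fun S => M ≤ (S ∩ U).card) := by
  classical
  have e : binPr V p (fun S => M ≤ (S ∩ U).card)
      = binEx U p (fun T => if M ≤ T.card then 1 else 0) := by
    rw [← Finset.inter_eq_right.2 hU, ← binEx_inter V U p (fun T => if M ≤ T.card then 1 else 0)]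
    unfold binPr
    rw [Finset.inter_eq_right.2 hU]
    exact binEx_congr fun S _ => by congr
  rw [e, ← Finset.card_powersetCard, ← nsmul_eq_mul, ← Finset.sum_const]
  unfold binEx
  refine le_trans (Finset.sum_le_sum fun S hS => le_of_eq ?_)
    (Finset.sum_le_sum_of_subset_of_nonneg (s := U.powersetCard M) ?_ fun S hS _ => ?_)
  · rw [Finset.mem_powersetCard] at hS
    simp [hS.2]
  · intro S hS
    exact Finset.mem_powerset.2 (Finset.mem_powersetCard.1 hS).1
  · have : 0 ≤ 1 - p := by linarith
    dsimp only
    split_ifs <;> positivity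

/-! ### The random set `[n]_p` -/

lemma randomSubset_real_singleton {n : ℕ} (p : unitInterval) {S : Finset ℕ}
    (hS : S ⊆ Finset.Icc 1 n) :
    (randomSubset n p).real {(S : Set ℕ)} = (p : ℝ) ^ S.card * (1 - p : ℝ) ^ (n - S.card) := by
  have hS' : (S : Set ℕ) ⊆ Set.Icc 1 n := by
    rw [← Finset.coe_Icc]; exact_mod_cast hS
  unfold randomSubset
  rw [setBernoulli_real_singleton p hS' (Set.finite_Icc 1 n), Set.ncard_coe_finset]
  congr 2
  rw [← Finset.coe_Icc, ← Finset.coe_sdiff, Set.ncard_coe_finset, Finset.card_sdiff_of_subset hS]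
  simp

lemma randomSubset_ae_mem (n : ℕ) (p : unitInterval) :
    ∀ᵐ R ∂(randomSubset n p),
      R ∈ (fun S : Finset ℕ => (S : Set ℕ)) '' ((Finset.Icc 1 n).powerset : Set (Finset ℕ)) := by
  have := setBernoulli_ae_subset (u := Set.Icc 1 n) (p := p)
  unfold randomSubset
  filter_upwards [this] with R hR
  have hfin : R.Finite := (Set.finite_Icc 1 n).subset hR
  refine ⟨hfin.toFinset, ?_, by simp⟩
  rw [Finset.mem_coe, Finset.mem_powerset]
  intro x hx
  have := hR (hfin.mem_toFinset.1 hx)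
  simpa using this

instance (n : ℕ) (p : unitInterval) : IsProbabilityMeasure (randomSubset n p) := by
  unfold randomSubset; infer_instance

/-- The law is carried by the finitely many subsets of [n], so measure-theoretic integrals become
finite sums; from here on only `binEx` is needed. -/
lemma integral_randomSubset (n : ℕ) (p : unitInterval) (f : Set ℕ → ℝ) :
    ∫ R, f R ∂(randomSubset n p) = binEx (Finset.Icc 1 n) p (fun S => f S) := by
  classical
  set T : Finset (Set ℕ) := ((Finset.Icc 1 n).powerset).image
    (fun S : Finset ℕ => (S : Set ℕ)) with hT
  have hae : ∀ᵐ R ∂(randomSubset n p), R ∈ (T : Set (Set ℕ)) := by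
    rw [hT, Finset.coe_image]
    exact randomSubset_ae_mem n p
  have hres : (randomSubset n p).restrict (T : Set (Set ℕ)) = randomSubset n p :=
    Measure.restrict_eq_self_of_ae_mem hae
  rw [← hres, setIntegral_finset]
  · rw [hT, Finset.sum_image (fun _ _ _ _ h => Finset.coe_injective h)]
    unfold binEx
    refine Finset.sum_congr rfl fun S hS => ?_
    rw [randomSubset_real_singleton p (Finset.mem_powerset.1 hS)]
    simp
  · exact IntegrableOn.finset

lemma randomSubset_real (n : ℕ) (p : unitInterval) (P : Set ℕ → Prop) :
    (randomSubset n p).real {R | P R} = binPr (Finset.Icc 1 n) p (fun S => P S) := by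
  classical
  set T : Set (Set ℕ) :=
    (fun S : Finset ℕ => (S : Set ℕ)) '' ((Finset.Icc 1 n).powerset : Set (Finset ℕ)) with hT
  have hTf : T.Finite := (Finset.finite_toSet _).image _
  have hae := randomSubset_ae_mem n p
  have hs : {R | P R} =ᵐ[randomSubset n p] ({R | P R} ∩ T : Set (Set ℕ)) := by
    filter_upwards [hae] with R hR
    exact propext ⟨fun h => ⟨h, hR⟩, fun h => h.1⟩
  rw [measureReal_congr hs, ← integral_indicator_one (hTf.inter_of_right _).measurableSet,
    integral_randomSubset]
  unfold binPr
  refine binEx_congr fun S hS => ?_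
  have : (S : Set ℕ) ∈ T := ⟨S, by rw [Finset.mem_coe]; exact Finset.mem_powerset.2 hS, rfl⟩
  by_cases h : P S <;> simp [Set.indicator, this, h]

lemma apCount_coe (k n : ℕ) (S : Finset ℕ) : apCount k n S = famCount (apSets k n) id S := by
  rw [famCount_eq_card, apCount]
  simp only [Finset.coe_subset, id]

lemma apSets_subset {k n : ℕ} : ∀ A ∈ apSets k n, id A ⊆ Finset.Icc 1 n := fun A hA => by
  classical
  unfold apSets at hA
  exact Finset.mem_powerset.1 (Finset.mem_filter.1 hA).1

lemma apMean_eq_binEx (k n : ℕ) (p : unitInterval) :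
    apMean k n p = binEx (Finset.Icc 1 n) p (famCount (apSets k n) id) := by
  rw [apMean, integral_randomSubset]
  simp_rw [apCount_coe]

lemma apUpperTail_eq (k n : ℕ) (p : unitInterval) (x : ℝ) :
    apUpperTail k n p x
      = binPr (Finset.Icc 1 n) p (fun S => x ≤ famCount (apSets k n) id S) := by
  rw [apUpperTail, randomSubset_real]
  simp_rw [apCount_coe]

lemma apVar_eq (k n : ℕ) (p : unitInterval) :
    apVar k n p = binVar (Finset.Icc 1 n) p (famCount (apSets k n) id) := by
  have hmeas : AEMeasurable (apCount k n) (randomSubset n p) := by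
    classical
    have e : apCount k n = fun R => ∑ A ∈ apSets k n, if (A : Set ℕ) ⊆ R then (1 : ℝ) else 0 := by
      funext R
      rw [apCount, Finset.sum_boole]
    rw [e]
    refine (Finset.measurable_fun_sum _ fun A _ => ?_).aemeasurable
    refine Measurable.ite ?_ measurable_const measurable_const
    have : {R : Set ℕ | (A : Set ℕ) ⊆ R} = ⋂ a ∈ A, {R : Set ℕ | a ∈ R} := by
      ext R; simp [Set.subset_def]
    rw [this]
    exact Finset.measurableSet_biInter A fun a _ => measurableSet_setOfPred.2 (measurable_set_mem a)
  rw [apVar, variance_eq_integral hmeas, integral_randomSubset]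
  rw [← apMean, apMean_eq_binEx]
  simp_rw [apCount_coe]
  rfl


/-! ### Counting arithmetic progressions -/

/-- The progression `a, a + d, …, a + (k - 1) d`. -/
def apOf (k a d : ℕ) : Finset ℕ := (Finset.range k).image fun i => a + i * d

lemma mem_apOf {k a d x : ℕ} : x ∈ apOf k a d ↔ ∃ i < k, a + i * d = x := by
  simp [apOf]

lemma mem_apSets {k n : ℕ} {A : Finset ℕ} :
    A ∈ apSets k n ↔ A ⊆ Finset.Icc 1 n ∧ ∃ a d, 0 < d ∧ A = apOf k a d := by
  classical
  unfold apSets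
  rw [Finset.mem_filter, Finset.mem_powerset]
  rfl

lemma card_apOf {k a d : ℕ} (hd : 0 < d) : (apOf k a d).card = k := by
  rw [apOf, Finset.card_image_of_injective, Finset.card_range]
  intro i j hij
  simpa [hd.ne'] using hij

lemma card_of_mem_apSets {k n : ℕ} {A : Finset ℕ} (hA : A ∈ apSets k n) : A.card = k := by
  obtain ⟨-, a, d, hd, rfl⟩ := mem_apSets.1 hA
  exact card_apOf hd

lemma diff_le_of_apOf_subset {k n a d : ℕ} (hk : 2 ≤ k) (h : apOf k a d ⊆ Finset.Icc 1 n) :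
    1 ≤ a ∧ a ≤ n ∧ d ≤ n := by
  have h1 := Finset.mem_Icc.1 (h (mem_apOf.2 ⟨1, by omega, rfl⟩))
  have h0 := Finset.mem_Icc.1 (h (mem_apOf.2 ⟨0, by omega, rfl⟩))
  omega

lemma card_apSets_le {k n : ℕ} (hk : 2 ≤ k) : (apSets k n).card ≤ n * n := by
  have hsub : apSets k n ⊆ (Finset.Icc 1 n ×ˢ Finset.Icc 1 n).image fun x => apOf k x.1 x.2 := by
    intro A hA
    obtain ⟨hA, a, d, hd, rfl⟩ := mem_apSets.1 hA
    obtain ⟨h1, h2, h3⟩ := diff_le_of_apOf_subset hk hA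
    exact Finset.mem_image.2 ⟨(a, d), by simp; omega, rfl⟩
  refine (Finset.card_le_card hsub).trans (Finset.card_image_le.trans ?_)
  simp

lemma card_apSets_mem_le {k n : ℕ} (hk : 2 ≤ k) (v : ℕ) :
    ((apSets k n).filter fun A => v ∈ A).card ≤ k * n := by
  have hsub : ((apSets k n).filter fun A => v ∈ A)
      ⊆ (Finset.range k ×ˢ Finset.Icc 1 n).image fun x => apOf k (v - x.1 * x.2) x.2 := by
    intro A hA
    obtain ⟨hA, hv⟩ := Finset.mem_filter.1 hA
    obtain ⟨hA, a, d, hd, rfl⟩ := mem_apSets.1 hA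
    obtain ⟨h1, h2, h3⟩ := diff_le_of_apOf_subset hk hA
    obtain ⟨i, hi, hv⟩ := mem_apOf.1 hv
    refine Finset.mem_image.2 ⟨(i, d), by simp; omega, ?_⟩
    have : v - i * d = a := by omega
    simp only [this]
  refine (Finset.card_le_card hsub).trans (Finset.card_image_le.trans ?_)
  simp

/-- Two distinct points together with their positions in the progression determine its difference
and first term. -/
lemma card_apSets_mem_mem_le {k n : ℕ} {u v : ℕ} (huv : u ≠ v) :
    ((apSets k n).filter fun A => u ∈ A ∧ v ∈ A).card ≤ k ^ 2 := by
  have hsub : ((apSets k n).filter fun A => u ∈ A ∧ v ∈ A)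
      ⊆ (Finset.range k ×ˢ Finset.range k).image fun x =>
        apOf k (u - x.1 * (((v : ℤ) - u) / ((x.2 : ℤ) - x.1)).toNat)
          (((v : ℤ) - u) / ((x.2 : ℤ) - x.1)).toNat := by
    intro A hA
    obtain ⟨hA, hu, hv⟩ := Finset.mem_filter.1 hA
    obtain ⟨hA, a, d, hd, rfl⟩ := mem_apSets.1 hA
    obtain ⟨i, hi, hu⟩ := mem_apOf.1 hu
    obtain ⟨j, hj, hv⟩ := mem_apOf.1 hv
    refine Finset.mem_image.2 ⟨(i, j), by simp; omega, ?_⟩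
    have hij : (j : ℤ) - i ≠ 0 := by
      intro h
      have : i = j := by omega
      subst this
      exact huv (hu.symm.trans hv)
    have e : ((v : ℤ) - u) / ((j : ℤ) - i) = d := by
      have : (v : ℤ) - u = ((j : ℤ) - i) * d := by
        rw [← hu, ← hv]; push_cast; ring
      rw [this, Int.mul_ediv_cancel_left _ hij]
    have e' : (((v : ℤ) - u) / ((j : ℤ) - i)).toNat = d := by rw [e]; simp
    have : u - i * d = a := by omega
    simp only [e', this]
  refine (Finset.card_le_card hsub).trans (Finset.card_image_le.trans ?_)
  simp [sq]

/-- The progressions in `[n]` that meet `(n - h, n]` in exactly one point. -/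
noncomputable def tailAPs (k n h : ℕ) : Finset (Finset ℕ) :=
  (apSets k n).filter fun A => (A ∩ Finset.Ioc (n - h) n).card = 1

/-- The last point `n - s` is in the tail because `s < h`, and the previous ones drop out because `d
> h`; the bounds `d ≤ 2 * h` and `4 * k * h ≤ n` keep the first point positive. -/
lemma apOf_inter_tail {k n h s d : ℕ} (hk : 2 ≤ k) (hs : s < h) (hd : h < d) (hd' : d ≤ 2 * h)
    (hn : 4 * k * h ≤ n) :
    apOf k (n - s - (k - 1) * d) d ⊆ Finset.Icc 1 n ∧
      apOf k (n - s - (k - 1) * d) d ∩ Finset.Ioc (n - h) n = {n - s} := by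
  have hkd : (k - 1) * d + d = k * d := by
    conv_lhs => rw [← Nat.succ_mul]
    congr 1; omega
  have hk2 : k * d ≤ 2 * (k * h) := by nlinarith
  have hh : h ≤ k * h := by nlinarith
  have h4 : 4 * (k * h) ≤ n := by rw [← mul_assoc]; exact hn
  have hle : ∀ i < k, i * d ≤ (k - 1) * d := fun i hi => Nat.mul_le_mul_right d (by omega)
  have hlt : ∀ i < k, i ≠ k - 1 → i * d + d ≤ (k - 1) * d := fun i hi hne => by
    rw [← Nat.succ_mul]; exact Nat.mul_le_mul_right d (by omega)
  constructor
  · intro x hx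
    obtain ⟨i, hi, rfl⟩ := mem_apOf.1 hx
    have := hle i hi
    rw [Finset.mem_Icc]
    omega
  · ext x
    rw [Finset.mem_inter, Finset.mem_Ioc, Finset.mem_singleton, mem_apOf]
    constructor
    · rintro ⟨⟨i, hi, rfl⟩, h1, h2⟩
      by_cases hik : i = k - 1
      · subst hik; omega
      · have := hlt i hi hik
        omega
    · rintro rfl
      refine ⟨⟨k - 1, by omega, ?_⟩, ?_⟩ <;> omega

lemma sq_le_card_tailAPs {k n h : ℕ} (hk : 2 ≤ k) (hn : 4 * k * h ≤ n) :
    h * h ≤ (tailAPs k n h).card := by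
  have hmain : ((Finset.range h ×ˢ Finset.range h).image fun x =>
      apOf k (n - x.1 - (k - 1) * (h + 1 + x.2)) (h + 1 + x.2)) ⊆ tailAPs k n h := by
    intro A hA
    obtain ⟨⟨s, t⟩, hst, rfl⟩ := Finset.mem_image.1 hA
    simp only [Finset.mem_product, Finset.mem_range] at hst
    obtain ⟨h1, h2⟩ := apOf_inter_tail hk hst.1 (d := h + 1 + t) (by omega) (by omega) hn
    refine Finset.mem_filter.2 ⟨mem_apSets.2 ⟨h1, _, _, by omega, rfl⟩, ?_⟩
    dsimp only
    rw [h2, Finset.card_singleton]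
  refine le_trans (le_of_eq ?_) (Finset.card_le_card hmain)
  -- Injectivity: the unique tail point determines `s`, and then the second largest element
  -- determines `d`.
  rw [Finset.card_image_of_injOn, Finset.card_product, Finset.card_range]
  rintro ⟨s, t⟩ hst ⟨s', t'⟩ hst' heq
  simp only [Finset.coe_product, Finset.coe_range, Set.mem_prod, Set.mem_Iio] at hst hst'
  simp only at heq
  have i1 := (apOf_inter_tail hk hst.1 (d := h + 1 + t) (by omega) (by omega) hn)
  have i2 := (apOf_inter_tail hk hst'.1 (d := h + 1 + t') (by omega) (by omega) hn)
  have hs : s = s' := by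
    have h3 := i1.2.symm.trans ((congrArg (· ∩ Finset.Ioc (n - h) n) heq).trans i2.2)
    have h4 := Finset.singleton_injective h3
    have : h ≤ 4 * k * h := by nlinarith
    omega
  subst hs
  have aux : ∀ d d', h < d → d ≤ 2 * h → h < d' → d' ≤ 2 * h →
      apOf k (n - s - (k - 1) * d) d = apOf k (n - s - (k - 1) * d') d' → d' ≤ d := by
    intro d d' hd1 hd2 hd1' hd2' he
    have bound : ∀ e, e ≤ 2 * h → (k - 1) * e ≤ n - s := fun e he => by
      have h5 : (k - 1) * e ≤ k * (2 * h) := Nat.mul_le_mul (by omega) he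
      have h6 : h ≤ k * h := by nlinarith
      have h4 : 4 * (k * h) ≤ n := by rw [← mul_assoc]; exact hn
      have h7 : k * (2 * h) = 2 * (k * h) := by ring
      omega
    have b1 := bound d hd2
    have b2 := bound d' hd2'
    have hm : n - s - d ∈ apOf k (n - s - (k - 1) * d) d := by
      refine mem_apOf.2 ⟨k - 2, by omega, ?_⟩
      have : (k - 1) * d = (k - 2) * d + d := by
        rw [← Nat.succ_mul]; congr 1; omega
      omega
    rw [he] at hm
    obtain ⟨i, hi, hm⟩ := mem_apOf.1 hm
    have hik : i ≠ k - 1 := by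
      rintro rfl
      have : h ≤ 4 * k * h := by nlinarith
      omega
    have h5 : i * d' + d' ≤ (k - 1) * d' := by
      rw [← Nat.succ_mul]; exact Nat.mul_le_mul_right d' (by omega)
    omega
  have := aux (h + 1 + t) (h + 1 + t') (by omega) (by omega) (by omega) (by omega) heq
  have := aux (h + 1 + t') (h + 1 + t) (by omega) (by omega) (by omega) (by omega) heq.symm
  simp only [Prod.mk.injEq, true_and]
  omega


/-! ### Means and pair sums for progressions -/

lemma famMean_of_card {ι : Type*} {I : Finset ι} {b : ι → Finset ℕ} {j : ℕ}
    (hb : ∀ i ∈ I, (b i).card = j) (p : ℝ) : famMean I b p = I.card * p ^ j := by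
  rw [famMean, Finset.sum_congr rfl fun i hi => by rw [hb i hi], Finset.sum_const, nsmul_eq_mul]

lemma famMean_apSets (k n : ℕ) (p : ℝ) :
    famMean (apSets k n) id p = (apSets k n).card * p ^ k :=
  famMean_of_card (fun _ hA => card_of_mem_apSets hA) p

/-- A fixed progression meets at most k·kn others, and at most k²·k² in two or more points. Pairs of
traces `b A` sharing one point weigh at most p^(2j-1); all other intersecting pairs are bounded
crudely by p^j. General traces are needed because the estimate is also applied to progressions with
their tail point deleted. -/
lemma famXi_apSets_le {k n j : ℕ} (hk : 2 ≤ k) (hj : 1 ≤ j) {I : Finset (Finset ℕ)}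
    (hI : I ⊆ apSets k n) {b : Finset ℕ → Finset ℕ} (hb : ∀ A ∈ I, b A ⊆ A)
    (hbj : ∀ A ∈ I, (b A).card = j) {p : ℝ} (h0 : 0 ≤ p) (h1 : p ≤ 1) :
    famXi I b p ≤ I.card * p ^ j * (k ^ 2 * n * p ^ (j - 1) + k ^ 4) := by
  classical
  have hterm : ∀ A ∈ I, ∑ A' ∈ I, (if Disjoint (b A) (b A') then 0 else p ^ (b A ∪ b A').card)
      ≤ p ^ j * (k ^ 2 * n * p ^ (j - 1) + k ^ 4) := by
    intro A hA
    have hAk : A.card = k := card_of_mem_apSets (hI hA)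
    have hle : ∀ A' ∈ I, (if Disjoint (b A) (b A') then 0 else p ^ (b A ∪ b A').card)
        ≤ (∑ x ∈ A, if x ∈ A' then p ^ j * p ^ (j - 1) else 0)
          + ∑ z ∈ A.offDiag, if z.1 ∈ A' ∧ z.2 ∈ A' then p ^ j else 0 := by
      intro A' hA'
      have n1 : ∀ x ∈ A, 0 ≤ (if x ∈ A' then p ^ j * p ^ (j - 1) else 0) := fun x _ => by
        split_ifs <;> positivity
      have n2 : ∀ z ∈ A.offDiag, 0 ≤ (if z.1 ∈ A' ∧ z.2 ∈ A' then p ^ j else 0) := fun x _ => by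
        split_ifs <;> positivity
      split_ifs with hd
      · exact add_nonneg (Finset.sum_nonneg n1) (Finset.sum_nonneg n2)
      · have hne := Finset.not_disjoint_iff_nonempty_inter.1 hd
        have hcard := Finset.card_union_add_card_inter (b A) (b A')
        rw [hbj A hA, hbj A' hA'] at hcard
        rcases Nat.lt_or_ge 1 (b A ∩ b A').card with h | h
        · obtain ⟨x, hx, y, hy, hxy⟩ := Finset.one_lt_card.1 h
          rw [Finset.mem_inter] at hx hy
          have hmem : (x, y) ∈ A.offDiag :=
            Finset.mem_offDiag.2 ⟨hb A hA hx.1, hb A hA hy.1, hxy⟩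
          refine le_trans ?_ (le_add_of_nonneg_left (Finset.sum_nonneg n1))
          refine le_trans ?_ (Finset.single_le_sum n2 hmem)
          rw [if_pos ⟨hb A' hA' hx.2, hb A' hA' hy.2⟩]
          refine pow_le_pow_of_le_one h0 h1 ?_
          rw [← hbj A hA]
          exact Finset.card_le_card Finset.subset_union_left
        · obtain ⟨x, hx⟩ := hne
          rw [Finset.mem_inter] at hx
          refine le_trans ?_ (le_add_of_nonneg_right (Finset.sum_nonneg n2))
          refine le_trans ?_ (Finset.single_le_sum n1 (hb A hA hx.1))
          rw [if_pos (hb A' hA' hx.2), ← pow_add]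
          exact pow_le_pow_of_le_one h0 h1 (by omega)
    refine (Finset.sum_le_sum hle).trans ?_
    rw [Finset.sum_add_distrib, Finset.sum_comm, Finset.sum_comm (s := I) (t := A.offDiag)]
    have s1 : ∀ x ∈ A, ∑ A' ∈ I, (if x ∈ A' then p ^ j * p ^ (j - 1) else 0)
        ≤ (k * n : ℝ) * (p ^ j * p ^ (j - 1)) := by
      intro x _
      rw [← Finset.sum_filter, Finset.sum_const, nsmul_eq_mul]
      refine mul_le_mul_of_nonneg_right ?_ (by positivity)
      exact_mod_cast (Finset.card_le_card (Finset.filter_subset_filter _ hI)).trans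
        (card_apSets_mem_le hk x)
    have s2 : ∀ z ∈ A.offDiag, ∑ A' ∈ I, (if z.1 ∈ A' ∧ z.2 ∈ A' then p ^ j else 0)
        ≤ (k ^ 2 : ℝ) * p ^ j := by
      intro z hz
      rw [← Finset.sum_filter, Finset.sum_const, nsmul_eq_mul]
      refine mul_le_mul_of_nonneg_right ?_ (by positivity)
      exact_mod_cast (Finset.card_le_card (Finset.filter_subset_filter _ hI)).trans
        (card_apSets_mem_mem_le (Finset.mem_offDiag.1 hz).2.2)
    have t1 := Finset.sum_le_sum s1
    have t2 := Finset.sum_le_sum s2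
    rw [Finset.sum_const, nsmul_eq_mul, hAk] at t1
    rw [Finset.sum_const, nsmul_eq_mul, Finset.offDiag_card, hAk] at t2
    have hkk : ((k * k - k : ℕ) : ℝ) ≤ (k : ℝ) ^ 2 := by
      rw [sq]; exact_mod_cast Nat.sub_le _ _
    calc _ ≤ (k : ℝ) * ((k * n : ℝ) * (p ^ j * p ^ (j - 1)))
          + ((k * k - k : ℕ) : ℝ) * ((k ^ 2 : ℝ) * p ^ j) := add_le_add t1 t2
      _ ≤ (k : ℝ) * ((k * n : ℝ) * (p ^ j * p ^ (j - 1)))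
          + (k : ℝ) ^ 2 * ((k ^ 2 : ℝ) * p ^ j) := by gcongr
      _ = _ := by ring
  unfold famXi
  refine (Finset.sum_le_sum hterm).trans (le_of_eq ?_)
  rw [Finset.sum_const, nsmul_eq_mul]
  ring

lemma famMean_le_famXi {ι : Type*} {I : Finset ι} {b : ι → Finset ℕ}
    (hb : ∀ i ∈ I, (b i).Nonempty) {p : ℝ} (h0 : 0 ≤ p) : famMean I b p ≤ famXi I b p := by
  refine Finset.sum_le_sum fun i hi => ?_
  have := Finset.single_le_sum (s := I)
    (f := fun j => if Disjoint (b i) (b j) then (0 : ℝ) else p ^ (b i ∪ b j).card)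
    (fun j _ => by split_ifs <;> positivity) hi
  refine le_trans (le_of_eq ?_) this
  simp [(hb i hi).ne_empty]

lemma famXi_nonneg {ι : Type*} (I : Finset ι) (b : ι → Finset ℕ) {p : ℝ} (h0 : 0 ≤ p) :
    0 ≤ famXi I b p :=
  Finset.sum_nonneg fun i _ => Finset.sum_nonneg fun j _ => by split_ifs <;> positivity

/-- Cauchy–Schwarz for the degree sequence: (kN)² ≤ n Σ deg², and Σ deg² counts intersecting pairs
at most `k` times each, while each such pair has weight at least p^(2k-1) in the pair sum. It yields
Φ = O(φ(ε) np). -/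
lemma sq_famMean_apSets_le {k n : ℕ} (hk : 1 ≤ k) {p : ℝ} (h0 : 0 ≤ p) (h1 : p ≤ 1) :
    ((apSets k n).card * p ^ k) ^ 2 ≤ famXi (apSets k n) id p * (n * p) := by
  classical
  set H := apSets k n with hH
  set N : ℝ := (H.card : ℝ) with hN
  have hk0 : (0 : ℝ) < k := by exact_mod_cast hk
  have hdeg : ∑ x ∈ Finset.Icc 1 n, ∑ A ∈ H, (if x ∈ A then (1 : ℝ) else 0) = k * N := by
    rw [Finset.sum_comm, mul_comm, hN, ← nsmul_eq_mul, ← Finset.sum_const]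
    refine Finset.sum_congr rfl fun A hA => ?_
    rw [Finset.sum_boole, ← card_of_mem_apSets hA, Finset.filter_mem_eq_inter,
      Finset.inter_eq_right.2 (mem_apSets.1 hA).1]
  have hsq : (k * N) ^ 2 ≤ n * ∑ x ∈ Finset.Icc 1 n, (∑ A ∈ H, (if x ∈ A then (1 : ℝ) else 0)) ^ 2 := by
    rw [← hdeg]
    refine (sq_sum_le_card_mul_sum_sq).trans (le_of_eq ?_)
    simp
  have hpairs : ∑ x ∈ Finset.Icc 1 n, (∑ A ∈ H, (if x ∈ A then (1 : ℝ) else 0)) ^ 2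
      ≤ ∑ A ∈ H, ∑ A' ∈ H, (if Disjoint A A' then (0 : ℝ) else k) := by
    simp_rw [sq, Finset.sum_mul_sum]
    rw [Finset.sum_comm]
    refine Finset.sum_le_sum fun A hA => ?_
    rw [Finset.sum_comm]
    refine Finset.sum_le_sum fun A' hA' => ?_
    have e : ∀ x, ((if x ∈ A then (1 : ℝ) else 0) * if x ∈ A' then 1 else 0)
        = if x ∈ A ∩ A' then 1 else 0 := fun x => by
      by_cases hx : x ∈ A <;> by_cases hx' : x ∈ A' <;> simp [hx, hx']
    simp_rw [e]
    split_ifs with hd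
    · simp [Finset.disjoint_iff_inter_eq_empty.1 hd]
    · rw [Finset.sum_boole]
      rw [← card_of_mem_apSets hA]
      refine Nat.cast_le.2 (Finset.card_le_card fun x hx => ?_)
      exact (Finset.mem_inter.1 (Finset.mem_filter.1 hx).2).1
  have hxi : (∑ A ∈ H, ∑ A' ∈ H, (if Disjoint A A' then (0 : ℝ) else k)) * p ^ (2 * k - 1)
      ≤ k * famXi H id p := by
    unfold famXi
    rw [Finset.sum_mul, Finset.mul_sum]
    refine Finset.sum_le_sum fun A hA => ?_
    rw [Finset.sum_mul, Finset.mul_sum]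
    refine Finset.sum_le_sum fun A' hA' => ?_
    simp only [id]
    split_ifs with hd
    · simp
    · refine mul_le_mul_of_nonneg_left (pow_le_pow_of_le_one h0 h1 ?_) hk0.le
      have hcard := Finset.card_union_add_card_inter A A'
      rw [card_of_mem_apSets hA, card_of_mem_apSets hA'] at hcard
      have := Finset.card_pos.2 (Finset.not_disjoint_iff_nonempty_inter.1 hd)
      omega
  have hpow : (p ^ k) ^ 2 = p ^ (2 * k - 1) * p := by
    rw [← pow_succ, ← pow_mul]; congr 1; omega
  have hfin : (k : ℝ) ^ 2 * (N * p ^ k) ^ 2 ≤ k * (famXi H id p * (n * p)) := by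
    calc (k : ℝ) ^ 2 * (N * p ^ k) ^ 2 = (k * N) ^ 2 * (p ^ (2 * k - 1) * p) := by
          rw [← hpow]; ring
      _ ≤ (n * ∑ A ∈ H, ∑ A' ∈ H, (if Disjoint A A' then (0 : ℝ) else k))
            * (p ^ (2 * k - 1) * p) :=
          mul_le_mul_of_nonneg_right (hsq.trans (by gcongr)) (by positivity)
      _ = ((∑ A ∈ H, ∑ A' ∈ H, (if Disjoint A A' then (0 : ℝ) else k)) * p ^ (2 * k - 1))
            * (n * p) := by ring
      _ ≤ (k * famXi H id p) * (n * p) := mul_le_mul_of_nonneg_right hxi (by positivity)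
      _ = _ := by ring
  have hk1 : (1 : ℝ) ≤ k := by exact_mod_cast hk
  have hs : 0 ≤ (N * p ^ k) ^ 2 := sq_nonneg _
  have : (k : ℝ) * (N * p ^ k) ^ 2 ≤ famXi H id p * (n * p) := by
    refine le_of_mul_le_mul_left ?_ hk0
    calc _ = (k : ℝ) ^ 2 * (N * p ^ k) ^ 2 := by ring
      _ ≤ _ := hfin
  nlinarith


/-! ### Peeling and sampling stars -/

open Classical in
-- Repeatedly delete a point of degree at least `D` along with all progressions through it. The
-- deleted progressions form edge-disjoint stars, `c` naming the point that caused the deletion.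
lemma exists_peeling (G : Finset (Finset ℕ)) {D : ℝ} (hD : 0 < D) :
    ∃ G' ⊆ G, ∃ (S : Finset ℕ) (c : Finset ℕ → ℕ),
      (∀ v, ((G'.filter fun A => v ∈ A).card : ℝ) < D) ∧
      (∀ A ∈ G \ G', c A ∈ A ∧ c A ∈ S) ∧
      ∀ v ∈ S, D ≤ (((G \ G').filter fun A => c A = v).card : ℝ) := by
  induction hm : G.card using Nat.strong_induction_on generalizing G with
  | _ m ih =>
    by_cases hG : ∀ v, ((G.filter fun A => v ∈ A).card : ℝ) < D
    · exact ⟨G, subset_rfl, ∅, fun _ => 0, hG, by simp, by simp⟩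
    · push Not at hG
      obtain ⟨v, hv⟩ := hG
      have hlt : (G.filter fun A => v ∉ A).card < m := by
        have hpos : 0 < (G.filter fun A => v ∈ A).card := by
          have := hD.trans_le hv
          exact_mod_cast this
        have := Finset.card_filter_add_card_filter_not (s := G) (fun A => v ∈ A)
        omega
      obtain ⟨G', hG', S, c, h1, h2, h3⟩ := ih _ hlt (G.filter fun A => v ∉ A) rfl
      have hv' : ∀ A ∈ G', v ∉ A := fun A hA => (Finset.mem_filter.1 (hG' hA)).2
      refine ⟨G', hG'.trans (Finset.filter_subset _ _), insert v S,
        fun A => if v ∈ A then v else c A, h1, ?_, ?_⟩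
      · intro A hA
        rw [Finset.mem_sdiff] at hA
        by_cases hvA : v ∈ A
        · simp [hvA]
        · have := h2 A (Finset.mem_sdiff.2 ⟨Finset.mem_filter.2 ⟨hA.1, hvA⟩, hA.2⟩)
          simp [hvA, this.1, this.2]
      · intro u hu
        by_cases huv : u = v
        · subst huv
          refine hv.trans (Nat.cast_le.2 (Finset.card_le_card fun A hA => ?_))
          rw [Finset.mem_filter] at hA
          simp only [Finset.mem_filter, Finset.mem_sdiff]
          exact ⟨⟨hA.1, fun h => hv' A h hA.2⟩, by simp [hA.2]⟩
        · have huS : u ∈ S := by simpa [huv] using hu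
          refine (h3 u huS).trans (Nat.cast_le.2 (Finset.card_le_card fun A hA => ?_))
          simp only [Finset.mem_filter, Finset.mem_sdiff] at hA ⊢
          exact ⟨⟨hA.1.1.1, hA.1.2⟩, by simp [hA.1.1.2, hA.2]⟩

lemma binEx_mem_ite {S : Finset ℕ} {u : ℕ} (hu : u ∈ S) (t : ℝ) :
    binEx S t (fun Y => if u ∈ Y then 1 else 0) = t := by
  have := binEx_subset_ite (Finset.singleton_subset_iff.2 hu) t
  simpa using this

lemma binEx_mem_mem_ite_le {S : Finset ℕ} {u v : ℕ} (huv : u ≠ v) (t : ℝ) :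
    binEx S t (fun Y => if u ∈ Y ∧ v ∈ Y then 1 else 0) ≤ t ^ 2 := by
  by_cases h : {u, v} ⊆ S
  · have := binEx_subset_ite h t
    rw [Finset.card_pair huv] at this
    rw [← this]
    refine le_of_eq (binEx_congr fun Y _ => ?_)
    simp [Finset.insert_subset_iff]
  · have e : binEx S t (fun Y => if u ∈ Y ∧ v ∈ Y then 1 else 0) = binEx S t (fun _ => 0) := by
      refine binEx_congr fun Y hY => if_neg fun hh => h ?_
      rw [Finset.insert_subset_iff, Finset.singleton_subset_iff]
      exact ⟨hY hh.1, hY hh.2⟩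
    rw [e, binEx_const]
    exact sq_nonneg t

lemma binEx_card (S : Finset ℕ) (t : ℝ) : binEx S t (fun Y => (Y.card : ℝ)) = t * S.card := by
  have : binEx S t (fun Y => (Y.card : ℝ))
      = binEx S t (fun Y => ∑ u ∈ S, if u ∈ Y then (1 : ℝ) else 0) := by
    refine binEx_congr fun Y hY => ?_
    rw [Finset.sum_boole, Finset.filter_mem_eq_inter, Finset.inter_eq_right.2 hY]
  rw [this, binEx_sum, Finset.sum_congr rfl fun u hu => binEx_mem_ite hu t]
  simp [mul_comm]

lemma exists_binEx_le (V : Finset ℕ) {p : ℝ} (h0 : 0 ≤ p) (h1 : p ≤ 1) (f : Finset ℕ → ℝ) :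
    ∃ S ⊆ V, binEx V p f ≤ f S := by
  obtain ⟨S, hS, hmax⟩ := Finset.exists_max_image V.powerset f ⟨∅, by simp⟩
  refine ⟨S, Finset.mem_powerset.1 hS, ?_⟩
  rw [← binEx_const V p (f S)]
  exact binEx_mono h0 h1 fun T hT => hmax T (Finset.mem_powerset.2 hT)

open Classical in
-- Keep each centre with probability `t`. A progression survives with its own centre with
-- probability `t`, while a conflict created through a different centre needs two centres and costs
-- t². This thins conflicts to order `t * D`, yet the stars of surviving centres stay almost
-- complete, which is the term `D * Y.card`.
lemma exists_star_sample {k : ℕ} {E : Finset (Finset ℕ)} {S : Finset ℕ} {c : Finset ℕ → ℕ}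
    {D t M : ℝ} (hEk : ∀ A ∈ E, A.card = k) (hc : ∀ A ∈ E, c A ∈ A ∧ c A ∈ S)
    (hdeg : ∀ w, ((E.filter fun A => w ∈ A).card : ℝ) ≤ 2 * D) (hS : D * S.card ≤ E.card)
    (hD : 0 < D) (ht : 0 < t) (hkt : k * t ≤ 1 / 4) (hM : M = 8 * k * t * D) (hk : 1 ≤ k) :
    ∃ Y ⊆ S, ∃ E' ⊆ E, (D * Y.card + t * E.card) / 4 ≤ (E'.card : ℝ) ∧
      ∀ A ∈ E', c A ∈ Y ∧ ∀ w ∈ A, w ≠ c A → w ∉ Y ∧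
        ((E.filter fun B => w ∈ B ∧ c B ≠ c A ∧ c B ∈ Y).card : ℝ) ≤ M := by
  have hk0 : (1 : ℝ) ≤ k := by exact_mod_cast hk
  have ht1 : t ≤ 1 := by nlinarith
  have hMpos : 0 < M := by rw [hM]; positivity
  -- Two penalties: a second sampled point on `A`, and conflicts at non-central points, scaled so
  -- that more than `M` of them at one point already cost more than 1. Their expectations are at
  -- most kt² ≤ t/4 and exactly bounded by t/4 through the choice M = 8ktD.
  set pen : Finset ℕ → Finset ℕ → ℝ := fun A Y =>
    (∑ w ∈ A.erase (c A), if c A ∈ Y ∧ w ∈ Y then (1 : ℝ) else 0)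
    + M⁻¹ * ∑ w ∈ A.erase (c A), ∑ B ∈ E.filter (fun B => w ∈ B ∧ c B ≠ c A),
        if c A ∈ Y ∧ c B ∈ Y then (1 : ℝ) else 0 with hpen
  set f : Finset ℕ → Finset ℕ → ℝ := fun A Y => (if c A ∈ Y then (1 : ℝ) else 0) - pen A Y with hf
  have hEf : ∀ A ∈ E, t / 2 ≤ binEx S t (f A) := by
    intro A hA
    have hcard : ((A.erase (c A)).card : ℝ) ≤ k := by
      rw [← hEk A hA]; exact_mod_cast Finset.card_le_card (Finset.erase_subset _ _)
    have e1 : binEx S t (fun Y => ∑ w ∈ A.erase (c A), if c A ∈ Y ∧ w ∈ Y then (1 : ℝ) else 0)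
        ≤ k * t ^ 2 := by
      rw [binEx_sum]
      refine (Finset.sum_le_card_nsmul _ _ (t ^ 2) fun w hw =>
        binEx_mem_mem_ite_le (Finset.ne_of_mem_erase hw).symm t).trans ?_
      rw [nsmul_eq_mul]
      gcongr
    have e2 : binEx S t (fun Y => ∑ w ∈ A.erase (c A),
        ∑ B ∈ E.filter (fun B => w ∈ B ∧ c B ≠ c A), if c A ∈ Y ∧ c B ∈ Y then (1 : ℝ) else 0)
        ≤ k * (2 * D * t ^ 2) := by
      rw [binEx_sum]
      refine (Finset.sum_le_card_nsmul _ _ (2 * D * t ^ 2) fun w hw => ?_).trans ?_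
      · rw [binEx_sum]
        refine (Finset.sum_le_card_nsmul _ _ (t ^ 2) fun B hB =>
          binEx_mem_mem_ite_le (Finset.mem_filter.1 hB).2.2.symm t).trans ?_
        rw [nsmul_eq_mul]
        refine mul_le_mul_of_nonneg_right (le_trans ?_ (hdeg w)) (by positivity)
        refine Nat.cast_le.2 (Finset.card_le_card fun B hB => ?_)
        rw [Finset.mem_filter] at hB ⊢
        exact ⟨hB.1, hB.2.1⟩
      · rw [nsmul_eq_mul]
        gcongr
    have e3 : binEx S t (pen A) ≤ k * t ^ 2 + M⁻¹ * (k * (2 * D * t ^ 2)) := by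
      simp only [hpen]
      rw [binEx_add, binEx_const_mul]
      gcongr
    have e4 : M⁻¹ * (k * (2 * D * t ^ 2)) = t / 4 := by
      rw [hM]; field_simp; ring
    have e5 : binEx S t (f A) = t - binEx S t (pen A) := by
      simp only [hf]
      rw [binEx_sub, binEx_mem_ite (hc A hA).2]
    rw [e5]
    nlinarith
  -- Since D|S| ≤ |E|, subtracting D|Y|/4 lowers the expectation by at most t|E|/4, half of what is
  -- available. Both terms of the lower bound on |E'| come from one choice of `Y`.
  obtain ⟨Y, hY, hYf⟩ := exists_binEx_le S ht.le ht1
    (fun Y => (∑ A ∈ E, f A Y) - D / 4 * (Y.card : ℝ))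
  rw [binEx_sub, binEx_sum, binEx_const_mul, binEx_card] at hYf
  have hsum : (E.card : ℝ) * (t / 2) ≤ ∑ A ∈ E, binEx S t (f A) := by
    rw [← nsmul_eq_mul]
    exact Finset.card_nsmul_le_sum _ _ _ hEf
  refine ⟨Y, hY, E.filter fun A => 0 < f A Y, Finset.filter_subset _ _, ?_, ?_⟩
  · have hle : ∑ A ∈ E, f A Y ≤ ((E.filter fun A => 0 < f A Y).card : ℝ) := by
      rw [← Finset.sum_boole]
      refine Finset.sum_le_sum fun A _ => ?_
      have hp : 0 ≤ pen A Y := by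
        simp only [hpen]
        refine add_nonneg (Finset.sum_nonneg fun w _ => by split_ifs <;> norm_num)
          (mul_nonneg (inv_nonneg.2 hMpos.le) (Finset.sum_nonneg fun w _ =>
            Finset.sum_nonneg fun B _ => by split_ifs <;> norm_num))
      split_ifs with h
      · have : (if c A ∈ Y then (1 : ℝ) else 0) ≤ 1 := by split_ifs <;> norm_num
        simp only [hf]
        linarith
      · exact not_lt.1 h
    have : t * (D * S.card) ≤ t * E.card := mul_le_mul_of_nonneg_left hS ht.le
    nlinarith
  · intro A hA
    have hfA := (Finset.mem_filter.1 hA).2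
    have n1 : ∀ w ∈ A.erase (c A), (0 : ℝ) ≤ if c A ∈ Y ∧ w ∈ Y then (1 : ℝ) else 0 :=
      fun w _ => by split_ifs <;> norm_num
    have n2 : ∀ w ∈ A.erase (c A), (0 : ℝ) ≤ ∑ B ∈ E.filter (fun B => w ∈ B ∧ c B ≠ c A),
        if c A ∈ Y ∧ c B ∈ Y then (1 : ℝ) else 0 :=
      fun w _ => Finset.sum_nonneg fun B _ => by split_ifs <;> norm_num
    have m1 := Finset.sum_nonneg n1
    have m2 := mul_nonneg (inv_nonneg.2 hMpos.le) (Finset.sum_nonneg n2)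
    have hcY : c A ∈ Y := by
      by_contra hcY
      simp only [hf, hpen, hcY, if_false] at hfA m1 m2
      linarith
    simp only [hf, hpen, hcY, if_true, true_and] at hfA m1 m2 n1 n2
    refine ⟨hcY, fun w hw hwc => ⟨fun hwY => ?_, ?_⟩⟩
    · have := Finset.single_le_sum n1 (Finset.mem_erase.2 ⟨hwc, hw⟩)
      rw [if_pos hwY] at this
      linarith
    · have h1 := Finset.single_le_sum n2 (Finset.mem_erase.2 ⟨hwc, hw⟩)
      rw [Finset.sum_boole, Finset.filter_filter] at h1
      have h2 : M⁻¹ * _ ≤ _ := mul_le_mul_of_nonneg_left h1 (inv_nonneg.2 hMpos.le)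
      have h3 : M⁻¹ * ((E.filter fun B => (w ∈ B ∧ c B ≠ c A) ∧ c B ∈ Y).card : ℝ) ≤ 1 := by
        linarith
      rw [inv_mul_le_iff₀ hMpos, mul_one] at h3
      simpa only [and_assoc] using h3


/-! ### High degrees and stars -/

open Classical in
/-- The progressions in `R` contain a family of at least `θ` progressions that decompose into stars
with at least `D` progressions on average, while all degrees are at most `2 D`. -/
def HasStars (k n : ℕ) (D θ : ℝ) (R : Finset ℕ) : Prop :=
  ∃ E ⊆ apSets k n, (∀ A ∈ E, A ⊆ R) ∧ ∃ (S : Finset ℕ) (c : Finset ℕ → ℕ),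
    S ⊆ Finset.Icc 1 n ∧ (∀ A ∈ E, c A ∈ A ∧ c A ∈ S) ∧ D * S.card ≤ E.card ∧
    (∀ w, ((E.filter fun A => w ∈ A).card : ℝ) ≤ 2 * D) ∧ θ ≤ E.card

lemma card_biUnion_le_real {α β : Type*} [DecidableEq β] (s : Finset α) (F : α → Finset β) {c : ℝ}
    (h : ∀ a ∈ s, ((F a).card : ℝ) ≤ c) : ((s.biUnion F).card : ℝ) ≤ s.card * c := by
  calc ((s.biUnion F).card : ℝ) ≤ ∑ a ∈ s, ((F a).card : ℝ) := by
        exact_mod_cast Finset.card_biUnion_le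
    _ ≤ s.card * c := by
        rw [← nsmul_eq_mul]; exact Finset.sum_le_card_nsmul _ _ _ h

open Classical in
-- In the link of `v` the sets A \ {v} have mean count at most k n p^(k-1), and each meets at most
-- k³ others because two points lie in at most k² progressions. The disjoint-tuple bound applies,
-- followed by a union over `v`.
lemma binPr_degree_le {k n : ℕ} (hk : 2 ≤ k) {p : ℝ} (h0 : 0 ≤ p) (h1 : p ≤ 1) {D ρ : ℝ}
    (hD : 0 < D) (hρ0 : 0 < ρ) (hρ1 : ρ ≤ 1) (hρ : 2 * (k * n * p ^ (k - 1)) ≤ ρ * D) :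
    binPr (Finset.Icc 1 n) p (fun R => ∃ v ∈ Finset.Icc 1 n,
      D ≤ ((((apSets k n).filter fun A => A ⊆ R).filter fun A => v ∈ A).card : ℝ))
      ≤ n * ρ ^ (D / (2 * (k : ℝ) ^ 3)) := by
  refine (binPr_exists_le h0 h1 _ _).trans ?_
  have hn : ((Finset.Icc 1 n).card : ℝ) = n := by simp
  rw [← hn, ← nsmul_eq_mul]
  refine Finset.sum_le_card_nsmul _ _ _ fun v _ => ?_
  set I := (apSets k n).filter fun A => v ∈ A with hI
  have hIV : ∀ A ∈ I, A.erase v ⊆ Finset.Icc 1 n := fun A hA =>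
    (Finset.erase_subset _ _).trans (mem_apSets.1 (Finset.mem_filter.1 hA).1).1
  have hk0 : (0 : ℝ) < k := by exact_mod_cast (by omega : 0 < k)
  refine le_trans ?_ (binPr_sparse_subfamily_le_rpow (V := Finset.Icc 1 n) (I := I)
    (b := fun A => A.erase v) hIV h0 h1 (Δ := (k : ℝ) ^ 3) (by positivity) hD hρ0 hρ1 ?_)
  · refine binPr_mono h0 h1 fun R _ hR => ?_
    refine ⟨((apSets k n).filter fun A => A ⊆ R).filter fun A => v ∈ A, ?_, ?_, ?_, hR⟩
    · intro A hA
      simp only [hI, Finset.mem_filter] at hA ⊢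
      tauto
    · intro A hA
      simp only [Finset.mem_filter] at hA
      exact (Finset.erase_subset _ _).trans hA.1.2
    · intro A hA
      simp only [Finset.mem_filter] at hA
      have hAk := card_of_mem_apSets hA.1.1
      refine le_trans (Nat.cast_le.2 (Finset.card_le_card (t := (A.erase v).biUnion fun w =>
        (apSets k n).filter fun B => v ∈ B ∧ w ∈ B) fun B hB => ?_)) ?_
      · simp only [Finset.mem_filter, Finset.not_disjoint_iff] at hB
        obtain ⟨hB, w, hwB, hwA⟩ := hB
        simp only [Finset.mem_biUnion, Finset.mem_filter]
        exact ⟨w, hwA, hB.1.1, hB.2, Finset.mem_of_mem_erase hwB⟩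
      · refine (card_biUnion_le_real _ _ (c := (k : ℝ) ^ 2) fun w hw => ?_).trans ?_
        · exact_mod_cast card_apSets_mem_mem_le (Finset.ne_of_mem_erase hw).symm
        · have : ((A.erase v).card : ℝ) ≤ k := by
            rw [← hAk]; exact_mod_cast Finset.card_le_card (Finset.erase_subset _ _)
          calc _ ≤ (k : ℝ) * k ^ 2 := by gcongr
            _ = _ := by ring
  · have hb : ∀ A ∈ I, (A.erase v).card = k - 1 := fun A hA => by
      rw [Finset.card_erase_of_mem (Finset.mem_filter.1 hA).2,
        card_of_mem_apSets (Finset.mem_filter.1 hA).1]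
    rw [famMean_of_card hb]
    have : (I.card : ℝ) ≤ k * n := by exact_mod_cast card_apSets_mem_le hk v
    refine le_trans ?_ hρ
    gcongr

open Classical in
lemma card_filter_card_inter_eq_one_le {k n : ℕ} (hk : 2 ≤ k) (Y : Finset ℕ) :
    (((apSets k n).filter fun A => (A ∩ Y).card = 1).card : ℝ) ≤ Y.card * (k * n) := by
  refine le_trans (Nat.cast_le.2 (Finset.card_le_card (t := Y.biUnion fun v =>
    (apSets k n).filter fun A => v ∈ A) fun A hA => ?_)) (card_biUnion_le_real _ _ fun v _ => ?_)
  · rw [Finset.mem_filter] at hA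
    obtain ⟨v, hv⟩ := Finset.card_pos.1 (by rw [hA.2]; norm_num : 0 < (A ∩ Y).card)
    rw [Finset.mem_inter] at hv
    exact Finset.mem_biUnion.2 ⟨v, hv.2, Finset.mem_filter.2 ⟨hA.1, hv.1⟩⟩
  · exact_mod_cast card_apSets_mem_le hk v

open Classical in
-- The sampled centres form the set `Y` over which a union bound is taken. Progressions with a
-- common centre conflict at most k² times per point; the hypothesis 1 ≤ tD absorbs this into the
-- conflicts counted by sampling.
lemma HasStars.exists_sample {k n : ℕ} (hk : 2 ≤ k) {D θ t : ℝ} {R : Finset ℕ} (hD : 0 < D)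
    (hθ : 0 < θ) (ht : 0 < t) (htD : 1 ≤ t * D) (hkt : k * t ≤ 1 / 4) (h : HasStars k n D θ R) :
    ∃ Y ∈ (Finset.Icc 1 n).powerset.erase ∅,
      ∃ E ⊆ (apSets k n).filter (fun A => (A ∩ Y).card = 1), (∀ A ∈ E, A \ Y ⊆ R) ∧
        (∀ A ∈ E, ((E.filter fun B => ¬ Disjoint (B \ Y) (A \ Y)).card : ℝ)
          ≤ 9 * k ^ 3 * t * D) ∧ (D * Y.card + t * θ) / 4 ≤ E.card := by
  obtain ⟨E, hE, hER, S, c, hSn, hc, hDS, hdeg, hθE⟩ := h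
  have hEk : ∀ A ∈ E, A.card = k := fun A hA => card_of_mem_apSets (hE hA)
  obtain ⟨Y, hYS, E', hE', hcard, hprop⟩ := exists_star_sample hEk hc hdeg hDS hD ht hkt rfl
    (by omega : 1 ≤ k)
  have htθ : t * θ ≤ t * E.card := mul_le_mul_of_nonneg_left hθE ht.le
  have hk1 : (1 : ℝ) ≤ k := by exact_mod_cast (by omega : 1 ≤ k)
  have hpos : (0 : ℝ) < E'.card := by
    refine lt_of_lt_of_le ?_ hcard
    have : 0 < t * θ := by positivity
    have : 0 ≤ D * (Y.card : ℝ) := by positivity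
    linarith
  have hinter : ∀ A ∈ E', A ∩ Y = {c A} := by
    intro A hA
    ext w
    rw [Finset.mem_inter, Finset.mem_singleton]
    constructor
    · rintro ⟨hwA, hwY⟩
      by_contra hne
      exact ((hprop A hA).2 w hwA hne).1 hwY
    · rintro rfl
      exact ⟨(hc A (hE' hA)).1, (hprop A hA).1⟩
  refine ⟨Y, ?_, E', ?_, ?_, ?_, by linarith⟩
  · rw [Finset.mem_erase, Finset.mem_powerset]
    refine ⟨?_, hYS.trans hSn⟩
    rintro rfl
    obtain ⟨A, hA⟩ := Finset.card_pos.1 (by exact_mod_cast hpos : 0 < E'.card)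
    simpa using (hprop A hA).1
  · intro A hA
    rw [Finset.mem_filter, hinter A hA]
    exact ⟨hE (hE' hA), by simp⟩
  · exact fun A hA => Finset.sdiff_subset.trans (hER A (hE' hA))
  · intro A hA
    refine le_trans (Nat.cast_le.2 (Finset.card_le_card (t := (A.erase (c A)).biUnion fun w =>
      ((apSets k n).filter fun B => c A ∈ B ∧ w ∈ B) ∪
        (E.filter fun B => w ∈ B ∧ c B ≠ c A ∧ c B ∈ Y)) fun B hB => ?_)) ?_
    · simp only [Finset.mem_filter, Finset.not_disjoint_iff, Finset.mem_sdiff] at hB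
      obtain ⟨hB, w, ⟨hwB, hwY⟩, hwA, -⟩ := hB
      have hwc : w ≠ c A := fun h => hwY (h ▸ (hprop A hA).1)
      simp only [Finset.mem_biUnion, Finset.mem_union, Finset.mem_filter]
      refine ⟨w, Finset.mem_erase.2 ⟨hwc, hwA⟩, ?_⟩
      by_cases hcB : c B = c A
      · exact Or.inl ⟨hE (hE' hB), hcB ▸ (hc B (hE' hB)).1, hwB⟩
      · exact Or.inr ⟨hE' hB, hwB, hcB, (hprop B hB).1⟩
    · refine (card_biUnion_le_real _ _ (c := (k : ℝ) ^ 2 + 8 * k * t * D) fun w hw => ?_).trans ?_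
      · refine le_trans (Nat.cast_le.2 (Finset.card_union_le _ _)) ?_
        push_cast
        refine add_le_add ?_ ?_
        · exact_mod_cast card_apSets_mem_mem_le (Finset.ne_of_mem_erase hw).symm
        · exact ((hprop A hA).2 w (Finset.mem_of_mem_erase hw) (Finset.ne_of_mem_erase hw)).2
      · have h1 : ((A.erase (c A)).card : ℝ) ≤ k := by
          rw [← hEk A (hE' hA)]; exact_mod_cast Finset.card_le_card (Finset.erase_subset _ _)
        have hk2 : (k : ℝ) ≤ k ^ 2 := by nlinarith
        calc _ ≤ (k : ℝ) * (k ^ 2 + 8 * k * t * D) := by gcongr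
          _ ≤ (k : ℝ) * (k ^ 2 * (t * D) + 8 * k ^ 2 * (t * D)) := by
              have i1 : (k : ℝ) ^ 2 ≤ k ^ 2 * (t * D) := le_mul_of_one_le_right (by positivity) htD
              have i2 : 8 * k * t * D ≤ 8 * (k : ℝ) ^ 2 * (t * D) := by
                rw [mul_assoc (8 * (k : ℝ))]; gcongr
              gcongr
          _ = _ := by ring

/-- The sum is (1 + n⁻³)ⁿ - 1 ≤ exp(n⁻²) - 1. The factor n⁻² later also pays for the number of
dyadic levels. -/
lemma sum_powerset_erase_le {n : ℕ} (hn : 1 ≤ n) :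
    ∑ Y ∈ (Finset.Icc 1 n).powerset.erase ∅, (1 / (n : ℝ) ^ 3) ^ Y.card ≤ 2 / (n : ℝ) ^ 2 := by
  have hn1 : (1 : ℝ) ≤ n := by exact_mod_cast hn
  have h1 := Finset.add_sum_erase (Finset.Icc 1 n).powerset (fun Y => (1 / (n : ℝ) ^ 3) ^ Y.card)
    (Finset.empty_mem_powerset _)
  have h2 := Finset.sum_pow_mul_eq_add_pow (1 / (n : ℝ) ^ 3) 1 (Finset.Icc 1 n)
  simp only [one_pow, mul_one, Nat.card_Icc, add_tsub_cancel_right] at h2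
  rw [h2] at h1
  simp only [Finset.card_empty, pow_zero] at h1
  have hx : (n : ℝ) * (1 / n ^ 3) = 1 / (n : ℝ) ^ 2 := by field_simp
  have hx1 : 1 / (n : ℝ) ^ 2 ≤ 1 := by
    rw [div_le_one (by positivity)]; exact one_le_pow₀ hn1
  have hx0 : 0 ≤ 1 / (n : ℝ) ^ 2 := by positivity
  have h3 : (1 / (n : ℝ) ^ 3 + 1) ^ n ≤ Real.exp (1 / (n : ℝ) ^ 2) := by
    rw [← hx, Real.exp_nat_mul]
    exact pow_le_pow_left₀ (by positivity) (Real.add_one_le_exp _) _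
  have h4 := Real.abs_exp_sub_one_le (x := 1 / (n : ℝ) ^ 2) (by rw [abs_of_nonneg hx0]; exact hx1)
  rw [abs_of_nonneg hx0] at h4
  have h5 := le_abs_self (Real.exp (1 / (n : ℝ) ^ 2) - 1)
  have : 2 / (n : ℝ) ^ 2 = 2 * (1 / (n : ℝ) ^ 2) := by ring
  linarith

/-- For fixed `Y` the mean number of traces is at most |Y| k n p^(k-1), a fraction ρ/8 of D|Y|. The
disjoint-tuple exponent (D|Y| + tθ)/(72k³tD) splits into a part proportional to |Y|, which pays n⁻³
per centre by `hρn`, and the part θ/(72k³D), which does not depend on `Y`. -/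
lemma binPr_hasStars_le {k n : ℕ} (hk : 2 ≤ k) (hn : 1 ≤ n) {p : ℝ} (h0 : 0 ≤ p) (h1 : p ≤ 1)
    {D θ t ρ : ℝ} (hD : 0 < D) (hθ : 0 < θ) (ht : 0 < t) (htD : 1 ≤ t * D) (hkt : k * t ≤ 1 / 4)
    (hρ0 : 0 < ρ) (hρ1 : ρ ≤ 1) (hρ : 8 * (k * n * p ^ (k - 1)) ≤ ρ * D)
    (hρn : ρ ^ (1 / (72 * k ^ 3 * t)) ≤ 1 / (n : ℝ) ^ 3) :
    binPr (Finset.Icc 1 n) p (HasStars k n D θ)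
      ≤ 2 / (n : ℝ) ^ 2 * ρ ^ (θ / (72 * k ^ 3 * D)) := by
  classical
  have hk0 : (0 : ℝ) < k := by exact_mod_cast (by omega : 0 < k)
  refine (binPr_mono h0 h1 fun R _ hR => hR.exists_sample hk hD hθ ht htD hkt).trans
    ((binPr_exists_le h0 h1 _ _).trans ?_)
  have hY : ∀ Y ∈ (Finset.Icc 1 n).powerset.erase ∅, binPr (Finset.Icc 1 n) p (fun R =>
      ∃ E ⊆ (apSets k n).filter (fun A => (A ∩ Y).card = 1), (∀ A ∈ E, A \ Y ⊆ R) ∧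
        (∀ A ∈ E, ((E.filter fun B => ¬ Disjoint (B \ Y) (A \ Y)).card : ℝ)
          ≤ 9 * k ^ 3 * t * D) ∧ (D * Y.card + t * θ) / 4 ≤ E.card)
      ≤ (1 / (n : ℝ) ^ 3) ^ Y.card * ρ ^ (θ / (72 * k ^ 3 * D)) := by
    intro Y _
    have hV : ∀ A ∈ (apSets k n).filter (fun A => (A ∩ Y).card = 1),
        A \ Y ⊆ Finset.Icc 1 n := fun A hA =>
      Finset.sdiff_subset.trans (mem_apSets.1 (Finset.mem_filter.1 hA).1).1
    have hx : 0 < (D * Y.card + t * θ) / 4 := by positivity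
    have hm : 2 * famMean ((apSets k n).filter (fun A => (A ∩ Y).card = 1)) (fun A => A \ Y) p
        ≤ ρ * ((D * Y.card + t * θ) / 4) := by
      have hb : ∀ A ∈ (apSets k n).filter (fun A => (A ∩ Y).card = 1), (A \ Y).card = k - 1 := by
        intro A hA
        rw [Finset.mem_filter] at hA
        have := Finset.card_sdiff_add_card_inter A Y
        rw [hA.2, card_of_mem_apSets hA.1] at this
        omega
      rw [famMean_of_card hb]
      have i1 := card_filter_card_inter_eq_one_le (n := n) hk Y
      calc 2 * ((((apSets k n).filter (fun A => (A ∩ Y).card = 1)).card : ℝ) * p ^ (k - 1))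
          ≤ 2 * ((Y.card * (k * n)) * p ^ (k - 1)) := by gcongr
        _ = (8 * (k * n * p ^ (k - 1))) * Y.card / 4 := by ring
        _ ≤ (ρ * D) * Y.card / 4 := by gcongr
        _ ≤ ρ * ((D * Y.card + t * θ) / 4) := by
            have : 0 ≤ ρ * (t * θ) := by positivity
            linarith
    refine (binPr_sparse_subfamily_le_rpow (V := Finset.Icc 1 n) hV h0 h1
      (Δ := 9 * (k : ℝ) ^ 3 * t * D) (by positivity) hx hρ0 hρ1 hm).trans (le_of_eq_of_le ?_
        (mul_le_mul_of_nonneg_right (pow_le_pow_left₀ (by positivity) hρn Y.card) (by positivity)))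
    rw [← Real.rpow_mul_natCast hρ0.le, ← Real.rpow_add hρ0]
    congr 1
    field_simp
    ring
  refine (Finset.sum_le_sum hY).trans ?_
  rw [← Finset.sum_mul]
  exact mul_le_mul_of_nonneg_right (sum_powerset_erase_le hn) (by positivity)


/-! ### Decomposition of the upper tail event -/

open Classical in
/-- `R` contains a family of at least `x` progressions with all degrees below `r`. -/
def HasSparse (k n : ℕ) (r x : ℝ) (R : Finset ℕ) : Prop :=
  ∃ G ⊆ apSets k n, (∀ A ∈ G, A ⊆ R) ∧ (∀ v, ((G.filter fun A => v ∈ A).card : ℝ) < r) ∧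
    x ≤ G.card

open Classical in
-- Peel from the top scale downwards. At scale D = 2^j r all degrees are already below 2D, so the
-- peeled part is a family of stars as in `HasStars`; in the absence of that event fewer than `θ j`
-- progressions are lost.
lemma exists_stars_or_sparse {k n : ℕ} {r x : ℝ} (hr : 0 < r) (m : ℕ) (θ : ℕ → ℝ) {R : Finset ℕ}
    (hx : x + ∑ i ∈ Finset.range m, θ i ≤ famCount (apSets k n) id R)
    (hdeg : ¬ ∃ v ∈ Finset.Icc 1 n,
      2 ^ m * r ≤ ((((apSets k n).filter fun A => A ⊆ R).filter fun A => v ∈ A).card : ℝ))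
    (hstars : ¬ ∃ i ∈ Finset.range m, HasStars k n (2 ^ i * r) (θ i) R) :
    HasSparse k n r x R := by
  have key : ∀ d ≤ m, ∃ G ⊆ apSets k n, (∀ A ∈ G, A ⊆ R) ∧
      (∀ v, ((G.filter fun A => v ∈ A).card : ℝ) < 2 ^ (m - d) * r) ∧
      x + ∑ i ∈ Finset.range (m - d), θ i ≤ G.card := by
    intro d hd
    induction d with
    | zero =>
      refine ⟨(apSets k n).filter fun A => A ⊆ R, Finset.filter_subset _ _,
        fun A hA => (Finset.mem_filter.1 hA).2, fun v => ?_, ?_⟩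
      · by_cases hv : v ∈ Finset.Icc 1 n
        · by_contra hcon
          exact hdeg ⟨v, hv, not_lt.1 hcon⟩
        · have : (((apSets k n).filter fun A => A ⊆ R).filter fun A => v ∈ A) = ∅ := by
            refine Finset.filter_eq_empty_iff.2 fun A hA hvA => hv ?_
            exact (mem_apSets.1 (Finset.mem_filter.1 hA).1).1 hvA
          rw [this]
          simp only [Finset.card_empty, Nat.cast_zero]
          positivity
      · rw [famCount_eq_card] at hx
        simpa using hx
    | succ d ih =>
      obtain ⟨G, hG, hGR, hGdeg, hGx⟩ := ih (by omega)
      have hmd : m - d = m - (d + 1) + 1 := by omega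
      set j := m - (d + 1) with hj
      rw [hmd] at hGdeg hGx
      obtain ⟨G', hG', S, c, h1, h2, h3⟩ := exists_peeling G (D := 2 ^ j * r) (by positivity)
      refine ⟨G', hG'.trans hG, fun A hA => hGR A (hG' hA), h1, ?_⟩
      have hE : ((G \ G').card : ℝ) < θ j := by
        by_contra hcon
        refine hstars ⟨j, Finset.mem_range.2 (by omega), G \ G',
          Finset.sdiff_subset.trans hG, fun A hA => hGR A (Finset.sdiff_subset hA), S, c, ?_, h2,
          ?_, fun w => ?_, not_lt.1 hcon⟩
        · intro v hv
          have hpos : 0 < ((G \ G').filter fun A => c A = v).card := by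
            have : 0 < 2 ^ j * r := by positivity
            exact_mod_cast this.trans_le (h3 v hv)
          obtain ⟨A, hA⟩ := Finset.card_pos.1 hpos
          rw [Finset.mem_filter] at hA
          rw [← hA.2]
          exact (mem_apSets.1 (hG (Finset.sdiff_subset hA.1))).1 (h2 A hA.1).1
        · have := Finset.card_nsmul_le_sum S
            (fun v => (((G \ G').filter fun A => c A = v).card : ℝ)) _ h3
          rw [nsmul_eq_mul] at this
          have e := Finset.card_eq_sum_card_fiberwise (s := G \ G') (f := c) (t := S)
            (fun A hA => (h2 A hA).2)
          rw [e, mul_comm]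
          push_cast
          exact this
        · have := (hGdeg w).le
          rw [pow_succ] at this
          refine le_trans (Nat.cast_le.2 (Finset.card_le_card
            (Finset.filter_subset_filter _ Finset.sdiff_subset))) (this.trans (le_of_eq (by ring)))
      rw [Finset.sum_range_succ] at hGx
      have hc : ((G \ G').card : ℝ) + G'.card = G.card := by
        exact_mod_cast Finset.card_sdiff_add_card_eq_card hG'
      linarith
  obtain ⟨G, h1, h2, h3, h4⟩ := key m le_rfl
  refine ⟨G, h1, h2, ?_, ?_⟩
  · simpa using h3
  · simpa using h4

open Classical in
-- With degrees below `r` each progression meets at most k r members. Tuples of length about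
-- εμ/(4kr) block at most εμ/4 members, which leaves (1 + ε/4)μ choices at each step.
lemma binPr_hasSparse_le {k n : ℕ} (hk : 1 ≤ k) {p : ℝ} (h0 : 0 < p) (h1 : p ≤ 1) {r ε : ℝ}
    (hr : 0 < r) (hε : 0 < ε) (hN : 0 < (apSets k n).card) :
    binPr (Finset.Icc 1 n) p (HasSparse k n r ((1 + ε / 2) * ((apSets k n).card * p ^ k)))
      ≤ Real.exp (-(ε * ((apSets k n).card * p ^ k) / (4 * (k * r)) * Real.log (1 + ε / 4))) := by
  set μ : ℝ := (apSets k n).card * p ^ k with hμ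
  have hN0 : (0 : ℝ) < (apSets k n).card := by exact_mod_cast hN
  have hμ0 : 0 < μ := by positivity
  have hk0 : (0 : ℝ) < k := by exact_mod_cast hk
  set Q : ℝ := ε * μ / (4 * (k * r)) with hQ
  have hQ0 : 0 < Q := by positivity
  have hq : (1 + ε / 4) * μ + ((⌈Q⌉₊ : ℝ) - 1) * (k * r) ≤ (1 + ε / 2) * μ := by
    have := Nat.ceil_lt_add_one hQ0.le
    have h3 : ((⌈Q⌉₊ : ℝ) - 1) * (k * r) ≤ Q * (k * r) :=
      mul_le_mul_of_nonneg_right (by linarith) (by positivity)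
    have h4 : Q * (k * r) = ε * μ / 4 := by rw [hQ]; field_simp
    linarith
  have hε1 : 0 < 1 + ε / 4 := by positivity
  have hmain := binPr_sparse_subfamily_le (V := Finset.Icc 1 n) (I := apSets k n) (b := id)
    apSets_subset h0.le h1 (Δ := k * r) (by positivity) (by positivity : 0 < (1 + ε / 4) * μ) _ hq
  refine le_trans (binPr_mono h0.le h1 fun R _ hR => ?_) (hmain.trans ?_)
  · obtain ⟨G, hG, hGR, hdeg, hx⟩ := hR
    refine ⟨G, hG, hGR, fun A hA => ?_, hx⟩
    refine le_trans (Nat.cast_le.2 (Finset.card_le_card (t := A.biUnion fun w =>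
      G.filter fun B => w ∈ B) fun B hB => ?_)) ?_
    · simp only [Finset.mem_filter, Finset.not_disjoint_iff, id] at hB
      obtain ⟨hB, w, hwB, hwA⟩ := hB
      exact Finset.mem_biUnion.2 ⟨w, hwA, Finset.mem_filter.2 ⟨hB, hwB⟩⟩
    · refine (card_biUnion_le_real _ _ (c := r) fun w _ => (hdeg w).le).trans ?_
      rw [card_of_mem_apSets (hG hA)]
  · rw [famMean_apSets, ← hμ]
    have e : μ / ((1 + ε / 4) * μ) = (1 + ε / 4)⁻¹ := by field_simp
    rw [e, inv_pow, neg_eq_neg_one_mul, mul_comm, Real.exp_mul, ← Real.rpow_natCast]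
    have hl : 0 < Real.log (1 + ε / 4) := Real.log_pos (by linarith)
    rw [← Real.exp_mul, ← Real.rpow_neg hε1.le, Real.rpow_def_of_pos hε1]
    refine Real.exp_le_exp.2 ?_
    have := mul_le_mul_of_nonneg_left (Nat.le_ceil Q) hl.le
    linarith

/-- The union bound over the three ways in which `X` can be large. -/
lemma binPr_upper_tail_le {k n : ℕ} (hk : 2 ≤ k) {p : ℝ} (h0 : 0 < p) (h1 : p ≤ 1) {r ε : ℝ}
    (hr : 0 < r) (hε : 0 < ε) (hN : 0 < (apSets k n).card) (m : ℕ) (θ : ℕ → ℝ)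
    (hθ : ∑ i ∈ Finset.range m, θ i ≤ ε / 2 * ((apSets k n).card * p ^ k))
    {ρ : ℝ} (hρ0 : 0 < ρ) (hρ1 : ρ ≤ 1) (hρ : 2 * (k * n * p ^ (k - 1)) ≤ ρ * (2 ^ m * r)) :
    binPr (Finset.Icc 1 n) p
      (fun R => (1 + ε) * ((apSets k n).card * p ^ k) ≤ famCount (apSets k n) id R)
      ≤ Real.exp (-(ε * ((apSets k n).card * p ^ k) / (4 * (k * r)) * Real.log (1 + ε / 4)))
        + n * ρ ^ (2 ^ m * r / (2 * (k : ℝ) ^ 3))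
        + ∑ i ∈ Finset.range m,
            binPr (Finset.Icc 1 n) p (HasStars k n (2 ^ i * r) (θ i)) := by
  classical
  refine le_trans (binPr_mono h0.le h1 (P' := fun R =>
    (HasSparse k n r ((1 + ε / 2) * ((apSets k n).card * p ^ k)) R ∨ ∃ v ∈ Finset.Icc 1 n,
      2 ^ m * r ≤ ((((apSets k n).filter fun A => A ⊆ R).filter fun A => v ∈ A).card : ℝ)) ∨
      ∃ i ∈ Finset.range m, HasStars k n (2 ^ i * r) (θ i) R) fun R _ hR => ?_) ?_
  · by_cases hd : ∃ v ∈ Finset.Icc 1 n,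
      2 ^ m * r ≤ ((((apSets k n).filter fun A => A ⊆ R).filter fun A => v ∈ A).card : ℝ)
    · exact Or.inl (Or.inr hd)
    · by_cases hs : ∃ i ∈ Finset.range m, HasStars k n (2 ^ i * r) (θ i) R
      · exact Or.inr hs
      · exact Or.inl (Or.inl (exists_stars_or_sparse hr m θ (by linarith) hd hs))
  · refine (binPr_or_le h0.le h1 _ _).trans (add_le_add ((binPr_or_le h0.le h1 _ _).trans
      (add_le_add ?_ ?_)) (binPr_exists_le h0.le h1 _ _))
    · exact binPr_hasSparse_le (by omega) h0 h1 hr hε hN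
    · exact binPr_degree_le hk h0.le h1 (by positivity) hρ0 hρ1 hρ


/-! ### The function `φ` -/

lemma phi_le_mul_log {x : ℝ} (hx : 0 ≤ x) : phi x ≤ x * Real.log (1 + x) := by
  have := Real.log_le_sub_one_of_pos (by linarith : 0 < 1 + x)
  unfold phi
  linarith

lemma phi_le_sq {x : ℝ} (hx : 0 ≤ x) : phi x ≤ x ^ 2 := by
  have := Real.log_le_sub_one_of_pos (by linarith : 0 < 1 + x)
  refine (phi_le_mul_log hx).trans ?_
  rw [sq]
  exact mul_le_mul_of_nonneg_left (by linarith) hx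

lemma sq_div_le_phi {x : ℝ} (hx : 0 ≤ x) : x ^ 2 / (x + 2) ≤ phi x := by
  have h := Real.le_log_one_add_of_nonneg hx
  have h2 : (1 + x) * (2 * x / (x + 2)) - x = x ^ 2 / (x + 2) := by field_simp; ring
  rw [← h2]
  unfold phi
  have := mul_le_mul_of_nonneg_left h (by linarith : 0 ≤ 1 + x)
  linarith

lemma phi_pos {x : ℝ} (hx : 0 < x) : 0 < phi x :=
  lt_of_lt_of_le (by positivity) (sq_div_le_phi hx.le)

lemma log_one_add_le_four_mul {x : ℝ} (hx : 0 ≤ x) :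
    Real.log (1 + x) ≤ 4 * Real.log (1 + x / 4) := by
  have h := one_add_mul_le_pow (a := x / 4) (by linarith) 4
  have : (4 : ℝ) * Real.log (1 + x / 4) = Real.log ((1 + x / 4) ^ 4) := by
    rw [Real.log_pow]; norm_num
  rw [this]
  refine Real.log_le_log (by linarith) (le_trans (le_of_eq ?_) h)
  push_cast; ring

lemma exists_mul_sq_le_exp (C : ℝ) {a : ℝ} (ha : 0 < a) :
    ∃ y₀ : ℝ, ∀ y, y₀ ≤ y → C * y ^ 2 ≤ Real.exp (a * y) := by
  refine ⟨max 1 (6 * C / a ^ 3), fun y hy => ?_⟩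
  have h1 : 1 ≤ y := (le_max_left _ _).trans hy
  have h2 : 6 * C / a ^ 3 ≤ y := (le_max_right _ _).trans hy
  rw [div_le_iff₀ (by positivity)] at h2
  have h3 := Real.pow_div_factorial_le_exp (a * y) (by positivity) 3
  refine le_trans ?_ h3
  rw [le_div_iff₀ (by positivity)]
  have : ((3 : ℕ).factorial : ℝ) = 6 := by norm_num [Nat.factorial]
  rw [this]
  have := mul_le_mul_of_nonneg_right h2 (sq_nonneg y)
  nlinarith

/-! ### Sizes of the parameters in the upper bound -/

section Sizes

variable {k : ℕ} {n p ε N D : ℝ}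

lemma log_lam (hn : 0 < n) (hp : 0 < p) (hk : 1 ≤ k) :
    Real.log (n * p ^ (k - 1)) = Real.log n - ((k : ℝ) - 1) * Real.log (1 / p) := by
  rw [Real.log_mul hn.ne' (by positivity), Real.log_pow, one_div, Real.log_inv]
  push_cast [Nat.cast_sub hk]
  ring

lemma log_sqrt_mean (hp : 0 < p) (hε : 0 < ε) (hN : 0 < N) :
    Real.log √(ε * (N * p ^ k))
      = (Real.log ε + Real.log N - k * Real.log (1 / p)) / 2 := by
  rw [Real.log_sqrt (by positivity), Real.log_mul hε.ne' (by positivity),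
    Real.log_mul hN.ne' (by positivity), Real.log_pow, one_div, Real.log_inv]
  ring

lemma le_log_of_sq_le {c : ℝ} (hn : 0 < n) (hc : 0 < c) (hN : c * n ^ 2 ≤ N) :
    Real.log c + 2 * Real.log n ≤ Real.log N := by
  have : Real.log (c * n ^ 2) = Real.log c + 2 * Real.log n := by
    rw [Real.log_mul hc.ne' (by positivity), Real.log_pow]; norm_num
  rw [← this]
  exact Real.log_le_log (by positivity) hN

lemma log_div_lam (hn : 0 < n) (hp : 0 < p) (hk : 1 ≤ k) (hD : 0 < D) :
    Real.log (D / (8 * k * (n * p ^ (k - 1))))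
      = Real.log D - Real.log (8 * k) - (Real.log n - ((k : ℝ) - 1) * Real.log (1 / p)) := by
  have hk0 : (0 : ℝ) < k := by exact_mod_cast hk
  rw [Real.log_div hD.ne' (by positivity), Real.log_mul (by positivity) (by positivity),
    log_lam hn hp hk]
  ring

lemma one_le_log_div_lam (hn : 0 < n) (hp : 0 < p) (hk : 1 ≤ k)
    (hD : 5184 * (k : ℝ) ^ 4 * (n * p ^ (k - 1)) ≤ D) :
    1 ≤ Real.log (D / (8 * k * (n * p ^ (k - 1)))) := by
  have hk1 : (1 : ℝ) ≤ k := by exact_mod_cast hk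
  have hlam : 0 < n * p ^ (k - 1) := by positivity
  have hk4 : (k : ℝ) ≤ k ^ 4 := le_self_pow₀ hk1 (by norm_num)
  rw [Real.le_log_iff_exp_le, le_div_iff₀ (by positivity)]
  · have he : Real.exp 1 ≤ 3 := by linarith [Real.exp_one_lt_d9]
    refine le_trans ?_ hD
    calc Real.exp 1 * (8 * k * (n * p ^ (k - 1))) ≤ 3 * (8 * k * (n * p ^ (k - 1))) := by gcongr
      _ = 24 * k * (n * p ^ (k - 1)) := by ring
      _ ≤ 5184 * (k : ℝ) ^ 4 * (n * p ^ (k - 1)) := by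
          gcongr
          linarith
  · have : 0 < D := lt_of_lt_of_le (by positivity) hD
    positivity

/-- Above the degree threshold, the union bound over the centres of the stars is affordable. -/
lemma exists_le_mul_log_div_lam (k : ℕ) (hk : 3 ≤ k) :
    ∃ y₀ : ℝ, ∀ n p ε N D : ℝ, 1 < n → y₀ ≤ Real.log n → 0 < p → p < 1 →
      n ^ (-(1 / 16) : ℝ) ≤ ε → 1 / (64 * (k : ℝ) ^ 2) * n ^ 2 ≤ N →
      5184 * (k : ℝ) ^ 4 ≤ D → 5184 * (k : ℝ) ^ 4 * (n * p ^ (k - 1)) ≤ D →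
      phi ε * √(ε * (N * p ^ k)) / (ε * Real.log (1 / p)) ≤ D →
      216 * (k : ℝ) ^ 3 * Real.log n ≤ D * Real.log (D / (8 * k * (n * p ^ (k - 1)))) := by
  have hk3 : (3 : ℝ) ≤ k := by exact_mod_cast hk
  set c : ℝ := 1 / (64 * (k : ℝ) ^ 2) with hc
  have hc0 : 0 < c := by positivity
  obtain ⟨y₁, hy₁⟩ := exists_mul_sq_le_exp (216 * (k : ℝ) ^ 3) (by norm_num : (0 : ℝ) < 1 / 2)
  obtain ⟨y₂, hy₂⟩ := exists_mul_sq_le_exp (216 * (k : ℝ) ^ 3 * (3 * Real.exp (-(Real.log c / 2))))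
    (by norm_num : (0 : ℝ) < 31 / 352)
  refine ⟨max (max 1 (24 * k * Real.log (8 * k))) (max y₁ y₂), ?_⟩
  intro n p ε N D hn hy hp hp1 hε hN hD1 hD2 hD3
  have hn0 : 0 < n := by linarith
  simp only [max_le_iff] at hy
  obtain ⟨⟨hy1, hyk⟩, hyy₁, hyy₂⟩ := hy
  set y := Real.log n with hydef
  set L := Real.log (1 / p) with hL
  have hL0 : 0 < L := Real.log_pos (by rw [lt_div_iff₀ hp]; linarith)
  have hk4 : (1 : ℝ) ≤ k ^ 4 := one_le_pow₀ (by linarith)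
  have hD0 : 1 ≤ D := by linarith
  have hDpos : 0 < D := by linarith
  have hl1 := one_le_log_div_lam hn0 hp (by omega) hD2
  have hleq := log_div_lam hn0 hp (by omega : 1 ≤ k) hDpos
  rw [← hydef, ← hL] at hleq
  set l := Real.log (D / (8 * k * (n * p ^ (k - 1)))) with hl
  have hlogD : 0 ≤ Real.log D := Real.log_nonneg hD0
  -- it is enough to have a large `D`
  have hlarge : 216 * (k : ℝ) ^ 3 * y ≤ D → 216 * (k : ℝ) ^ 3 * y ≤ D * l := fun h =>
    h.trans (le_mul_of_one_le_right hDpos.le hl1)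
  -- If p > n^(-1/(2k)) then n p^(k-1) ≥ √n, and `D` alone beats log n.
  by_cases hA : 2 * k * L < y
  · -- dense case
    apply hlarge
    refine le_trans ?_ hD2
    have hkL : ((k : ℝ) - 1) * L ≤ y / 2 := by nlinarith
    have h1 : Real.exp (1 / 2 * y) ≤ n * p ^ (k - 1) := by
      rw [← Real.le_log_iff_exp_le (by positivity), log_lam hn0 hp (by omega)]
      linarith
    have h2 := hy₁ y hyy₁
    have h3 : 216 * (k : ℝ) ^ 3 * y ≤ 216 * (k : ℝ) ^ 3 * y ^ 2 := by
      gcongr; nlinarith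
    have h4 : n * p ^ (k - 1) ≤ 5184 * (k : ℝ) ^ 4 * (n * p ^ (k - 1)) :=
      le_mul_of_one_le_left (by positivity) (by linarith)
    linarith
  · push Not at hA
    -- If D ≥ λ p^(-1/6), the logarithm is at least L/12 ≥ log n/(24k), and 5184 k⁴ = 216 k³ · 24 k
    -- explains the lower bound on `D`.
    by_cases hB : y - ((k : ℝ) - 1) * L + L / 6 ≤ Real.log D
    · have hl2 : L / 12 ≤ l := by
        have : Real.log (8 * k) ≤ L / 12 := by
          have h5 : (k : ℝ) * (24 * Real.log (8 * k)) ≤ k * (2 * L) := by linarith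
          have := le_of_mul_le_mul_left h5 (by linarith)
          linarith
        linarith
      have hkp : (0 : ℝ) < k := by linarith
      have hl3 : y ≤ 24 * k * l := by
        have : k * (L / 12) ≤ k * l := mul_le_mul_of_nonneg_left hl2 hkp.le
        linarith
      calc 216 * (k : ℝ) ^ 3 * y ≤ 216 * (k : ℝ) ^ 3 * (24 * k * l) := by gcongr
        _ = 5184 * (k : ℝ) ^ 4 * l := by ring
        _ ≤ D * l := by gcongr
    · -- sparse case with large mean
      push Not at hB
      apply hlarge
      have hε0 : 0 < ε := lt_of_lt_of_le (by positivity) hε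
      have hN0 : 0 < N := lt_of_lt_of_le (by positivity) hN
      have hkL : 3 * L ≤ k * L := mul_le_mul_of_nonneg_right hk3 hL0.le
      have hLy : 11 / 6 * L ≤ y := by linarith
      have hlogε : -(1 / 16) * y ≤ Real.log ε := by
        rw [hydef, ← Real.log_rpow hn0]
        exact Real.log_le_log (by positivity) hε
      have hlogN := le_log_of_sq_le hn0 hc0 hN
      have hsq := log_sqrt_mean (k := k) hp hε0 hN0
      set Q := √(ε * (N * p ^ k)) with hQ
      have hQ0 : 0 < Q := Real.sqrt_pos.2 (by positivity)
      -- `Q ≥ √ε √c n^{2/11}`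
      have hQlow : Real.log ε / 2 + Real.log c / 2 + 2 / 11 * y ≤ Real.log Q := by
        rw [hsq]; linarith
      -- For ε ≤ 1 the bound is ε Q, of order ε^(3/2) n^(2/11), and 31/352 = 2/11 - (3/2)(1/16) is
      -- what ε ≥ n^(-1/16) leaves.
      have hmain : Real.exp (31 / 352 * y) ≤ 3 * Real.exp (-(Real.log c / 2)) * (D * L) := by
        have h1 : ε / (ε + 2) * Q ≤ D * L := by
          have h2 := sq_div_le_phi hε0.le
          rw [div_le_iff₀ (by positivity)] at hD3
          have h3 : ε ^ 2 / (ε + 2) * Q ≤ D * (ε * L) :=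
            (mul_le_mul_of_nonneg_right h2 hQ0.le).trans hD3
          have h4 : ε ^ 2 / (ε + 2) * Q = ε * (ε / (ε + 2) * Q) := by ring
          rw [h4] at h3
          refine le_of_mul_le_mul_left ?_ hε0
          linarith
        have h5 : Real.exp (31 / 352 * y + Real.log c / 2) ≤ 3 * (ε / (ε + 2) * Q) := by
          rcases le_total ε 1 with h | h
          · have h6 : ε * Q ≤ 3 * (ε / (ε + 2) * Q) := by
              have : ε ≤ 3 * (ε / (ε + 2)) := by
                rw [mul_div_assoc', le_div_iff₀ (by positivity)]; nlinarith
              calc ε * Q ≤ 3 * (ε / (ε + 2)) * Q := by gcongr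
                _ = _ := by ring
            refine le_trans ?_ h6
            rw [← Real.le_log_iff_exp_le (by positivity), Real.log_mul hε0.ne' hQ0.ne']
            linarith
          · have h6 : Q ≤ 3 * (ε / (ε + 2) * Q) := by
              have : 1 ≤ 3 * (ε / (ε + 2)) := by
                rw [mul_div_assoc', le_div_iff₀ (by positivity)]; linarith
              calc Q ≤ 3 * (ε / (ε + 2)) * Q := le_mul_of_one_le_left hQ0.le this
                _ = _ := by ring
            refine le_trans ?_ h6
            rw [← Real.le_log_iff_exp_le hQ0]
            have := Real.log_nonneg h
            linarith
        have h7 : Real.exp (31 / 352 * y)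
            = Real.exp (-(Real.log c / 2)) * Real.exp (31 / 352 * y + Real.log c / 2) := by
          rw [← Real.exp_add]; congr 1; ring
        rw [h7]
        calc _ ≤ Real.exp (-(Real.log c / 2)) * (3 * (D * L)) := by
              gcongr; linarith
          _ = _ := by ring
      have h8 := (hy₂ y hyy₂).trans hmain
      have hE : 0 < 3 * Real.exp (-(Real.log c / 2)) := by positivity
      have h9 : 216 * (k : ℝ) ^ 3 * y ^ 2 ≤ D * L := by
        refine le_of_mul_le_mul_left ?_ hE
        linarith
      have h10 : D * L ≤ D * y := by gcongr; linarith
      refine le_of_mul_le_mul_right ?_ (by linarith : 0 < y)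
      calc _ = 216 * (k : ℝ) ^ 3 * y ^ 2 := by ring
        _ ≤ _ := h9.trans h10

/-- The exponents in the union bound are at least of the order of `Φ`. -/
lemma exists_mul_le_mul_log_div_lam (k : ℕ) (hk : 3 ≤ k) {γ : ℝ} (hγ : 0 < γ) :
    ∃ c : ℝ, 0 < c ∧ ∀ n p ε N D M F : ℝ, 1 < n → 0 < p → p < 1 → 0 < ε →
      1 / (64 * (k : ℝ) ^ 2) * n ^ 2 ≤ N → 0 < D →
      5184 * (k : ℝ) ^ 4 * (n * p ^ (k - 1)) ≤ D → √(ε * (N * p ^ k)) ≤ M →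
      √(ε * (N * p ^ k)) * √(√(ε * (N * p ^ k)) / D) ≤ M →
      γ * F ≤ phi ε * (n * p) → F ≤ √(ε * (N * p ^ k)) * Real.log (1 / p) →
      c * F ≤ M * Real.log (D / (8 * k * (n * p ^ (k - 1)))) := by
  have hk3 : (3 : ℝ) ≤ k := by exact_mod_cast hk
  set c : ℝ := 1 / (64 * (k : ℝ) ^ 2) with hc
  have hc0 : 0 < c := by positivity
  have hl8 : 0 < Real.log (8 * k) := Real.log_pos (by linarith)
  -- One constant per case: logarithm of order L, Φ of order Q by the variance bound, and Q/D at
  -- least of order p^(-1/6).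
  set c₁ : ℝ := 1 / (6 * (1 + Real.log (8 * k))) with hc₁
  set c₂ : ℝ := γ * Real.exp (Real.log c / 2) with hc₂
  set c₃ : ℝ := Real.exp (Real.log c / 4) / 12 with hc₃
  have hc₁0 : 0 < c₁ := by positivity
  have hc₂0 : 0 < c₂ := by positivity
  have hc₃0 : 0 < c₃ := by positivity
  refine ⟨min c₁ (min c₂ c₃), by positivity, ?_⟩
  intro n p ε N D M F hn hp hp1 hε0 hN hD0 hD2 hM1 hM2 hF1 hF2
  have hn0 : 0 < n := by linarith
  have hN0 : 0 < N := lt_of_lt_of_le (by positivity) hN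
  set Q := √(ε * (N * p ^ k)) with hQ
  have hQ0 : 0 < Q := Real.sqrt_pos.2 (by positivity)
  set y := Real.log n with hydef
  set L := Real.log (1 / p) with hL
  have hL0 : 0 < L := Real.log_pos (by rw [lt_div_iff₀ hp]; linarith)
  have hl1 := one_le_log_div_lam hn0 hp (by omega) hD2
  have hleq := log_div_lam hn0 hp (by omega : 1 ≤ k) hD0
  rw [← hydef, ← hL] at hleq
  set l := Real.log (D / (8 * k * (n * p ^ (k - 1)))) with hl
  have hM0 : 0 < M := hQ0.trans_le hM1
  rcases le_total F 0 with hF0 | hF0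
  · have h1 : min c₁ (min c₂ c₃) * F ≤ 0 := mul_nonpos_of_nonneg_of_nonpos (by positivity) hF0
    have h2 : 0 ≤ M * l := by positivity
    linarith
  have hkL : 3 * L ≤ k * L := mul_le_mul_of_nonneg_right hk3 hL0.le
  have hlogN := le_log_of_sq_le hn0 hc0 hN
  have hsq := log_sqrt_mean (k := k) hp hε0 hN0
  rw [← hQ, ← hL] at hsq
  rw [← hydef] at hlogN
  by_cases hB : y - ((k : ℝ) - 1) * L + L / 6 ≤ Real.log D
  · have h1 : c₁ * L ≤ l := by
      rw [hc₁, one_div, inv_mul_le_iff₀ (by positivity)]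
      nlinarith
    calc _ ≤ c₁ * (Q * L) := mul_le_mul (min_le_left _ _) hF2 hF0 hc₁0.le
      _ = Q * (c₁ * L) := by ring
      _ ≤ M * l := by gcongr
  · push Not at hB
    -- Now D < λ p^(-1/6). If ε^(3/2) ≤ p^(k/2-1), then ε² np = O(Q), so Φ = O(Q) and no logarithm
    -- is needed.
    by_cases hC : 3 / 2 * Real.log ε ≤ -((k : ℝ) / 2 - 1) * L
    · have h1 : Real.exp (Real.log c / 2) * (ε ^ 2 * (n * p)) ≤ Q := by
        rw [← Real.log_le_log_iff (by positivity) hQ0, Real.log_mul (Real.exp_pos _).ne'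
          (by positivity), Real.log_exp, Real.log_mul (by positivity) (by positivity),
          Real.log_mul hn0.ne' hp.ne', Real.log_pow, hsq]
        have : Real.log p = -L := by rw [hL, one_div, Real.log_inv]; ring
        rw [this]
        push_cast
        linarith
      calc _ ≤ c₂ * F := mul_le_mul_of_nonneg_right
            ((min_le_right _ _).trans (min_le_left _ _)) hF0
        _ = Real.exp (Real.log c / 2) * (γ * F) := by ring
        _ ≤ Real.exp (Real.log c / 2) * (ε ^ 2 * (n * p)) := by
            refine mul_le_mul_of_nonneg_left (hF1.trans ?_) (Real.exp_pos _).le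
            exact mul_le_mul_of_nonneg_right (phi_le_sq hε0.le) (by positivity)
        _ ≤ M * l := (h1.trans hM1).trans (le_mul_of_one_le_right hM0.le hl1)
    · push Not at hC
      -- Otherwise ε is large enough that Q/D is at least of order p^(-1/6), using k ≥ 3; its square
      -- root p^(-1/12) replaces the missing factor L.
      have h1 : c₃ * L ≤ √(Q / D) := by
        have h2 : Real.exp (Real.log c / 4 + L / 12) ≤ √(Q / D) := by
          rw [← Real.le_log_iff_exp_le (Real.sqrt_pos.2 (by positivity)),
            Real.log_sqrt (by positivity), Real.log_div hQ0.ne' hD0.ne', hsq]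
          linarith
        refine le_trans ?_ h2
        rw [Real.exp_add, hc₃]
        have := Real.add_one_le_exp (L / 12)
        calc _ = Real.exp (Real.log c / 4) * (L / 12) := by ring
          _ ≤ _ := by gcongr; linarith
      calc _ ≤ c₃ * (Q * L) := mul_le_mul ((min_le_right _ _).trans (min_le_right _ _)) hF2 hF0
            hc₃0.le
        _ = Q * (c₃ * L) := by ring
        _ ≤ Q * √(Q / D) := by gcongr
        _ ≤ M * l := hM2.trans (le_mul_of_one_le_right hM0.le hl1)

end Sizes


/-! ### Consequences of `Φ(ε) ≥ 1` -/

lemma apMean_eq (k n : ℕ) (p : unitInterval) :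
    apMean k n p = (apSets k n).card * (p : ℝ) ^ k := by
  rw [apMean_eq_binEx, binEx_famCount apSets_subset, famMean_apSets]

lemma apVar_le_famXi (k n : ℕ) (p : unitInterval) :
    apVar k n p ≤ famXi (apSets k n) id p := by
  rw [apVar_eq]
  exact binVar_famCount_le_xi apSets_subset p.2.1

lemma famXi_le_apVar (k n : ℕ) (p : unitInterval) :
    (1 - p : ℝ) * famXi (apSets k n) id p ≤ apVar k n p := by
  rw [apVar_eq]
  exact xi_le_binVar_famCount apSets_subset p.2.1 p.2.2

lemma apVar_nonneg (k n : ℕ) (p : unitInterval) : 0 ≤ apVar k n p := by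
  rw [apVar_eq]
  exact binVar_nonneg p.2.1 p.2.2 _

lemma bigPhi_le_sqrt_mul_log (k n : ℕ) (p : unitInterval) (ε : ℝ) :
    bigPhi k n p ε ≤ √(ε * ((apSets k n).card * (p : ℝ) ^ k)) * Real.log (1 / (p : ℝ)) := by
  rw [← apMean_eq]
  exact min_le_right _ _

lemma bigPhi_pos_imp {k n : ℕ} {p : unitInterval} {ε : ℝ} (h : 1 ≤ bigPhi k n p ε) :
    0 < apVar k n p ∧ 0 < apMean k n p ∧
      bigPhi k n p ε * apVar k n p ≤ phi ε * apMean k n p ^ 2 := by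
  have h1 : bigPhi k n p ε ≤ phi ε * apMean k n p ^ 2 / apVar k n p := min_le_left _ _
  have h2 : 0 < phi ε * apMean k n p ^ 2 / apVar k n p := by linarith
  have hv : 0 < apVar k n p := by
    refine lt_of_le_of_ne (apVar_nonneg k n p) fun h0 => ?_
    rw [← h0, div_zero] at h2
    exact lt_irrefl _ h2
  refine ⟨hv, ?_, (le_div_iff₀ hv).1 h1⟩
  have hm : 0 ≤ apMean k n p := by
    rw [apMean_eq]
    have := p.2.1
    positivity
  refine lt_of_le_of_ne hm fun h0 => ?_
  rw [← h0] at h2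
  simp at h2

section Consequences

variable {k n : ℕ} {p : unitInterval} {ε γ : ℝ}

lemma card_apSets_pos_of_bigPhi (h : 1 ≤ bigPhi k n p ε) : 0 < (apSets k n).card := by
  by_contra hN
  have := (bigPhi_pos_imp h).2.1
  rw [apMean_eq, Nat.eq_zero_of_not_pos hN] at this
  simp at this

/-- Since φ(ε) ≤ ε², the condition Φ ≥ 1 puts the deviation εμ at or beyond one standard deviation.
Each later use of Cantelli's inequality relies on this. -/
lemma apVar_le_sq (hε : 0 ≤ ε) (h : 1 ≤ bigPhi k n p ε) :
    apVar k n p ≤ (ε * apMean k n p) ^ 2 := by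
  obtain ⟨hv, hm, hle⟩ := bigPhi_pos_imp h
  calc apVar k n p ≤ bigPhi k n p ε * apVar k n p := le_mul_of_one_le_left hv.le h
    _ ≤ phi ε * apMean k n p ^ 2 := hle
    _ ≤ ε ^ 2 * apMean k n p ^ 2 := by gcongr; exact phi_le_sq hε
    _ = _ := by ring

lemma mul_bigPhi_le_mean (hk : 1 ≤ k) (hγ : 0 < γ)
    (hp : (p : ℝ) ≤ 1 - γ) (h : 1 ≤ bigPhi k n p ε) :
    γ * bigPhi k n p ε ≤ phi ε * ((apSets k n).card * (p : ℝ) ^ k) := by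
  obtain ⟨hv, hm, hle⟩ := bigPhi_pos_imp h
  have hX : famMean (apSets k n) id p ≤ famXi (apSets k n) id p :=
    famMean_le_famXi (fun A hA => Finset.card_pos.1 (by
      rw [id, card_of_mem_apSets hA]; omega)) p.2.1
  rw [famMean_apSets] at hX
  have hX2 := famXi_le_apVar k n p
  rw [apMean_eq] at hle hm
  set μ := ((apSets k n).card * (p : ℝ) ^ k) with hμ
  have h1 : γ * μ ≤ apVar k n p := by
    refine le_trans ?_ hX2
    calc γ * μ ≤ (1 - p : ℝ) * μ := by gcongr; linarith
      _ ≤ _ := by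
        have : 0 ≤ (1 - p : ℝ) := by linarith [p.2.2]
        gcongr
  have h2 : bigPhi k n p ε * (γ * μ) ≤ phi ε * μ ^ 2 :=
    (mul_le_mul_of_nonneg_left h1 (by linarith)).trans hle
  refine le_of_mul_le_mul_right ?_ hm
  linarith

lemma mul_bigPhi_le_np (hk : 1 ≤ k) (hε : 0 < ε) (hγ : 0 < γ)
    (hp : (p : ℝ) ≤ 1 - γ) (h : 1 ≤ bigPhi k n p ε) :
    γ * bigPhi k n p ε ≤ phi ε * (n * p) := by
  obtain ⟨hv, hm, hle⟩ := bigPhi_pos_imp h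
  have hX := sq_famMean_apSets_le (n := n) hk p.2.1 p.2.2
  have hX2 := famXi_le_apVar k n p
  rw [apMean_eq] at hle hm
  set μ := ((apSets k n).card * (p : ℝ) ^ k) with hμ
  have hXn := famXi_nonneg (apSets k n) id p.2.1
  have h1 : γ * famXi (apSets k n) id p ≤ apVar k n p := by
    refine le_trans ?_ hX2
    gcongr; linarith
  have hp0 := p.2.1
  have hφ := phi_pos hε
  have h2 : (γ * bigPhi k n p ε) * μ ^ 2 ≤ (phi ε * (n * p)) * μ ^ 2 := by
    calc (γ * bigPhi k n p ε) * μ ^ 2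
        ≤ (γ * bigPhi k n p ε) * (famXi (apSets k n) id p * (n * p)) := by
          have : 0 ≤ bigPhi k n p ε := by linarith
          gcongr
      _ = bigPhi k n p ε * (γ * famXi (apSets k n) id p) * (n * p) := by ring
      _ ≤ bigPhi k n p ε * apVar k n p * (n * p) := by
          have : 0 ≤ bigPhi k n p ε := by linarith
          gcongr
      _ ≤ (phi ε * μ ^ 2) * (n * p) := by gcongr
      _ = _ := by ring
  exact le_of_mul_le_mul_right h2 (by positivity)

lemma apUpperTail_le_half (hε : 0 < ε) (h : 1 ≤ bigPhi k n p ε) :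
    apUpperTail k n p ((1 + ε) * apMean k n p) ≤ 1 / 2 := by
  have hm := (bigPhi_pos_imp h).2.1
  have hv := apVar_le_sq hε.le h
  rw [apVar_eq] at hv
  have hpos : 0 < ε * apMean k n p := by positivity
  have := binPr_cantelli p.2.1 p.2.2 (famCount (apSets k n) id) hpos hv
  rw [← apMean_eq_binEx] at this
  rw [apUpperTail_eq]
  have e : (1 + ε) * apMean k n p = apMean k n p + ε * apMean k n p := by ring
  rw [e]
  refine this.trans (le_of_eq ?_)
  field_simp
  norm_num

end Consequences

/-- The factor 4 is absorbed into the exponent when cF is large; when it is bounded, the bound 1/2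
from Cantelli's inequality suffices. -/
lemma le_exp_of_le_four_mul_exp {P F c : ℝ} (h1 : P ≤ 4 * Real.exp (-(c * F)))
    (h2 : P ≤ 1 / 2) : P ≤ Real.exp (-(c / 4 * F)) := by
  by_cases hF : Real.log 4 ≤ c / 2 * F
  · have h4 : Real.exp (-(c / 2 * F)) ≤ 1 / 4 := by
      rw [Real.exp_neg, one_div]
      refine inv_anti₀ (by norm_num) ?_
      rwa [← Real.log_le_iff_le_exp (by norm_num)]
    have hF0 : 0 < c / 2 * F := (Real.log_pos (by norm_num)).trans_le hF
    have h5 : Real.exp (-(c * F)) = Real.exp (-(c / 2 * F)) * Real.exp (-(c / 2 * F)) := by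
      rw [← Real.exp_add]; congr 1; ring
    have h6 : P ≤ Real.exp (-(c / 2 * F)) := by
      refine h1.trans ?_
      rw [h5]
      have := Real.exp_pos (-(c / 2 * F))
      nlinarith
    refine h6.trans (Real.exp_le_exp.2 ?_)
    linarith
  · push Not at hF
    have h4 : Real.log 4 = 2 * Real.log 2 := by
      rw [show (4 : ℝ) = 2 ^ 2 by norm_num, Real.log_pow]; norm_num
    refine h2.trans ?_
    have : (1 / 2 : ℝ) = Real.exp (-Real.log 2) := by
      rw [Real.exp_neg, Real.exp_log (by norm_num)]; norm_num
    rw [this]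
    exact Real.exp_le_exp.2 (by linarith)

lemma sum_sqrt_two_pow_mul_le {a : ℝ} (m : ℕ) (h : ∀ i < m, 2 ^ i * a ≤ 1) :
    ∑ i ∈ Finset.range m, √(2 ^ i * a) ≤ 4 := by
  have key : ∀ j, ∑ i ∈ Finset.range (j + 1), √(2 ^ i * a) ≤ 4 * √(2 ^ j * a) := by
    intro j
    induction j with
    | zero => simp; linarith [Real.sqrt_nonneg a]
    | succ j ih =>
      rw [Finset.sum_range_succ]
      have e : √(2 ^ (j + 1) * a) = √2 * √(2 ^ j * a) := by
        rw [← Real.sqrt_mul (by norm_num)]; congr 1; ring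
      have h2 : (4 / 3 : ℝ) ≤ √2 := Real.le_sqrt_of_sq_le (by norm_num)
      rw [e]
      have := mul_le_mul_of_nonneg_right h2 (Real.sqrt_nonneg (2 ^ j * a))
      linarith
  rcases m with _ | j
  · simp
  · refine (key j).trans ?_
    have : √(2 ^ j * a) ≤ 1 := Real.sqrt_le_one.2 (h j (Nat.lt_succ_self j))
    linarith

lemma card_tailAPs_ge {k n : ℕ} (hk : 2 ≤ k) (hn : 4 * k ≤ n) :
    1 / (64 * (k : ℝ) ^ 2) * (n : ℝ) ^ 2 ≤ (tailAPs k n (n / (4 * k))).card := by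
  have h1 : 4 * k * (n / (4 * k)) ≤ n := Nat.mul_div_le n (4 * k)
  have h2 := sq_le_card_tailAPs hk h1
  have h3 : n < 4 * k * (n / (4 * k) + 1) := Nat.lt_mul_div_succ n (by omega)
  have h4 : 1 ≤ n / (4 * k) := (Nat.one_le_div_iff (by omega)).2 hn
  generalize n / (4 * k) = h at *
  have h5 : n ≤ 8 * k * h := by nlinarith
  have h6 : (n : ℝ) ≤ 8 * k * h := by exact_mod_cast h5
  have h7 : (h : ℝ) * h ≤ (tailAPs k n h).card := by exact_mod_cast h2
  have hk0 : (0 : ℝ) < k := by exact_mod_cast (by omega : 0 < k)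
  refine le_trans ?_ h7
  rw [one_div, inv_mul_le_iff₀ (by positivity)]
  calc (n : ℝ) ^ 2 ≤ (8 * k * h) ^ 2 := by gcongr
    _ = _ := by ring

lemma tailAPs_subset (k n h : ℕ) : tailAPs k n h ⊆ apSets k n := Finset.filter_subset _ _

lemma card_apSets_ge {k n : ℕ} (hk : 2 ≤ k) (hn : 4 * k ≤ n) :
    1 / (64 * (k : ℝ) ^ 2) * (n : ℝ) ^ 2 ≤ (apSets k n).card :=
  (card_tailAPs_ge hk hn).trans (Nat.cast_le.2 (Finset.card_le_card (tailAPs_subset _ _ _)))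


/-! ### The upper bound -/

lemma rpow_eq_exp_neg_log_inv {ρ : ℝ} (hρ : 0 < ρ) (x : ℝ) :
    ρ⁻¹ ^ x = Real.exp (-(Real.log ρ * x)) := by
  rw [Real.rpow_def_of_pos (inv_pos.2 hρ), Real.log_inv]
  congr 1; ring

/-- The threshold below which degrees are harmless. -/
noncomputable def degThreshold (k n : ℕ) (p ε : ℝ) : ℝ :=
  5184 * (k : ℝ) ^ 4 * max 1 (max (n * p ^ (k - 1))
    (phi ε * √(ε * ((apSets k n).card * p ^ k)) / (ε * Real.log (1 / p))))

/-- Up to constants the exponent is φ(ε)μ divided by the threshold. The three terms of the threshold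
give φ(ε)μ, φ(ε)np and Q L respectively, and each is at least of order Φ. -/
lemma exponent_sparse_ge {k n : ℕ} (hk : 3 ≤ k) {p ε γ F : ℝ} (hp : 0 < p) (hp1 : p < 1)
    (hε : 0 < ε) (hγ : 0 < γ) (hγ1 : γ < 1) (hn : 0 < n)
    (hN : 1 / (64 * (k : ℝ) ^ 2) * (n : ℝ) ^ 2 ≤ (apSets k n).card) (hF0 : 0 ≤ F)
    (hF1 : γ * F ≤ phi ε * ((apSets k n).card * p ^ k)) (hF2 : γ * F ≤ phi ε * (n * p))
    (hF3 : F ≤ √(ε * ((apSets k n).card * p ^ k)) * Real.log (1 / p)) :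
    γ / (64 * (k : ℝ) ^ 2 * (16 * k * (5184 * (k : ℝ) ^ 4))) * F
      ≤ ε * ((apSets k n).card * p ^ k) / (4 * (k * degThreshold k n p ε))
        * Real.log (1 + ε / 4) := by
  have hk3 : (3 : ℝ) ≤ k := by exact_mod_cast hk
  have hn0 : (0 : ℝ) < n := by exact_mod_cast hn
  set N : ℝ := ((apSets k n).card : ℝ) with hNdef
  have hN0 : 0 < N := lt_of_lt_of_le (by positivity) hN
  set μ := N * p ^ k with hμ
  have hμ0 : 0 < μ := by positivity
  have hL0 : 0 < Real.log (1 / p) := Real.log_pos (by rw [lt_div_iff₀ hp]; linarith)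
  have hφ := phi_pos hε
  set Q := √(ε * μ) with hQ
  have hQ0 : 0 < Q := Real.sqrt_pos.2 (by positivity)
  have hQ2 : Q * Q = ε * μ := Real.mul_self_sqrt (by positivity)
  set lam := (n : ℝ) * p ^ (k - 1) with hlam
  have hlam0 : 0 < lam := by positivity
  set Ψ := phi ε * Q / (ε * Real.log (1 / p)) with hΨ
  have hΨ0 : 0 < Ψ := by positivity
  set T := max 1 (max lam Ψ) with hT
  have hT1 : 1 ≤ T := le_max_left _ _
  have hr : degThreshold k n p ε = 5184 * (k : ℝ) ^ 4 * T := rfl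
  have hc : (1 : ℝ) ≤ 64 * k ^ 2 := by nlinarith
  have key : γ / (64 * (k : ℝ) ^ 2) * F * T ≤ phi ε * μ := by
    have hx : γ / (64 * (k : ℝ) ^ 2) * F ≤ γ * F := by
      rw [div_mul_eq_mul_div]
      exact div_le_self (by positivity) hc
    rcases max_choice 1 (max lam Ψ) with h | h
    · rw [hT, h, mul_one]
      exact hx.trans hF1
    · rw [hT, h]
      rcases max_choice lam Ψ with h' | h'
      · rw [h']
        have e : n * p * lam = n ^ 2 * p ^ k := by
          have : p ^ k = p * p ^ (k - 1) := by rw [← pow_succ']; congr 1; omega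
          rw [hlam, this]; ring
        calc γ / (64 * (k : ℝ) ^ 2) * F * lam = 1 / (64 * (k : ℝ) ^ 2) * lam * (γ * F) := by ring
          _ ≤ 1 / (64 * (k : ℝ) ^ 2) * lam * (phi ε * (n * p)) := by gcongr
          _ = phi ε * (1 / (64 * (k : ℝ) ^ 2) * (n * p * lam)) := by ring
          _ = phi ε * ((1 / (64 * (k : ℝ) ^ 2) * n ^ 2) * p ^ k) := by rw [e]; ring
          _ ≤ phi ε * μ := by rw [hμ]; gcongr
      · rw [h']
        have h1 : γ / (64 * (k : ℝ) ^ 2) * F ≤ Q * Real.log (1 / p) := by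
          refine le_trans (hx.trans ?_) hF3
          nlinarith
        calc γ / (64 * (k : ℝ) ^ 2) * F * Ψ ≤ Q * Real.log (1 / p) * Ψ :=
              mul_le_mul_of_nonneg_right h1 hΨ0.le
          _ = phi ε * (Q * Q) / ε := by rw [hΨ]; field_simp
          _ = phi ε * μ := by rw [hQ2]; field_simp
  have hφ4 : phi ε ≤ 4 * ε * Real.log (1 + ε / 4) := by
    refine (phi_le_mul_log hε.le).trans ?_
    have := mul_le_mul_of_nonneg_left (log_one_add_le_four_mul hε.le) hε.le
    linarith
  have hfin : ε * μ / (4 * (k * degThreshold k n p ε)) * Real.log (1 + ε / 4)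
      = (4 * ε * Real.log (1 + ε / 4) * μ) / (16 * k * (5184 * (k : ℝ) ^ 4) * T) := by
    rw [hr, div_mul_eq_mul_div, div_eq_div_iff (by positivity) (by positivity)]; ring
  rw [hfin, le_div_iff₀ (by positivity)]
  calc γ / (64 * (k : ℝ) ^ 2 * (16 * k * (5184 * (k : ℝ) ^ 4))) * F
        * (16 * k * (5184 * (k : ℝ) ^ 4) * T)
      = γ / (64 * (k : ℝ) ^ 2) * F * T
          * ((16 * k * (5184 * (k : ℝ) ^ 4)) / (16 * k * (5184 * (k : ℝ) ^ 4))) := by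
        generalize 16 * k * (5184 * (k : ℝ) ^ 4) = a
        rw [← div_div]; ring
    _ = γ / (64 * (k : ℝ) ^ 2) * F * T := by rw [div_self (by positivity), mul_one]
    _ ≤ phi ε * μ := key
    _ ≤ _ := by gcongr

lemma level_bound {k n : ℕ} (hk : 2 ≤ k) {p D Q c F : ℝ} (hp : 0 < p) (hp1 : p ≤ 1) (hn : 1 < n)
    (hD : 4 * k ≤ D) (hDQ : D ≤ Q) (hl : 1 ≤ Real.log (D / (8 * k * (n * p ^ (k - 1)))))
    (hsize : 216 * (k : ℝ) ^ 3 * Real.log n ≤ D * Real.log (D / (8 * k * (n * p ^ (k - 1)))))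
    (hcost : c * F ≤ Q * √(Q / D) * Real.log (D / (8 * k * (n * p ^ (k - 1))))) :
    binPr (Finset.Icc 1 n) p (HasStars k n D (1 / 8 * (Q * Q) * √(D / Q)))
      ≤ 2 / (n : ℝ) ^ 2 * Real.exp (-(c / (576 * (k : ℝ) ^ 3) * F)) := by
  have hk0 : (0 : ℝ) < k := by exact_mod_cast (by omega : 0 < k)
  have hn0 : (0 : ℝ) < n := by exact_mod_cast (by omega : 0 < n)
  have hD0 : 0 < D := lt_of_lt_of_le (by positivity) hD
  have hQ0 : 0 < Q := hD0.trans_le hDQ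
  have hρ0 : 0 < D / (8 * k * (n * p ^ (k - 1))) := by positivity
  have hρ1 : (D / (8 * k * (n * p ^ (k - 1))))⁻¹ ≤ 1 := by
    refine inv_le_one_of_one_le₀ ?_
    rw [Real.le_log_iff_exp_le hρ0] at hl
    linarith [Real.add_one_le_exp 1]
  have hρD : 8 * (k * n * p ^ (k - 1)) = (D / (8 * k * (n * p ^ (k - 1))))⁻¹ * D := by
    rw [inv_div, div_mul_cancel₀ _ hD0.ne']; ring
  have hkD : (k : ℝ) * D⁻¹ ≤ 1 / 4 := by
    rw [← div_eq_mul_inv, div_le_iff₀ hD0]; linarith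
  set ρ := D / (8 * k * (n * p ^ (k - 1))) with hρ
  set ℓ := Real.log ρ with hℓ
  -- Sampling density t = 1/D: conflicts are bounded by 9k³, and the condition on n⁻³ becomes
  -- `hsize`.
  have h2 := binPr_hasStars_le hk hn.le hp.le hp1 hD0
    (θ := 1 / 8 * (Q * Q) * √(D / Q)) (by positivity)
    (inv_pos.2 hD0) (by rw [inv_mul_cancel₀ hD0.ne']) hkD (inv_pos.2 hρ0) hρ1
    hρD.le (by
      rw [rpow_eq_exp_neg_log_inv hρ0]
      have e : 1 / (n : ℝ) ^ 3 = Real.exp (-(3 * Real.log n)) := by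
        rw [Real.exp_neg, one_div, ← Real.exp_log (pow_pos hn0 3), Real.log_pow]
        norm_num
      rw [e]
      refine Real.exp_le_exp.2 (neg_le_neg ?_)
      have e2 : ℓ * (1 / (72 * (k : ℝ) ^ 3 * D⁻¹)) = D * ℓ / (72 * (k : ℝ) ^ 3) := by
        field_simp
      rw [e2, le_div_iff₀ (by positivity)]
      linarith)
  refine h2.trans (mul_le_mul_of_nonneg_left ?_ (by positivity))
  rw [rpow_eq_exp_neg_log_inv hρ0]
  refine Real.exp_le_exp.2 (neg_le_neg ?_)
  set s := √(Q / D) with hs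
  have hss : s * s = Q / D := Real.mul_self_sqrt (by positivity)
  have hs0 : 0 < s := Real.sqrt_pos.2 (by positivity)
  have e4 : 1 / 8 * (Q * Q) * √(D / Q) / (72 * (k : ℝ) ^ 3 * D) = Q * s / (576 * (k : ℝ) ^ 3) := by
    have hinv : √(D / Q) = s⁻¹ := by
      rw [hs, ← Real.sqrt_inv, inv_div]
    have hQ' : Q = s * s * D := by rw [hss]; field_simp
    rw [hinv, div_eq_div_iff (by positivity) (by positivity)]
    have : Q * s⁻¹ = s * D := by rw [hQ']; field_simp
    calc 1 / 8 * (Q * Q) * s⁻¹ * (576 * (k : ℝ) ^ 3) = 72 * k ^ 3 * Q * (Q * s⁻¹) := by ring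
      _ = _ := by rw [this]; ring
  rw [e4]
  calc c / (576 * (k : ℝ) ^ 3) * F = c * F / (576 * (k : ℝ) ^ 3) := by ring
    _ ≤ Q * s * ℓ / (576 * (k : ℝ) ^ 3) := by gcongr
    _ = _ := by ring

lemma degree_term_le {k n : ℕ} (hk : 2 ≤ k) {p D c F : ℝ} (hp : 0 < p) (hn : 1 < n)
    (hD : 0 < D) (hF : 0 ≤ c * F)
    (hsize : 216 * (k : ℝ) ^ 3 * Real.log n ≤ D * Real.log (D / (8 * k * (n * p ^ (k - 1)))))
    (hcost : c * F ≤ D * Real.log (D / (8 * k * (n * p ^ (k - 1))))) :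
    n * (D / (8 * k * (n * p ^ (k - 1))))⁻¹ ^ (D / (2 * (k : ℝ) ^ 3))
      ≤ Real.exp (-(c / (576 * (k : ℝ) ^ 3) * F)) := by
  have hk0 : (0 : ℝ) < k := by exact_mod_cast (by omega : 0 < k)
  have hn0 : (0 : ℝ) < n := by exact_mod_cast (by omega : 0 < n)
  have hlogn : 0 ≤ Real.log n := Real.log_nonneg (by exact_mod_cast hn.le)
  have hρ0 : 0 < D / (8 * k * (n * p ^ (k - 1))) := by positivity
  rw [rpow_eq_exp_neg_log_inv hρ0]
  set ℓ := Real.log (D / (8 * k * (n * p ^ (k - 1)))) with hℓ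
  have hnlog : (n : ℝ) = Real.exp (Real.log n) := (Real.exp_log hn0).symm
  conv_lhs => rw [hnlog]
  rw [← Real.exp_add]
  refine Real.exp_le_exp.2 ?_
  have h3 : c / (576 * (k : ℝ) ^ 3) * F ≤ D * ℓ / (4 * (k : ℝ) ^ 3) := by
    calc c / (576 * (k : ℝ) ^ 3) * F = c * F / (576 * (k : ℝ) ^ 3) := by ring
      _ ≤ c * F / (4 * (k : ℝ) ^ 3) :=
          div_le_div_of_nonneg_left hF (by positivity)
            (mul_le_mul_of_nonneg_right (by norm_num) (by positivity))
      _ ≤ _ := div_le_div_of_nonneg_right hcost (by positivity)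
  have h4 : Real.log n ≤ D * ℓ / (4 * (k : ℝ) ^ 3) := by
    rw [le_div_iff₀ (by positivity)]
    have : 0 ≤ (k : ℝ) ^ 3 * Real.log n := by positivity
    linarith
  have h5 : ℓ * (D / (2 * (k : ℝ) ^ 3)) = 2 * (D * ℓ / (4 * (k : ℝ) ^ 3)) := by
    ring
  rw [h5]
  linarith

lemma natCast_mul_two_div_sq_le {m n : ℕ} (h : m ≤ n) (hn : (1 : ℝ) ≤ n) :
    (m : ℝ) * (2 / (n : ℝ) ^ 2) ≤ 2 := by
  have hm : (m : ℝ) ≤ n := by exact_mod_cast h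
  rw [mul_div_assoc', div_le_iff₀ (by positivity)]
  nlinarith

set_option maxHeartbeats 1000000 in
lemma exists_upper_bound (k : ℕ) (hk : 3 ≤ k) :
    ∃ n₀ : ℕ, 0 < n₀ ∧ ∀ γ : ℝ, 0 < γ → γ < 1 → ∃ c : ℝ, 0 < c ∧ ∀ n : ℕ, n₀ ≤ n →
      ∀ p : unitInterval, 0 < (p : ℝ) → (p : ℝ) ≤ 1 - γ →
      ∀ ε : ℝ, (n : ℝ) ^ (-(1 / 16) : ℝ) ≤ ε → 1 ≤ bigPhi k n p ε →
        apUpperTail k n p ((1 + ε) * apMean k n p) ≤ Real.exp (-(c * bigPhi k n p ε)) := by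
  have hk3 : (3 : ℝ) ≤ k := by exact_mod_cast hk
  obtain ⟨y₀, hy₀⟩ := exists_le_mul_log_div_lam k hk
  refine ⟨max (4 * k) ⌈Real.exp y₀⌉₊, by simp; omega, fun γ hγ hγ1 => ?_⟩
  obtain ⟨c₀, hc₀, hcost⟩ := exists_mul_le_mul_log_div_lam k hk hγ
  set c₁ := γ / (64 * (k : ℝ) ^ 2 * (16 * k * (5184 * (k : ℝ) ^ 4))) with hc₁
  have hc₁0 : 0 < c₁ := by positivity
  set c₂ := c₀ / (576 * (k : ℝ) ^ 3) with hc₂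
  have hc₂0 : 0 < c₂ := by positivity
  refine ⟨min c₁ c₂ / 4, by positivity, ?_⟩
  intro n hn p hp0 hpγ ε hε hΦ
  have hn4 : 4 * k ≤ n := (le_max_left _ _).trans hn
  have hny : y₀ ≤ Real.log n := by
    rw [Real.le_log_iff_exp_le (by exact_mod_cast (by omega : 0 < n))]
    exact (Nat.le_ceil _).trans (by exact_mod_cast (le_max_right _ _).trans hn)
  have hn1 : (1 : ℝ) < n := by exact_mod_cast (by omega : 1 < n)
  have hn0 : (0 : ℝ) < n := by linarith
  have hε0 : 0 < ε := lt_of_lt_of_le (by positivity) hε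
  have hp1 : (p : ℝ) < 1 := by linarith
  have hNpos := card_apSets_pos_of_bigPhi hΦ
  have hN := card_apSets_ge (by omega : 2 ≤ k) hn4
  refine le_exp_of_le_four_mul_exp ?_ (apUpperTail_le_half hε0 hΦ)
  have hF1 := mul_bigPhi_le_mean (by omega) hγ hpγ hΦ
  have hF2 := mul_bigPhi_le_np (by omega) hε0 hγ hpγ hΦ
  have hF3 := bigPhi_le_sqrt_mul_log k n p ε
  set F := bigPhi k n p ε with hF
  have hF0 : 0 ≤ F := by linarith
  rw [apUpperTail_eq, apMean_eq]
  set P : ℝ := (p : ℝ) with hP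
  set N : ℝ := ((apSets k n).card : ℝ) with hNdef
  have hN0 : 0 < N := Nat.cast_pos.2 hNpos
  set μ := N * P ^ k with hμ
  have hμ0 : 0 < μ := by positivity
  -- the trivial case
  by_cases htriv : N < (1 + ε) * μ
  · refine le_trans (le_of_eq ?_) (by positivity : 0 ≤ 4 * Real.exp (-(min c₁ c₂ * F)))
    have : binPr (Finset.Icc 1 n) P (fun S => (1 + ε) * μ ≤ famCount (apSets k n) id S)
        = binEx (Finset.Icc 1 n) P fun _ => 0 := by
      refine binEx_congr fun S _ => if_neg fun h => ?_
      replace h : (1 + ε) * μ ≤ famCount (apSets k n) id S := h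
      rw [famCount_eq_card] at h
      have : (((apSets k n).filter fun A => id A ⊆ S).card : ℝ) ≤ N :=
        Nat.cast_le.2 (Finset.card_le_card (Finset.filter_subset _ _))
      linarith
    rw [this, binEx_const]
  push Not at htriv
  set Q := √(ε * μ) with hQ
  have hQ0 : 0 < Q := Real.sqrt_pos.2 (by positivity)
  have hQ2 : Q * Q = ε * μ := Real.mul_self_sqrt (by positivity)
  -- Outside the trivial case εμ ≤ N ≤ n²; this keeps the number of dyadic levels at most n.
  have hQn : Q ≤ n := by
    refine Real.sqrt_le_iff.2 ⟨hn0.le, ?_⟩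
    have h1 : N ≤ n ^ 2 := by
      have h2 := card_apSets_le (n := n) (by omega : 2 ≤ k)
      rw [hNdef, sq, ← Nat.cast_mul]
      exact Nat.cast_le.2 h2
    linarith
  set r := degThreshold k n P ε with hr
  have hk4 : (1 : ℝ) ≤ k ^ 4 := one_le_pow₀ (by linarith)
  have hK0 : (0 : ℝ) < 5184 * (k : ℝ) ^ 4 := by positivity
  have hr1 : 5184 * (k : ℝ) ^ 4 ≤ r :=
    le_mul_of_one_le_right hK0.le (le_max_left _ _)
  have hr2 : 5184 * (k : ℝ) ^ 4 * (n * P ^ (k - 1)) ≤ r :=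
    mul_le_mul_of_nonneg_left ((le_max_left _ _).trans (le_max_right _ _)) hK0.le
  have hr3 : phi ε * Q / (ε * Real.log (1 / P)) ≤ r := by
    refine le_trans ((le_max_right _ _).trans (le_max_right 1 _)) (le_mul_of_one_le_left ?_ ?_)
    · exact zero_le_one.trans (le_max_left _ _)
    · linarith
  have hr0 : 0 < r := by linarith
  have hlev : ∀ i : ℕ, r ≤ 2 ^ i * r := fun i =>
    le_mul_of_one_le_left hr0.le (one_le_pow₀ (by norm_num))
  set lam := (n : ℝ) * P ^ (k - 1) with hlam
  have hlam0 : 0 < lam := by positivity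
  -- the two estimates available at every level
  have hsize : ∀ i : ℕ, 216 * (k : ℝ) ^ 3 * Real.log n
      ≤ 2 ^ i * r * Real.log (2 ^ i * r / (8 * k * lam)) := fun i =>
    hy₀ n P ε N (2 ^ i * r) hn1 hny hp0 hp1 hε hN (hr1.trans (hlev i)) (hr2.trans (hlev i))
      (hr3.trans (hlev i))
  have hlog1 : ∀ i : ℕ, 1 ≤ Real.log (2 ^ i * r / (8 * k * lam)) := fun i =>
    one_le_log_div_lam hn0 hp0 (by omega) (hr2.trans (hlev i))
  have hcost' : ∀ (i : ℕ) (M : ℝ), Q ≤ M → Q * √(Q / (2 ^ i * r)) ≤ M →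
      c₀ * F ≤ M * Real.log (2 ^ i * r / (8 * k * lam)) := fun i M h1 h2 =>
    hcost n P ε N (2 ^ i * r) M F hn1 hp0 hp1 hε0 hN (by positivity) (hr2.trans (hlev i)) h1 h2
      hF2 hF3
  have hex : ∃ m : ℕ, Q ≤ 2 ^ m * r := by
    obtain ⟨m, hm⟩ := pow_unbounded_of_one_lt Q (by norm_num : (1 : ℝ) < 2)
    exact ⟨m, hm.le.trans (le_mul_of_one_le_right (by positivity) (by linarith))⟩
  classical
  -- The first scale reaching Q. A single point of degree this large already costs order Φ, so
  -- levels are needed only below Q.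
  set m := Nat.find hex with hm
  have hmQ : Q ≤ 2 ^ m * r := Nat.find_spec hex
  have hmin : ∀ i < m, 2 ^ i * r < Q := fun i hi => not_le.1 (Nat.find_min hex hi)
  have hmn : m ≤ n := by
    by_contra hcon
    have h1 := hmin n (by omega)
    have h2 : (n : ℝ) < 2 ^ n := by exact_mod_cast Nat.lt_two_pow_self
    have h3 : (2 : ℝ) ^ n ≤ 2 ^ n * r := le_mul_of_one_le_right (by positivity) (by linarith)
    linarith
  -- The geometric weight √(D/Q) makes the losses sum to at most εμ/2, while θ/D = Q√(Q/D)/8 stays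
  -- large enough for `hcost'`.
  set θ : ℕ → ℝ := fun i => 1 / 8 * (Q * Q) * √(2 ^ i * (r / Q)) with hθ
  have hθsum : ∑ i ∈ Finset.range m, θ i ≤ ε / 2 * μ := by
    rw [hθ, ← Finset.mul_sum]
    have := sum_sqrt_two_pow_mul_le (a := r / Q) m fun i hi => by
      rw [mul_div_assoc', div_le_one hQ0]; exact (hmin i hi).le
    calc _ ≤ 1 / 8 * (Q * Q) * 4 := by gcongr
      _ = ε / 2 * μ := by rw [hQ2]; ring
  have hρ0 : ∀ i : ℕ, 0 < 2 ^ i * r / (8 * k * lam) := fun i => by positivity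
  have hρ1 : ∀ i : ℕ, (2 ^ i * r / (8 * k * lam))⁻¹ ≤ 1 := fun i => by
    refine inv_le_one_of_one_le₀ ?_
    have := hlog1 i
    rw [Real.le_log_iff_exp_le (hρ0 i)] at this
    linarith [Real.add_one_le_exp 1]
  have hρD : ∀ i : ℕ, 8 * (k * lam) = (2 ^ i * r / (8 * k * lam))⁻¹ * (2 ^ i * r) := fun i => by
    field_simp
  have hmaster := binPr_upper_tail_le (k := k) (n := n) (by omega) hp0 hp1.le hr0 hε0 hNpos m θ
    hθsum (inv_pos.2 (hρ0 m)) (hρ1 m) (by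
      rw [← hρD m]
      have : 0 < k * lam := by positivity
      linarith)
  refine hmaster.trans ?_
  -- first term
  have t1 : Real.exp (-(ε * μ / (4 * (k * r)) * Real.log (1 + ε / 4)))
      ≤ Real.exp (-(min c₁ c₂ * F)) := by
    refine Real.exp_le_exp.2 (neg_le_neg ?_)
    exact (mul_le_mul_of_nonneg_right (min_le_left _ _) hF0).trans
      (exponent_sparse_ge hk hp0 hp1 hε0 hγ hγ1 (by omega) hN hF0 hF1 hF2 hF3)
  have hmono : ∀ x : ℝ, x ≤ Real.exp (-(c₂ * F)) → x ≤ Real.exp (-(min c₁ c₂ * F)) := fun x hx =>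
    hx.trans (Real.exp_le_exp.2 (neg_le_neg (mul_le_mul_of_nonneg_right (min_le_right _ _) hF0)))
  -- second term
  have t2 : n * (2 ^ m * r / (8 * k * lam))⁻¹ ^ (2 ^ m * r / (2 * (k : ℝ) ^ 3))
      ≤ Real.exp (-(min c₁ c₂ * F)) := by
    refine hmono _ (degree_term_le (by omega) hp0 (by omega) (by positivity) (by positivity)
      (hsize m) (hcost' m (2 ^ m * r) hmQ ?_))
    refine le_trans (mul_le_of_le_one_right hQ0.le ?_) hmQ
    exact Real.sqrt_le_one.2 ((div_le_one (by positivity)).2 hmQ)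
  -- the levels
  have t3 : ∀ i ∈ Finset.range m, binPr (Finset.Icc 1 n) P (HasStars k n (2 ^ i * r) (θ i))
      ≤ 2 / (n : ℝ) ^ 2 * Real.exp (-(min c₁ c₂ * F)) := by
    intro i hi
    have hiQ := hmin i (Finset.mem_range.1 hi)
    have hD0 : 0 < 2 ^ i * r := by positivity
    have hkD : 4 * (k : ℝ) ≤ 2 ^ i * r := by
      have : (k : ℝ) ≤ k ^ 4 := le_self_pow₀ (by linarith) (by norm_num)
      have := hr1.trans (hlev i)
      linarith
    have hs1 : 1 ≤ √(Q / (2 ^ i * r)) := by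
      rw [Real.one_le_sqrt, one_le_div hD0]; exact hiQ.le
    have h3 := hcost' i (Q * √(Q / (2 ^ i * r))) (le_mul_of_one_le_right hQ0.le hs1) le_rfl
    have h4 := level_bound (by omega) hp0 hp1.le (by omega) hkD hiQ.le (hlog1 i) (hsize i) h3
    simp only [hθ, mul_div_assoc']
    exact h4.trans (mul_le_mul_of_nonneg_left (hmono _ le_rfl) (by positivity))
  have t4 := Finset.sum_le_card_nsmul _ _ _ t3
  rw [Finset.card_range, nsmul_eq_mul] at t4
  have t5 : (m : ℝ) * (2 / (n : ℝ) ^ 2 * Real.exp (-(min c₁ c₂ * F)))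
      ≤ 2 * Real.exp (-(min c₁ c₂ * F)) := by
    rw [← mul_assoc]
    refine mul_le_mul_of_nonneg_right ?_ (Real.exp_pos _).le
    exact natCast_mul_two_div_sq_le hmn hn1.le
  rw [show 4 * Real.exp (-(min c₁ c₂ * F)) = Real.exp (-(min c₁ c₂ * F))
    + Real.exp (-(min c₁ c₂ * F)) + 2 * Real.exp (-(min c₁ c₂ * F)) by ring]
  exact add_le_add (add_le_add t1 t2) (t4.trans t5)


/-! ### The lower bound from a planted interval -/

lemma apSets_mono {k b n : ℕ} (h : b ≤ n) : apSets k b ⊆ apSets k n := fun A hA => by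
  rw [mem_apSets] at hA ⊢
  exact ⟨hA.1.trans (Finset.Icc_subset_Icc_right h), hA.2⟩

lemma famCount_sdiff_add {I I' : Finset (Finset ℕ)} (h : I' ⊆ I) (b : Finset ℕ → Finset ℕ)
    (S : Finset ℕ) : famCount (I \ I') b S + famCount I' b S = famCount I b S :=
  Finset.sum_sdiff h

lemma famCount_eq_card_of_forall {ι : Type*} {I : Finset ι} {b : ι → Finset ℕ} {S : Finset ℕ}
    (h : ∀ i ∈ I, b i ⊆ S) : famCount I b S = I.card := by
  rw [famCount_eq_card, Finset.filter_true_of_mem h]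

lemma half_le_binPr_famCount {V : Finset ℕ} {I : Finset (Finset ℕ)} {b : Finset ℕ → Finset ℕ}
    (h : ∀ i ∈ I, b i ⊆ V) {p t : ℝ} (h0 : 0 ≤ p) (h1 : p ≤ 1) (ht : 0 < t)
    (hv : binVar V p (famCount I b) ≤ t ^ 2) :
    1 / 2 ≤ binPr V p (fun S => famMean I b p - t ≤ famCount I b S) := by
  have := le_binPr_cantelli h0 h1 (famCount I b) ht hv
  rw [binEx_famCount h] at this
  refine le_trans (le_of_eq ?_) this
  field_simp
  norm_num

/-- For ε ≥ 1 this is half of (1+ε)μ ≥ 1; for ε ≤ 1 it follows from γ ≤ γΦ ≤ φ(ε)μ ≤ ε²μ. It bounds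
Q below, so additive constants can be absorbed in multiples of Q. -/
lemma min_le_mul_mean {k n : ℕ} {p : unitInterval} {ε γ : ℝ} (hε : 0 < ε) (hγ : 0 < γ)
    (hγ1 : γ < 1) (hp : (p : ℝ) ≤ 1 - γ) (hk : 1 ≤ k) (hΦ : 1 ≤ bigPhi k n p ε)
    (h1 : 1 ≤ (1 + ε) * apMean k n p) : γ / 2 ≤ ε * apMean k n p := by
  have hm := (bigPhi_pos_imp hΦ).2.1
  rcases le_total 1 ε with h | h
  · nlinarith
  · have h2 := mul_bigPhi_le_mean hk hγ hp hΦ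
    rw [← apMean_eq] at h2
    have h3 : phi ε * apMean k n p ≤ ε ^ 2 * apMean k n p := by
      gcongr; exact phi_le_sq hε.le
    have h4 : ε ^ 2 * apMean k n p ≤ ε * apMean k n p := by
      gcongr; nlinarith
    nlinarith

lemma pow_eq_exp_neg_mul_log {p : ℝ} (hp : 0 < p) (b : ℕ) :
    p ^ b = Real.exp (-(b * Real.log (1 / p))) := by
  rw [one_div, Real.log_inv, mul_neg, neg_neg, Real.exp_nat_mul, Real.exp_log hp]

/-- Containing [1, b] and not having too few progressions outside it are both increasing events, so
Harris's inequality multiplies p^b by 1/2. The planted progressions gain at least a proportion 1 - p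
over their mean, as p^k ≤ p. -/
lemma le_binPr_of_interval {k n b : ℕ} (hk : 1 ≤ k) (hb : b ≤ n) {p t x : ℝ} (h0 : 0 ≤ p)
    (h1 : p ≤ 1) (ht : 0 < t) (hv : binVar (Finset.Icc 1 n) p (famCount (apSets k n) id) ≤ t ^ 2)
    (hx : x ≤ (apSets k n).card * p ^ k + (1 - p) * (apSets k b).card - t) :
    p ^ b * (1 / 2) ≤ binPr (Finset.Icc 1 n) p (fun S => x ≤ famCount (apSets k n) id S) := by
  classical
  set I := apSets k n \ apSets k b with hI
  have hsub : apSets k b ⊆ apSets k n := apSets_mono hb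
  have hIV : ∀ A ∈ I, id A ⊆ Finset.Icc 1 n := fun A hA =>
    apSets_subset A (Finset.sdiff_subset hA)
  have e1 : binPr (Finset.Icc 1 n) p (fun S => Finset.Icc 1 b ⊆ S) = p ^ b := by
    rw [binPr_subset (Finset.Icc_subset_Icc_right hb)]; simp
  have e2 := half_le_binPr_famCount hIV h0 h1 ht
    ((binVar_famCount_mono Finset.sdiff_subset apSets_subset h0 h1).trans hv)
  rw [← e1]
  refine (mul_le_mul_of_nonneg_left e2 (binPr_nonneg h0 h1 _)).trans
    ((binPr_harris h0 h1 (fun S T hST h => h.trans hST)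
      (fun S T hST h => h.trans (famCount_mono _ _ hST))).trans
      (binPr_mono h0 h1 fun S _ hS => ?_))
  rw [← famCount_sdiff_add hsub]
  have e3 : famCount (apSets k b) id S = (apSets k b).card :=
    famCount_eq_card_of_forall fun A hA => (apSets_subset A hA).trans hS.1
  rw [e3]
  refine le_trans ?_ (add_le_add_left hS.2 _)
  have e4 : famMean I id p = (apSets k n).card * p ^ k - (apSets k b).card * p ^ k := by
    rw [famMean_of_card (I := I) (b := id) (j := k)
      (fun A hA => card_of_mem_apSets (Finset.sdiff_subset hA)),
      hI, ← Finset.card_sdiff_add_card_eq_card hsub]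
    push_cast
    ring
  rw [e4]
  have hpk : p ^ k ≤ p := by
    calc p ^ k ≤ p ^ 1 := pow_le_pow_of_le_one h0 h1 hk
      _ = p := pow_one p
  have : ((apSets k b).card : ℝ) * p ^ k ≤ (apSets k b).card * p := by gcongr
  linarith

lemma exists_clustering_bound (k : ℕ) (hk : 3 ≤ k) {γ : ℝ} (hγ : 0 < γ) (hγ1 : γ < 1) :
    ∃ C : ℝ, 0 < C ∧ ∀ (n : ℕ) (p : unitInterval) (ε : ℝ), 0 < (p : ℝ) → (p : ℝ) ≤ 1 - γ → 0 < ε →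
      1 ≤ bigPhi k n p ε → 1 ≤ (1 + ε) * apMean k n p →
      (1 + ε) * apMean k n p ≤ (apSets k n).card →
      Real.exp (-(C * (√(ε * apMean k n p) * Real.log (1 / (p : ℝ)))))
        ≤ apUpperTail k n p ((1 + ε) * apMean k n p) := by
  have hk0 : (0 : ℝ) < k := by exact_mod_cast (by omega : 0 < k)
  -- Chosen so that b ≥ aQ gives b²/(64k²) ≥ (2/γ)εμ progressions, a gain of 2εμ after the factor 1
  -- - p ≥ γ; `e` absorbs the rounding and the additive 4k.
  set a : ℝ := 8 * k * √(2 / γ) with ha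
  have ha0 : 0 < a := by positivity
  set e : ℝ := (1 + 4 * k) / √(γ / 2) with he
  have he0 : 0 < e := by positivity
  refine ⟨a + e + 1, by positivity, ?_⟩
  intro n p ε hp0 hpγ hε hΦ hm1 hmN
  have hm := (bigPhi_pos_imp hΦ).2.1
  have hQlow := min_le_mul_mean hε hγ hγ1 hpγ (by omega) hΦ hm1
  set Q := √(ε * apMean k n p) with hQ
  have hQ0 : 0 < Q := Real.sqrt_pos.2 (by positivity)
  have hQ2 : Q ^ 2 = ε * apMean k n p := Real.sq_sqrt (by positivity)
  have hQe : √(γ / 2) ≤ Q := Real.sqrt_le_sqrt hQlow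
  have hL0 : 0 < Real.log (1 / (p : ℝ)) := Real.log_pos (by rw [lt_div_iff₀ hp0]; linarith)
  have hΦ2 : 1 ≤ Q * Real.log (1 / (p : ℝ)) := hΦ.trans (min_le_right _ _)
  set b : ℕ := ⌈a * Q⌉₊ + 4 * k with hb
  have hbQ : (b : ℝ) ≤ (a + e) * Q := by
    have h1 := (Nat.ceil_lt_add_one (by positivity : 0 ≤ a * Q)).le
    have h2 : 1 + 4 * (k : ℝ) ≤ e * Q := by
      rw [he, div_mul_eq_mul_div, le_div_iff₀ (by positivity)]
      gcongr
    rw [hb]; push_cast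
    linarith
  have hexp : Real.exp (-((a + e + 1) * (Q * Real.log (1 / (p : ℝ))))) ≤ (p : ℝ) ^ b * (1 / 2) := by
    have h2 : (1 / 2 : ℝ) = Real.exp (-Real.log 2) := by
      rw [Real.exp_neg, Real.exp_log (by norm_num)]; norm_num
    rw [pow_eq_exp_neg_mul_log hp0, h2, ← Real.exp_add]
    refine Real.exp_le_exp.2 ?_
    have h3 : Real.log 2 ≤ 1 := by linarith [Real.log_two_lt_d9]
    have h4 := mul_le_mul_of_nonneg_right hbQ hL0.le
    linarith
  refine hexp.trans ?_
  rw [apUpperTail_eq]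
  by_cases hbn : b ≤ n
  · refine le_binPr_of_interval (by omega) hbn hp0.le p.2.2
      (by positivity : 0 < ε * apMean k n p) ?_ ?_
    · rw [← apVar_eq]; exact apVar_le_sq hε.le hΦ
    · rw [← apMean_eq]
      have h2γ : √(2 / γ) ^ 2 = 2 / γ := Real.sq_sqrt (by positivity)
      have h1 := card_apSets_ge (by omega : 2 ≤ k) (by omega : 4 * k ≤ b)
      have h2 : a * Q ≤ b := by
        rw [hb]; push_cast
        linarith [Nat.le_ceil (a * Q)]
      have h3 : 2 / γ * (ε * apMean k n p) ≤ (apSets k b).card := by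
        refine le_trans ?_ h1
        rw [one_div, inv_mul_eq_div, le_div_iff₀ (by positivity)]
        calc 2 / γ * (ε * apMean k n p) * (64 * (k : ℝ) ^ 2) = (a * Q) ^ 2 := by
              rw [ha, mul_pow, mul_pow, mul_pow, h2γ, hQ2]; ring
          _ ≤ (b : ℝ) ^ 2 := by gcongr
      have h4 : 2 * (ε * apMean k n p) ≤ (1 - p) * (apSets k b).card := by
        calc 2 * (ε * apMean k n p) = γ * (2 / γ * (ε * apMean k n p)) := by field_simp
          _ ≤ γ * (apSets k b).card := by gcongr
          _ ≤ _ := by gcongr; linarith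
      linarith
  -- When the interval would exceed [n], planting all of [n] is cheaper and attains every count up
  -- to N.
  · push Not at hbn
    have h1 : (p : ℝ) ^ b * (1 / 2) ≤ (p : ℝ) ^ n := by
      calc (p : ℝ) ^ b * (1 / 2) ≤ (p : ℝ) ^ b :=
            mul_le_of_le_one_right (by positivity) (by norm_num)
        _ ≤ _ := pow_le_pow_of_le_one hp0.le p.2.2 hbn.le
    refine h1.trans ?_
    have h2 : binPr (Finset.Icc 1 n) p (fun S => Finset.Icc 1 n ⊆ S) = (p : ℝ) ^ n := by
      rw [binPr_subset subset_rfl]; simp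
    rw [← h2]
    refine binPr_mono hp0.le p.2.2 fun S _ hS => ?_
    rw [famCount_eq_card_of_forall fun A hA => (apSets_subset A hA).trans hS]
    exact hmN


/-! ### Exposing a random set in two stages -/

/-- Conditioning on the first stage: only outcomes in `G` are kept, and each contributes at least
`b`. -/
lemma mul_le_binPr_union {V W : Finset ℕ} (h : Disjoint V W) {p : ℝ} (h0 : 0 ≤ p) (h1 : p ≤ 1)
    {G P : Finset ℕ → Prop} {a b : ℝ} (hb : 0 ≤ b) (ha : a ≤ binPr V p G)
    (hP : ∀ S ⊆ V, G S → b ≤ binPr W p (fun T => P (S ∪ T))) :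
    a * b ≤ binPr (V ∪ W) p P := by
  refine (mul_le_mul_of_nonneg_right ha hb).trans ?_
  unfold binPr
  rw [binEx_union h, ← binEx_mul_const]
  refine binEx_mono h0 h1 fun S hS => ?_
  split_ifs with hG
  · rw [one_mul]
    exact hP S hS hG
  · rw [zero_mul]
    exact binPr_nonneg h0 h1 fun T => P (S ∪ T)

lemma binPr_inter (V U : Finset ℕ) (p : ℝ) (P : Finset ℕ → Prop) :
    binPr V p (fun S => P (S ∩ U)) = binPr (V ∩ U) p P := by
  unfold binPr
  rw [← binEx_inter]

lemma sub_le_binPr_and_not {V : Finset ℕ} {p : ℝ} (h0 : 0 ≤ p) (h1 : p ≤ 1)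
    {P Q : Finset ℕ → Prop} {a δ : ℝ} (h : a ≤ binPr V p P) (h' : binPr V p Q ≤ δ) :
    a - δ ≤ binPr V p (fun S => P S ∧ ¬ Q S) := by
  have e : binPr V p P ≤ binPr V p (fun S => (P S ∧ ¬ Q S) ∨ Q S) :=
    binPr_mono h0 h1 fun S _ hS => by tauto
  have := binPr_or_le (V := V) h0 h1 (fun S => P S ∧ ¬ Q S) Q
  linarith

/-! ### Linear statistics -/

lemma binEx_sum_mem (V : Finset ℕ) (p : ℝ) (d : ℕ → ℝ) :
    binEx V p (fun S => ∑ x ∈ S, d x) = p * ∑ x ∈ V, d x := by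
  induction V using Finset.induction_on with
  | empty => simp [binEx_empty]
  | insert a V ha ih =>
    have e : binEx V p (fun S => ∑ x ∈ insert a S, d x) = binEx V p (fun S => d a + ∑ x ∈ S, d x) :=
      binEx_congr fun S hS => Finset.sum_insert fun h => ha (hS h)
    rw [binEx_insert ha, e, binEx_add, binEx_const, ih, Finset.sum_insert ha]
    ring

lemma binVar_sum_mem (V : Finset ℕ) (p : ℝ) (d : ℕ → ℝ) :
    binVar V p (fun S => ∑ x ∈ S, d x) = p * (1 - p) * ∑ x ∈ V, d x ^ 2 := by
  rw [binVar_eq, binEx_sum_mem]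
  induction V using Finset.induction_on with
  | empty => simp [binEx_empty]
  | insert a V ha ih =>
    have e : binEx V p (fun S => (∑ x ∈ insert a S, d x) ^ 2)
        = binEx V p (fun S => (d a ^ 2 + (2 * d a) * ∑ x ∈ S, d x) + (∑ x ∈ S, d x) ^ 2) :=
      binEx_congr fun S hS => by rw [Finset.sum_insert fun h => ha (hS h)]; ring
    rw [binEx_insert ha, e, binEx_add, binEx_add, binEx_const, binEx_const_mul, binEx_sum_mem,
      Finset.sum_insert ha, Finset.sum_insert ha]
    linear_combination ih

/-! ### Members of a family with exactly one element in `J` -/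

/-- The number of members of `T` through `x` all of whose elements outside `J` lie in `S`. -/
noncomputable def linkDeg (T : Finset (Finset ℕ)) (J S : Finset ℕ) (x : ℕ) : ℝ :=
  famCount (T.filter fun A => x ∈ A) (fun A => A \ J) S

section Link

variable {T : Finset (Finset ℕ)} {J : Finset ℕ}

lemma linkDeg_nonneg (T : Finset (Finset ℕ)) (J S : Finset ℕ) (x : ℕ) : 0 ≤ linkDeg T J S x :=
  famCount_nonneg _ _ _

lemma one_le_linkDeg {S : Finset ℕ} {x : ℕ} (h : linkDeg T J S x ≠ 0) : 1 ≤ linkDeg T J S x := by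
  rw [linkDeg, famCount_eq_card] at h ⊢
  exact_mod_cast Nat.one_le_iff_ne_zero.2 (by exact_mod_cast h)

lemma linkDeg_eq_sum (T : Finset (Finset ℕ)) (J S : Finset ℕ) (x : ℕ) :
    linkDeg T J S x = ∑ A ∈ T, if x ∈ A then (if A \ J ⊆ S then 1 else 0) else 0 := by
  rw [linkDeg, famCount, Finset.sum_filter]

lemma sum_linkDeg (hJ : ∀ A ∈ T, (A ∩ J).card = 1) (S : Finset ℕ) :
    ∑ x ∈ J, linkDeg T J S x = famCount T (fun A => A \ J) S := by
  simp_rw [linkDeg_eq_sum]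
  rw [Finset.sum_comm, famCount]
  refine Finset.sum_congr rfl fun A hA => ?_
  rw [← Finset.sum_filter, Finset.sum_const, Finset.filter_mem_eq_inter, Finset.inter_comm,
    hJ A hA, one_smul]

lemma famCount_union_eq_sum_linkDeg (hJ : ∀ A ∈ T, (A ∩ J).card = 1) {S S' : Finset ℕ}
    (hS : Disjoint S J) (hS' : S' ⊆ J) :
    famCount T id (S ∪ S') = ∑ x ∈ S', linkDeg T J S x := by
  simp_rw [linkDeg_eq_sum]
  rw [Finset.sum_comm, famCount]
  refine Finset.sum_congr rfl fun A hA => ?_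
  obtain ⟨y, hy⟩ := Finset.card_eq_one.1 (hJ A hA)
  have hyA : y ∈ A ∧ y ∈ J := Finset.mem_inter.1 (hy ▸ Finset.mem_singleton_self y)
  have huniq : ∀ x, x ∈ A → x ∈ J → x = y := fun x h1 h2 =>
    Finset.mem_singleton.1 (hy ▸ Finset.mem_inter.2 ⟨h1, h2⟩)
  have hsub : id A ⊆ S ∪ S' ↔ A \ J ⊆ S ∧ y ∈ S' := by
    constructor
    · intro h
      refine ⟨fun x hx => ?_, ?_⟩
      · rw [Finset.mem_sdiff] at hx
        exact (Finset.mem_union.1 (h hx.1)).resolve_right fun h' => hx.2 (hS' h')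
      · exact (Finset.mem_union.1 (h hyA.1)).resolve_left fun h' =>
          Finset.disjoint_left.1 hS h' hyA.2
    · rintro ⟨h1, h2⟩ x hx
      by_cases hxJ : x ∈ J
      · rw [huniq x hx hxJ]; exact Finset.mem_union_right _ h2
      · exact Finset.mem_union_left _ (h1 (Finset.mem_sdiff.2 ⟨hx, hxJ⟩))
  have hsum : ∀ c : ℝ, ∑ x ∈ S', (if x ∈ A then c else 0) = if y ∈ S' then c else 0 := by
    intro c
    rw [← Finset.sum_ite_eq' S' y fun _ => c]
    refine Finset.sum_congr rfl fun x hx => ?_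
    have : x ∈ A ↔ x = y := ⟨fun h => huniq x h (hS' hx), fun h => h ▸ hyA.1⟩
    simp only [this]
  rw [hsum, if_congr hsub rfl rfl]
  by_cases h1 : A \ J ⊆ S <;> by_cases h2 : y ∈ S' <;> simp [h1, h2]

/-- Two progressions sharing their point of `J` have a union with exactly one more element than the
union of their traces, so the factor `p` turns each term into a term of the pair sum. -/
lemma mul_binEx_sum_linkDeg_sq_le {V : Finset ℕ} (hV : ∀ A ∈ T, A \ J ⊆ V)
    (hJ : ∀ A ∈ T, (A ∩ J).card = 1) {p : ℝ} (h0 : 0 ≤ p) :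
    p * binEx V p (fun S => ∑ x ∈ J, linkDeg T J S x ^ 2) ≤ famXi T id p := by
  have e : ∀ x ∈ J, binEx V p (fun S => linkDeg T J S x ^ 2)
      = ∑ A ∈ T, ∑ A' ∈ T, if x ∈ A ∧ x ∈ A' then p ^ ((A \ J) ∪ (A' \ J)).card else 0 := by
    intro x _
    unfold linkDeg
    rw [binEx_famCount_sq fun A hA => hV A (Finset.mem_filter.1 hA).1, Finset.sum_filter]
    refine Finset.sum_congr rfl fun A _ => ?_
    by_cases hx : x ∈ A <;> simp [hx, Finset.sum_filter]
  rw [binEx_sum, Finset.sum_congr rfl e, Finset.sum_comm, Finset.mul_sum]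
  refine Finset.sum_le_sum fun A hA => ?_
  rw [Finset.sum_comm, Finset.mul_sum]
  refine Finset.sum_le_sum fun A' hA' => ?_
  obtain ⟨y, hy⟩ := Finset.card_eq_one.1 (hJ A hA)
  obtain ⟨y', hy'⟩ := Finset.card_eq_one.1 (hJ A' hA')
  have hA1 : ∀ x ∈ J, (x ∈ A ↔ x = y) := fun x hx => by
    rw [← Finset.mem_singleton, ← hy, Finset.mem_inter]; tauto
  have hA2 : ∀ x ∈ J, (x ∈ A' ↔ x = y') := fun x hx => by
    rw [← Finset.mem_singleton, ← hy', Finset.mem_inter]; tauto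
  have hyJ : y ∈ A ∧ y ∈ J := Finset.mem_inter.1 (hy ▸ Finset.mem_singleton_self y)
  have hyJ' : y' ∈ A' ∧ y' ∈ J := Finset.mem_inter.1 (hy' ▸ Finset.mem_singleton_self y')
  by_cases hyy : y = y'
  · subst hyy
    have hd : ¬ Disjoint (id A) (id A') := Finset.not_disjoint_iff.2 ⟨y, hyJ.1, hyJ'.1⟩
    rw [if_neg hd]
    have e2 : ∑ x ∈ J, (if x ∈ A ∧ x ∈ A' then p ^ ((A \ J) ∪ (A' \ J)).card else 0)
        = p ^ ((A \ J) ∪ (A' \ J)).card := by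
      rw [Finset.sum_eq_single_of_mem y hyJ.2 fun x hx hxy => by simp [hA1 x hx, hxy]]
      simp [hyJ.1, hyJ'.1]
    rw [e2, ← pow_succ']
    refine le_of_eq ?_
    congr 1
    have hU : id A ∪ id A' = insert y ((A \ J) ∪ (A' \ J)) := by
      ext x
      simp only [id, Finset.mem_union, Finset.mem_insert, Finset.mem_sdiff]
      by_cases hx : x ∈ J
      · simp [hA1 x hx, hA2 x hx, hx]
      · have : x ≠ y := fun h => hx (h ▸ hyJ.2)
        simp [hx, this]
    rw [hU, Finset.card_insert_of_notMem]
    simp [hyJ.2]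
  · have e2 : ∑ x ∈ J, (if x ∈ A ∧ x ∈ A' then p ^ ((A \ J) ∪ (A' \ J)).card else 0) = 0 := by
      refine Finset.sum_eq_zero fun x hx => if_neg ?_
      rw [hA1 x hx, hA2 x hx]
      rintro ⟨rfl, h⟩
      exact hyy h
    rw [e2, mul_zero]
    split_ifs <;> positivity

lemma sq_mul_famXi_sdiff_le (hJ : ∀ A ∈ T, (A ∩ J).card = 1) {p : ℝ} (h0 : 0 ≤ p) (h1 : p ≤ 1) :
    p ^ 2 * famXi T (fun A => A \ J) p ≤ famXi T id p := by
  unfold famXi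
  rw [Finset.mul_sum]
  refine Finset.sum_le_sum fun A hA => ?_
  rw [Finset.mul_sum]
  refine Finset.sum_le_sum fun A' hA' => ?_
  by_cases hd : Disjoint (A \ J) (A' \ J)
  · rw [if_pos hd, mul_zero]
    split_ifs <;> positivity
  · have hd' : ¬ Disjoint (id A) (id A') := fun h =>
      hd (h.mono Finset.sdiff_subset Finset.sdiff_subset)
    rw [if_neg hd, if_neg hd', ← pow_add]
    refine pow_le_pow_of_le_one h0 h1 ?_
    have hU : id A ∪ id A' ⊆ ((A \ J) ∪ (A' \ J)) ∪ ((A ∩ J) ∪ (A' ∩ J)) := by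
      intro x
      simp only [id, Finset.mem_union, Finset.mem_sdiff, Finset.mem_inter]
      tauto
    have h2 := Finset.card_le_card hU
    have h3 := Finset.card_union_le ((A \ J) ∪ (A' \ J)) ((A ∩ J) ∪ (A' ∩ J))
    have h4 := Finset.card_union_le (A ∩ J) (A' ∩ J)
    rw [hJ A hA, hJ A' hA'] at h4
    show _ ≤ 2 + ((A \ J) ∪ (A' \ J)).card
    omega

lemma famXi_mono {ι : Type*} {I I' : Finset ι} (h : I ⊆ I') (b : ι → Finset ℕ) {p : ℝ}
    (h0 : 0 ≤ p) : famXi I b p ≤ famXi I' b p :=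
  (Finset.sum_le_sum fun i _ => Finset.sum_le_sum_of_subset_of_nonneg h
    fun j _ _ => by split_ifs <;> positivity).trans
  (Finset.sum_le_sum_of_subset_of_nonneg h fun i _ _ => Finset.sum_nonneg
    fun j _ => by split_ifs <;> positivity)

end Link


/-! ### The lower bound from an increased density -/

lemma sum_inter_filter_of_ne_zero {V : Finset ℕ} {d : ℕ → ℝ} (hd : ∀ x ∈ V, d x ≠ 0 → 1 ≤ d x)
    {S : Finset ℕ} (hS : S ⊆ V) :
    ∑ x ∈ S ∩ V.filter (fun x => 1 ≤ d x), d x = ∑ x ∈ S, d x := by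
  refine Finset.sum_subset Finset.inter_subset_left fun x hx hx' => ?_
  by_contra h
  exact hx' (Finset.mem_inter.2 ⟨hx, Finset.mem_filter.2 ⟨hS hx, hd x (hS hx) h⟩⟩)

/-- Under density `p'` Cantelli's inequality gives constant probability, and the change of measure
returns to `p`. Points of zero weight are irrelevant, so the density is raised only where d ≥ 1;
this keeps the cost proportional to that set rather than to `V`. -/
lemma sq_le_binPr_sum_mem_mul_exp {V : Finset ℕ} {d : ℕ → ℝ} (hd : ∀ x ∈ V, d x ≠ 0 → 1 ≤ d x)
    {p p' x t v a : ℝ} (h0 : 0 < p) (h1 : p < 1) (h0' : 0 ≤ p') (h1' : p' ≤ 1) (ht : 0 < t)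
    (hx : x ≤ p' * ∑ y ∈ V, d y - t) (hv : p' * ∑ y ∈ V, d y ^ 2 ≤ v)
    (ha : (p' - p) ^ 2 / (p * (1 - p)) * (V.filter fun y => 1 ≤ d y).card ≤ a) :
    (t ^ 2 / (v + t ^ 2)) ^ 2 ≤ binPr V p (fun S => x ≤ ∑ y ∈ S, d y) * Real.exp a := by
  set U := V.filter fun y => 1 ≤ d y with hU
  have hUV : U ⊆ V := Finset.filter_subset _ _
  have hsum : ∀ q : ℝ, binPr V q (fun S => x ≤ ∑ y ∈ S, d y)
      = binPr U q (fun S => x ≤ ∑ y ∈ S, d y) := by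
    intro q
    have e := binPr_inter V U q (fun S => x ≤ ∑ y ∈ S, d y)
    rw [Finset.inter_eq_right.2 hUV] at e
    rw [← e]
    unfold binPr
    refine binEx_congr fun S hS => ?_
    have e2 := sum_inter_filter_of_ne_zero hd hS
    simp only [hU, e2]
  have hc := le_binPr_cantelli (V := V) h0' h1' (fun S => ∑ y ∈ S, d y) ht (v := v) (by
    rw [binVar_sum_mem]
    refine le_trans ?_ hv
    refine mul_le_mul_of_nonneg_right ?_ (Finset.sum_nonneg fun _ _ => sq_nonneg _)
    nlinarith)
  rw [binEx_sum_mem] at hc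
  have hv0 : 0 ≤ v := le_trans (mul_nonneg h0' (Finset.sum_nonneg fun _ _ => sq_nonneg _)) hv
  have hc2 : t ^ 2 / (v + t ^ 2) ≤ binPr U p' (fun S => x ≤ ∑ y ∈ S, d y) := by
    rw [← hsum]
    exact hc.trans (binPr_mono h0' h1' fun S _ hS => hx.trans hS)
  refine (pow_le_pow_left₀ (by positivity) hc2 2).trans ((binPr_tilt h0 h1 h1' _).trans ?_)
  rw [hsum]
  refine mul_le_mul_of_nonneg_left ?_ (binPr_nonneg h0.le h1.le _)
  have hq : 0 < 1 - p := by linarith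
  set z := (p' - p) ^ 2 / (p * (1 - p)) with hz
  have hz0 : 0 ≤ z := by positivity
  calc (1 + z) ^ U.card ≤ Real.exp z ^ U.card := by
        refine pow_le_pow_left₀ (by positivity) ?_ _
        linarith [Real.add_one_le_exp z]
    _ = Real.exp (z * U.card) := by rw [mul_comm, Real.exp_nat_mul]
    _ ≤ _ := Real.exp_le_exp.2 ha

/-! ### Progressions with one point in the last stretch of [n] -/

section Tail

variable {k n h : ℕ}

lemma Icc_union_tail (hn : h ≤ n) :
    Finset.Icc 1 (n - h) ∪ Finset.Ioc (n - h) n = Finset.Icc 1 n := by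
  ext x; simp only [Finset.mem_union, Finset.mem_Icc, Finset.mem_Ioc]; omega

lemma disjoint_Icc_tail : Disjoint (Finset.Icc 1 (n - h)) (Finset.Ioc (n - h) n) := by
  rw [Finset.disjoint_left]; intro x; simp only [Finset.mem_Icc, Finset.mem_Ioc]; omega

lemma card_inter_of_mem_tailAPs {A : Finset ℕ} (hA : A ∈ tailAPs k n h) :
    (A ∩ Finset.Ioc (n - h) n).card = 1 := (Finset.mem_filter.1 hA).2

lemma sdiff_subset_of_mem_tailAPs (A : Finset ℕ) (hA : A ∈ tailAPs k n h) :
    A \ Finset.Ioc (n - h) n ⊆ Finset.Icc 1 (n - h) := by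
  have := apSets_subset A (tailAPs_subset k n h hA)
  intro x hx
  rw [Finset.mem_sdiff] at hx
  have h2 := this hx.1
  simp only [Finset.mem_Icc, Finset.mem_Ioc] at h2 hx ⊢
  omega

lemma card_sdiff_of_mem_tailAPs (A : Finset ℕ) (hA : A ∈ tailAPs k n h) :
    (A \ Finset.Ioc (n - h) n).card = k - 1 := by
  have h1 := card_inter_of_mem_tailAPs hA
  have h2 := card_of_mem_apSets (tailAPs_subset k n h hA)
  have := Finset.card_sdiff_add_card_inter A (Finset.Ioc (n - h) n)
  omega

lemma card_apSets_le_card_tailAPs (hk : 2 ≤ k) (hn : 4 * k ≤ n) :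
    1 / (64 * (k : ℝ) ^ 2) * (apSets k n).card ≤ (tailAPs k n (n / (4 * k))).card := by
  refine le_trans ?_ (card_tailAPs_ge hk hn)
  refine mul_le_mul_of_nonneg_left ?_ (by positivity)
  rw [sq]
  exact_mod_cast card_apSets_le hk

/-- Planting progressions that meet `(n - h, n]` in one point on top of a typical configuration. -/
lemma mul_le_apUpperTail_of_tail {p : unitInterval} {ε t a b : ℝ} (hn : h ≤ n) (hε : 0 < ε)
    (hΦ : 1 ≤ bigPhi k n p ε) (hb : 0 ≤ b) {G : Finset ℕ → Prop}
    (ht : t = (tailAPs k n h).card * (p : ℝ) ^ k + 2 * (ε * apMean k n p))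
    (hG : a ≤ binPr (Finset.Icc 1 (n - h)) p G)
    (hS : ∀ S ⊆ Finset.Icc 1 (n - h), G S → b ≤ binPr (Finset.Ioc (n - h) n) p
      (fun S' => t ≤ ∑ x ∈ S', linkDeg (tailAPs k n h) (Finset.Ioc (n - h) n) S x)) :
    a * b * (1 / 2) ≤ apUpperTail k n p ((1 + ε) * apMean k n p) := by
  have hm := (bigPhi_pos_imp hΦ).2.1
  have h1 : a * b ≤ binPr (Finset.Icc 1 n) p (fun S => t ≤ famCount (tailAPs k n h) id S) := by
    rw [← Icc_union_tail hn]
    refine mul_le_binPr_union disjoint_Icc_tail p.2.1 p.2.2 hb hG fun S hSV hGS =>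
      (hS S hSV hGS).trans (binPr_mono p.2.1 p.2.2 fun S' hS' h => ?_)
    rwa [famCount_union_eq_sum_linkDeg (fun A hA => card_inter_of_mem_tailAPs hA)
      (disjoint_Icc_tail.mono_left hSV) hS']
  set I := apSets k n \ tailAPs k n h with hI
  have hsub := tailAPs_subset k n h
  have hIV : ∀ A ∈ I, id A ⊆ Finset.Icc 1 n := fun A hA =>
    apSets_subset A (Finset.sdiff_subset hA)
  have hv : binVar (Finset.Icc 1 n) p (famCount (apSets k n) id) ≤ (ε * apMean k n p) ^ 2 := by
    rw [← apVar_eq]; exact apVar_le_sq hε.le hΦ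
  have h2 := half_le_binPr_famCount hIV p.2.1 p.2.2 (by positivity : 0 < ε * apMean k n p)
    ((binVar_famCount_mono Finset.sdiff_subset apSets_subset p.2.1 p.2.2).trans hv)
  rw [apUpperTail_eq]
  refine (mul_le_mul h1 h2 (by norm_num) (binPr_nonneg p.2.1 p.2.2 _)).trans
    ((binPr_harris p.2.1 p.2.2 (fun S T hST h => h.trans (famCount_mono _ _ hST))
      (fun S T hST h => h.trans (famCount_mono _ _ hST))).trans
      (binPr_mono p.2.1 p.2.2 fun S _ hS => ?_))
  rw [← famCount_sdiff_add hsub]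
  have e4 : famMean I id p = (apSets k n).card * (p : ℝ) ^ k
      - (tailAPs k n h).card * (p : ℝ) ^ k := by
    rw [famMean_of_card (I := I) (b := id) (j := k)
      (fun A hA => card_of_mem_apSets (Finset.sdiff_subset hA)),
      hI, ← Finset.card_sdiff_add_card_eq_card hsub]
    push_cast
    ring
  have h3 := hS.2
  have h4 := hS.1
  rw [e4, ← apMean_eq] at h3
  linarith

end Tail


/-! ### Typical link degrees -/

section Typical

variable {k n h : ℕ} {p : unitInterval}

lemma famXi_pos_of_apVar_pos (h : 0 < apVar k n p) : 0 < famXi (apSets k n) id p :=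
  h.trans_le (apVar_le_famXi k n p)

lemma binPr_mul_mean_le_famCount_link (hp : 0 < (p : ℝ)) (hT : 0 < (tailAPs k n h).card)
    {M : ℝ} (hM : 0 < M) :
    binPr (Finset.Icc 1 (n - h)) p (fun S => M * ((tailAPs k n h).card * (p : ℝ) ^ (k - 1))
      ≤ famCount (tailAPs k n h) (fun A => A \ Finset.Ioc (n - h) n) S) ≤ 1 / M := by
  have hT' : (0 : ℝ) < (tailAPs k n h).card := by exact_mod_cast hT
  have := binPr_markov (V := Finset.Icc 1 (n - h)) p.2.1 p.2.2
    (f := famCount (tailAPs k n h) (fun A => A \ Finset.Ioc (n - h) n))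
    (fun S _ => famCount_nonneg _ _ _)
    (t := M * ((tailAPs k n h).card * (p : ℝ) ^ (k - 1))) (by positivity)
  rw [binEx_famCount sdiff_subset_of_mem_tailAPs, famMean_of_card card_sdiff_of_mem_tailAPs]
    at this
  refine this.trans (le_of_eq ?_)
  have hx : 0 < (tailAPs k n h).card * (p : ℝ) ^ (k - 1) := by positivity
  field_simp

lemma binPr_mul_famXi_le_sum_linkDeg_sq (hp : 0 < (p : ℝ)) (hX : 0 < famXi (apSets k n) id p)
    {M : ℝ} (hM : 0 < M) :
    binPr (Finset.Icc 1 (n - h)) p (fun S => M * (famXi (apSets k n) id p / p)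
      ≤ ∑ x ∈ Finset.Ioc (n - h) n, linkDeg (tailAPs k n h) (Finset.Ioc (n - h) n) S x ^ 2)
      ≤ 1 / M := by
  have := binPr_markov (V := Finset.Icc 1 (n - h)) p.2.1 p.2.2
    (f := fun S => ∑ x ∈ Finset.Ioc (n - h) n,
      linkDeg (tailAPs k n h) (Finset.Ioc (n - h) n) S x ^ 2)
    (fun S _ => Finset.sum_nonneg fun _ _ => sq_nonneg _)
    (t := M * (famXi (apSets k n) id p / p)) (by positivity)
  refine this.trans ?_
  have h1 := (mul_binEx_sum_linkDeg_sq_le (V := Finset.Icc 1 (n - h))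
    sdiff_subset_of_mem_tailAPs (fun A hA => card_inter_of_mem_tailAPs hA) p.2.1).trans
    (famXi_mono (tailAPs_subset k n h) id p.2.1)
  rw [div_le_div_iff₀ (by positivity) hM, one_mul, mul_comm _ M]
  refine mul_le_mul_of_nonneg_left ?_ hM.le
  rwa [le_div_iff₀ hp, mul_comm]

lemma le_binPr_mean_sub_le_famCount_link {t v : ℝ} (ht : 0 < t)
    (hv : famXi (tailAPs k n h) (fun A => A \ Finset.Ioc (n - h) n) p ≤ v) :
    t ^ 2 / (v + t ^ 2) ≤ binPr (Finset.Icc 1 (n - h)) p (fun S =>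
      (tailAPs k n h).card * (p : ℝ) ^ (k - 1) - t
        ≤ famCount (tailAPs k n h) (fun A => A \ Finset.Ioc (n - h) n) S) := by
  have := le_binPr_cantelli (V := Finset.Icc 1 (n - h)) p.2.1 p.2.2
    (famCount (tailAPs k n h) (fun A => A \ Finset.Ioc (n - h) n)) ht
    ((binVar_famCount_le_xi sdiff_subset_of_mem_tailAPs p.2.1).trans hv)
  rwa [binEx_famCount sdiff_subset_of_mem_tailAPs, famMean_of_card card_sdiff_of_mem_tailAPs]
    at this

end Typical

lemma card_filter_one_le_le_sum {V : Finset ℕ} {d : ℕ → ℝ} (hd : ∀ x ∈ V, 0 ≤ d x) :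
    ((V.filter fun x => 1 ≤ d x).card : ℝ) ≤ ∑ x ∈ V, d x := by
  rw [Finset.card_eq_sum_ones, Nat.cast_sum]
  refine (Finset.sum_le_sum fun x hx => ?_).trans
    (Finset.sum_le_sum_of_subset_of_nonneg (Finset.filter_subset _ _) fun x hx _ => hd x hx)
  simpa using (Finset.mem_filter.1 hx).2

lemma tilt_arith {p θ K m μ₁ s S₀ e : ℝ} (hp : 0 < p) (hθ0 : 0 ≤ θ) (hθ1 : θ ≤ 1) (hK : 0 ≤ K)
    (hm : 0 ≤ m) (he : 0 ≤ e) (hs : p * s = μ₁) (hS : s - K * (e * m) / p ≤ S₀)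
    (hθ : (2 * K + 3) * (e * m) ≤ θ * μ₁) :
    μ₁ + 2 * (e * m) ≤ (1 + θ) * p * S₀ - e * m := by
  have h1 : μ₁ - K * (e * m) ≤ p * S₀ := by
    have := mul_le_mul_of_nonneg_left hS hp.le
    rw [mul_sub, hs, mul_div_cancel₀ _ hp.ne'] at this
    exact this
  have h2 := mul_le_mul_of_nonneg_left h1 (by linarith : 0 ≤ 1 + θ)
  have h3 : θ * (K * (e * m)) ≤ 1 * (K * (e * m)) :=
    mul_le_mul_of_nonneg_right hθ1 (by positivity)
  linarith

/-- Raising the density on the tail by 1 + θ, with θ of order ε, lifts the linear statistic by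
several εμ, beyond its standard deviation. The cost is θ²|U|p, where U is the set of positive
weights; |U|p is at most np trivially and at most 8μ since |U| ≤ Σ d. -/
lemma exp_neg_le_apUpperTail_of_small {k n : ℕ} (hk : 2 ≤ k) (hn : 4 * k ≤ n) {γ : ℝ}
    (hγ : 0 < γ) (hγ1 : γ < 1) {p : unitInterval} (hp0 : 0 < (p : ℝ)) (hpγ : (p : ℝ) ≤ 1 - γ)
    {ε K θ : ℝ} (hε : 0 < ε) (hΦ : 1 ≤ bigPhi k n p ε) (hK0 : 0 < K) (hK : K ^ 2 = 8 / γ)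
    (hθ : θ = 64 * (k : ℝ) ^ 2 * ((2 * K + 3) * ε)) (hθγ : θ ≤ γ) :
    1 / 2 * ((1 / (16 / γ + 1)) ^ 2
        * Real.exp (-(θ ^ 2 / γ * (8 * min (apMean k n p) (n * p))))) * (1 / 2)
      ≤ apUpperTail k n p ((1 + ε) * apMean k n p) := by
  obtain ⟨hVar, hm, -⟩ := bigPhi_pos_imp hΦ
  have hX0 := famXi_pos_of_apVar_pos hVar
  have hk0 : (0 : ℝ) < k := by exact_mod_cast (by omega : 0 < k)
  have hXε : famXi (apSets k n) id p ≤ (ε * apMean k n p) ^ 2 / γ := by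
    rw [le_div_iff₀ hγ]
    refine le_trans ?_ ((famXi_le_apVar k n p).trans (apVar_le_sq hε.le hΦ))
    rw [mul_comm]
    exact mul_le_mul_of_nonneg_right (by linarith) hX0.le
  have hTN := card_apSets_le_card_tailAPs hk hn
  have hN := card_apSets_pos_of_bigPhi hΦ
  have hhn : n / (4 * k) ≤ n := Nat.div_le_self _ _
  generalize n / (4 * k) = h at *
  have hN' : (0 : ℝ) < (apSets k n).card := by exact_mod_cast hN
  have hT' : (0 : ℝ) < (tailAPs k n h).card := lt_of_lt_of_le (by positivity) hTN
  have hT : 0 < (tailAPs k n h).card := by exact_mod_cast hT'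
  have hθ0 : 0 < θ := by rw [hθ]; positivity
  have hps : (p : ℝ) * ((tailAPs k n h).card * (p : ℝ) ^ (k - 1))
      = (tailAPs k n h).card * (p : ℝ) ^ k := by
    rw [← Nat.sub_add_cancel (by omega : 1 ≤ k), pow_succ, Nat.add_sub_cancel]; ring
  have hμ1 : (tailAPs k n h).card * (p : ℝ) ^ k ≤ apMean k n p := by
    rw [apMean_eq]
    exact mul_le_mul_of_nonneg_right
      (Nat.cast_le.2 (Finset.card_le_card (tailAPs_subset k n h))) (by positivity)
  have hθμ : (2 * K + 3) * (ε * apMean k n p) ≤ θ * ((tailAPs k n h).card * (p : ℝ) ^ k) := by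
    calc (2 * K + 3) * (ε * apMean k n p)
        = θ * (1 / (64 * (k : ℝ) ^ 2) * (apSets k n).card * (p : ℝ) ^ k) := by
          rw [hθ, apMean_eq]; field_simp
      _ ≤ _ := mul_le_mul_of_nonneg_left
          (mul_le_mul_of_nonneg_right hTN (by positivity)) hθ0.le
  have g1 := le_binPr_mean_sub_le_famCount_link (k := k) (n := n) (h := h) (p := p)
    (t := K * (ε * apMean k n p) / p) (v := (ε * apMean k n p) ^ 2 / γ / (p : ℝ) ^ 2)
    (by positivity) (by
      rw [le_div_iff₀ (by positivity), mul_comm]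
      exact ((sq_mul_famXi_sdiff_le (fun A hA => card_inter_of_mem_tailAPs hA) p.2.1 p.2.2).trans
        (famXi_mono (tailAPs_subset k n h) id p.2.1)).trans hXε)
  -- K² = 8/γ is chosen for this value: after two Markov exceptions of probability 1/8 each, more
  -- than 1/2 is left.
  have g1' : (8 / 9 : ℝ) ≤ (K * (ε * apMean k n p) / p) ^ 2
      / ((ε * apMean k n p) ^ 2 / γ / (p : ℝ) ^ 2 + (K * (ε * apMean k n p) / p) ^ 2) := by
    refine le_of_eq ?_
    rw [div_pow, mul_pow, hK]
    have : 0 < ε * apMean k n p := by positivity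
    generalize ε * apMean k n p = e at *
    field_simp
    norm_num
  have g2 := sub_le_binPr_and_not p.2.1 p.2.2 (g1'.trans g1)
    (binPr_mul_mean_le_famCount_link hp0 hT (by norm_num : (0 : ℝ) < 8))
  have g3 := sub_le_binPr_and_not p.2.1 p.2.2 g2
    (binPr_mul_famXi_le_sum_linkDeg_sq (h := h) hp0 hX0 (by norm_num : (0 : ℝ) < 8))
  refine mul_le_apUpperTail_of_tail hhn hε hΦ (by positivity) rfl
    (le_trans (by norm_num) g3) fun S hS hG => ?_
  obtain ⟨⟨hG1, hG2⟩, hG3⟩ := hG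
  push Not at hG2 hG3
  rw [Real.exp_neg, ← div_eq_mul_inv, div_le_iff₀ (Real.exp_pos _)]
  have hp1 : (1 + θ) * p ≤ 1 := by nlinarith
  have e1 : (ε * apMean k n p) ^ 2 / (16 / γ * (ε * apMean k n p) ^ 2 + (ε * apMean k n p) ^ 2)
      = 1 / (16 / γ + 1) := by
    have : 0 < ε * apMean k n p := by positivity
    generalize ε * apMean k n p = e at *
    field_simp
  rw [← e1]
  refine sq_le_binPr_sum_mem_mul_exp (p' := (1 + θ) * p)
    (fun x _ hx => one_le_linkDeg hx) hp0 (by linarith) (by positivity) hp1 (by positivity) ?_ ?_ ?_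
  · rw [sum_linkDeg fun A hA => card_inter_of_mem_tailAPs hA]
    exact tilt_arith hp0 hθ0.le (by linarith) hK0.le hm.le hε.le hps hG1 hθμ
  · calc (1 + θ) * p * ∑ x ∈ Finset.Ioc (n - h) n,
          linkDeg (tailAPs k n h) (Finset.Ioc (n - h) n) S x ^ 2
        ≤ (2 * p) * (8 * (famXi (apSets k n) id p / p)) :=
          mul_le_mul (mul_le_mul_of_nonneg_right (by linarith) hp0.le) hG3.le
            (Finset.sum_nonneg fun _ _ => sq_nonneg _) (by positivity)
      _ = 16 * famXi (apSets k n) id p := by field_simp; norm_num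
      _ ≤ 16 * ((ε * apMean k n p) ^ 2 / γ) := by linarith
      _ = _ := by ring
  · set U := (Finset.Ioc (n - h) n).filter fun y =>
      1 ≤ linkDeg (tailAPs k n h) (Finset.Ioc (n - h) n) S y with hU
    have hU1 : (U.card : ℝ) * p ≤ n * p := by
      refine mul_le_mul_of_nonneg_right (Nat.cast_le.2 ?_) hp0.le
      refine (Finset.card_filter_le _ _).trans ?_
      rw [Nat.card_Ioc]; omega
    have hU2 : (U.card : ℝ) * p ≤ 8 * apMean k n p := by
      have h1 := (card_filter_one_le_le_sum (V := Finset.Ioc (n - h) n)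
        (d := linkDeg (tailAPs k n h) (Finset.Ioc (n - h) n) S)
        (fun x _ => linkDeg_nonneg _ _ _ _))
      rw [sum_linkDeg fun A hA => card_inter_of_mem_tailAPs hA] at h1
      have h2 := mul_le_mul_of_nonneg_right (h1.trans hG2.le) hp0.le
      linarith
    have hU3 : (U.card : ℝ) * p ≤ 8 * min (apMean k n p) (n * p) := by
      rw [mul_min_of_nonneg _ _ (by norm_num)]
      refine le_min hU2 (hU1.trans ?_)
      have : 0 ≤ (n : ℝ) * p := by positivity
      linarith
    have hq : 0 < 1 - (p : ℝ) := by linarith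
    calc ((1 + θ) * p - p) ^ 2 / (p * (1 - p)) * U.card
        = θ ^ 2 / (1 - p) * (U.card * p) := by field_simp; ring
      _ ≤ θ ^ 2 / γ * (8 * min (apMean k n p) (n * p)) := by
          refine mul_le_mul ?_ hU3 (by positivity) (by positivity)
          exact div_le_div_of_nonneg_left (by positivity) hγ (by linarith)


/-! ### Comparison of exponents, and the case of small ε -/

lemma mul_log_le_phi {x₀ x : ℝ} (h0 : 0 < x₀) (hx : x₀ ≤ x) :
    x₀ / (2 * (1 + x₀)) * ((1 + x) * Real.log (1 + x)) ≤ phi x := by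
  have hx0 : 0 < x := h0.trans_le hx
  have h := Real.le_log_one_add_of_nonneg hx0.le
  have h1 : x₀ / (2 * (1 + x₀)) ≤ x / (2 * (1 + x)) := by
    rw [div_le_div_iff₀ (by positivity) (by positivity)]
    linarith
  have hl : 0 ≤ Real.log (1 + x) := Real.log_nonneg (by linarith)
  have h2 : x / (2 * (1 + x)) * ((1 + x) * Real.log (1 + x)) = x / 2 * Real.log (1 + x) := by
    field_simp
  have h3 : x ≤ (x + 2) / 2 * Real.log (1 + x) := by
    calc x = (x + 2) / 2 * (2 * x / (x + 2)) := by field_simp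
      _ ≤ _ := mul_le_mul_of_nonneg_left h (by linarith)
  calc _ ≤ x / (2 * (1 + x)) * ((1 + x) * Real.log (1 + x)) :=
        mul_le_mul_of_nonneg_right h1 (by positivity)
    _ ≤ phi x := by rw [h2]; unfold phi; linarith

lemma sqrt_le_mul_phi {x₀ x : ℝ} (h0 : 0 < x₀) (hx : x₀ ≤ x) :
    √x ≤ (x₀ + 2) / (x₀ * √x₀) * phi x := by
  have hx0 : 0 < x := h0.trans_le hx
  have hs0 : 0 < √x₀ := Real.sqrt_pos.2 h0
  have h1 : √x * √x₀ ≤ x := by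
    calc √x * √x₀ ≤ √x * √x := by gcongr
      _ = x := Real.mul_self_sqrt hx0.le
  have h2 : x₀ / (x₀ + 2) * x ≤ phi x := by
    refine le_trans ?_ (sq_div_le_phi hx0.le)
    rw [div_mul_eq_mul_div, div_le_div_iff₀ (by positivity) (by positivity)]
    nlinarith
  calc √x = (x₀ + 2) / (x₀ * √x₀) * (x₀ / (x₀ + 2) * (√x * √x₀)) := by field_simp
    _ ≤ (x₀ + 2) / (x₀ * √x₀) * (x₀ / (x₀ + 2) * x) := by gcongr
    _ ≤ _ := by gcongr

lemma sqrt_mul_log_one_div_le {p : ℝ} (hp : 0 < p) : √p * Real.log (1 / p) ≤ 2 := by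
  have hs : 0 < √p := Real.sqrt_pos.2 hp
  have h1 : Real.log (1 / p) = 2 * Real.log (1 / √p) := by
    rw [one_div, one_div, Real.log_inv, Real.log_inv, Real.log_sqrt hp.le]; ring
  have h2 := Real.log_le_sub_one_of_pos (by positivity : 0 < 1 / √p)
  calc √p * Real.log (1 / p) ≤ √p * (2 * (1 / √p)) := by rw [h1]; gcongr; linarith
    _ = 2 := by field_simp

lemma sqrt_mul_log_le {x : ℝ} (hx : 0 < x) : √x * Real.log x ≤ 2 * x := by
  have hs : 0 < √x := Real.sqrt_pos.2 hx
  have h1 : Real.log x = 2 * Real.log √x := by rw [Real.log_sqrt hx.le]; ring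
  have h2 := Real.log_le_sub_one_of_pos hs
  calc √x * Real.log x ≤ √x * (2 * √x) := by rw [h1]; gcongr; linarith
    _ = 2 * (√x * √x) := by ring
    _ = 2 * x := by rw [Real.mul_self_sqrt hx.le]

lemma sq_mul_pow_le_apMean {k n : ℕ} (hk : 2 ≤ k) (hn : 4 * k ≤ n) (p : unitInterval) :
    (n : ℝ) ^ 2 * (p : ℝ) ^ k ≤ 64 * (k : ℝ) ^ 2 * apMean k n p := by
  have hk0 : (0 : ℝ) < k := by exact_mod_cast (by omega : 0 < k)
  rw [apMean_eq]
  have h := card_apSets_ge hk hn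
  rw [one_div, inv_mul_le_iff₀ (by positivity)] at h
  rw [← mul_assoc]
  exact mul_le_mul_of_nonneg_right h (pow_nonneg p.2.1 _)

lemma apMean_le_sq_mul_pow {k n : ℕ} (hk : 2 ≤ k) (p : unitInterval) :
    apMean k n p ≤ (n : ℝ) ^ 2 * (p : ℝ) ^ k := by
  rw [apMean_eq]
  refine mul_le_mul_of_nonneg_right ?_ (pow_nonneg p.2.1 _)
  rw [sq]
  exact_mod_cast card_apSets_le hk

lemma famXi_apSets_le_mean {k n : ℕ} (hk : 2 ≤ k) (p : unitInterval) :
    famXi (apSets k n) id p ≤ apMean k n p * (k ^ 2 * n * (p : ℝ) ^ (k - 1) + k ^ 4) := by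
  rw [apMean_eq]
  exact famXi_apSets_le hk (by omega) subset_rfl (fun _ _ => subset_rfl)
    (fun _ hA => card_of_mem_apSets hA) p.2.1 p.2.2

/-- Var X = O(μ(λ + 1)), where λ·np = n² p^k = O(μ); so min(μ, np)·Var X = O(μ²). It converts the
cost of the density change into the variance exponent. -/
lemma phi_mul_min_le {k n : ℕ} (hk : 2 ≤ k) (hn : 4 * k ≤ n) {p : unitInterval} {ε : ℝ}
    (hε : 0 < ε) (hV : 0 < apVar k n p) :
    phi ε * min (apMean k n p) (n * p)
      ≤ 65 * (k : ℝ) ^ 4 * (phi ε * apMean k n p ^ 2 / apVar k n p) := by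
  have hφ := phi_pos hε
  have hp0 := p.2.1
  have hm0 : 0 ≤ apMean k n p := by rw [apMean_eq]; positivity
  have h1 := (apVar_le_famXi k n p).trans (famXi_apSets_le_mean hk p)
  have h2 := sq_mul_pow_le_apMean hk hn p
  have hpk : (p : ℝ) ^ k = p * (p : ℝ) ^ (k - 1) := by
    rw [← pow_succ', Nat.sub_add_cancel (by omega)]
  rw [← mul_div_assoc, le_div_iff₀ hV]
  have h3 : min (apMean k n p) (n * p) * apVar k n p ≤ 65 * (k : ℝ) ^ 4 * apMean k n p ^ 2 := by
    have hmin0 : 0 ≤ min (apMean k n p) (n * p) := le_min hm0 (by positivity)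
    calc min (apMean k n p) (n * p) * apVar k n p
        ≤ min (apMean k n p) (n * p)
          * (apMean k n p * (k ^ 2 * n * (p : ℝ) ^ (k - 1) + k ^ 4)) :=
          mul_le_mul_of_nonneg_left h1 hmin0
      _ = apMean k n p * (k ^ 2 * (min (apMean k n p) (n * p) * (n * (p : ℝ) ^ (k - 1)))
          + k ^ 4 * min (apMean k n p) (n * p)) := by ring
      _ ≤ apMean k n p * (k ^ 2 * ((n * p) * (n * (p : ℝ) ^ (k - 1)))
          + k ^ 4 * apMean k n p) := by
          gcongr
          · exact min_le_right _ _
          · exact min_le_left _ _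
      _ = apMean k n p * (k ^ 2 * ((n : ℝ) ^ 2 * (p : ℝ) ^ k) + k ^ 4 * apMean k n p) := by
          rw [hpk]; ring
      _ ≤ apMean k n p * (k ^ 2 * (64 * (k : ℝ) ^ 2 * apMean k n p) + k ^ 4 * apMean k n p) := by
          gcongr
      _ = _ := by ring
  calc phi ε * min (apMean k n p) (n * p) * apVar k n p
      = phi ε * (min (apMean k n p) (n * p) * apVar k n p) := by ring
    _ ≤ phi ε * (65 * (k : ℝ) ^ 4 * apMean k n p ^ 2) := mul_le_mul_of_nonneg_left h3 hφ.le
    _ = _ := by ring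

lemma exp_neg_mul_le_mul_exp_neg {c a C F : ℝ} (hc : 0 < c) (hc1 : c ≤ 1) (hF : 1 ≤ F)
    (ha : a ≤ C * F) : Real.exp (-((C - Real.log c) * F)) ≤ c * Real.exp (-a) := by
  have h1 : Real.log c ≤ 0 := Real.log_nonpos hc.le hc1
  conv_rhs => rw [← Real.exp_log hc]
  rw [← Real.exp_add]
  refine Real.exp_le_exp.2 ?_
  nlinarith

lemma exists_small_bound (k : ℕ) (hk : 2 ≤ k) {γ : ℝ} (hγ : 0 < γ) (hγ1 : γ < 1) :
    ∃ ε₀ C : ℝ, 0 < ε₀ ∧ 0 < C ∧ ∀ (n : ℕ) (p : unitInterval) (ε : ℝ), 4 * k ≤ n → 0 < (p : ℝ) →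
      (p : ℝ) ≤ 1 - γ → 0 < ε → ε ≤ ε₀ → 1 ≤ bigPhi k n p ε →
      Real.exp (-(C * (phi ε * apMean k n p ^ 2 / apVar k n p)))
        ≤ apUpperTail k n p ((1 + ε) * apMean k n p) := by
  have hk1 : (1 : ℝ) ≤ k := by exact_mod_cast (by omega : 1 ≤ k)
  set K := √(8 / γ) with hKdef
  have hK0 : 0 < K := Real.sqrt_pos.2 (by positivity)
  have hK : K ^ 2 = 8 / γ := Real.sq_sqrt (by positivity)
  clear_value K
  set b := 64 * (k : ℝ) ^ 2 * (2 * K + 3) with hb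
  have hb1 : 1 ≤ b := by nlinarith [sq_nonneg (k : ℝ)]
  set c := 1 / 4 * (1 / (16 / γ + 1)) ^ 2 with hc
  have hc0 : 0 < c := by positivity
  have hc1 : c ≤ 1 := by
    have : 1 / (16 / γ + 1) ≤ 1 := by
      rw [div_le_one (by positivity)]
      have : 0 < 16 / γ := by positivity
      linarith
    have h2 := pow_le_one₀ (n := 2) (by positivity) this
    rw [hc]; linarith
  set C := b ^ 2 / γ * 24 * (65 * (k : ℝ) ^ 4) with hC
  refine ⟨γ / b, C - Real.log c, by positivity, ?_, ?_⟩
  · have : 0 < C := by positivity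
    linarith [Real.log_nonpos hc0.le hc1]
  intro n p ε hn hp0 hpγ hε hεb hΦ
  have hV := (bigPhi_pos_imp hΦ).1
  have hm := (bigPhi_pos_imp hΦ).2.1
  rw [le_div_iff₀ (by positivity)] at hεb
  have hε1 : ε ≤ 1 := by nlinarith
  have h1 := exp_neg_le_apUpperTail_of_small hk hn hγ hγ1 hp0 hpγ hε hΦ hK0 hK (θ := b * ε)
    (by rw [hb]; ring) (by linarith)
  have hφ : ε ^ 2 ≤ 3 * phi ε := by
    have := sq_div_le_phi hε.le
    rw [div_le_iff₀ (by positivity)] at this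
    nlinarith [phi_pos hε]
  have hmin : 0 ≤ min (apMean k n p) (n * p) := le_min hm.le (by positivity)
  refine le_trans (exp_neg_mul_le_mul_exp_neg (a := (b * ε) ^ 2 / γ
    * (8 * min (apMean k n p) (n * p))) hc0 hc1 (hΦ.trans (min_le_left _ _)) ?_)
    (le_trans (le_of_eq ?_) h1)
  · calc (b * ε) ^ 2 / γ * (8 * min (apMean k n p) (n * p))
        = b ^ 2 / γ * 8 * (ε ^ 2 * min (apMean k n p) (n * p)) := by ring
      _ ≤ b ^ 2 / γ * 8 * (3 * phi ε * min (apMean k n p) (n * p)) :=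
          mul_le_mul_of_nonneg_left (mul_le_mul_of_nonneg_right hφ hmin) (by positivity)
      _ = b ^ 2 / γ * 24 * (phi ε * min (apMean k n p) (n * p)) := by ring
      _ ≤ b ^ 2 / γ * 24 * (65 * (k : ℝ) ^ 4
            * (phi ε * apMean k n p ^ 2 / apVar k n p)) :=
          mul_le_mul_of_nonneg_left (phi_mul_min_le hk hn hε hV) (by positivity)
      _ = _ := by rw [hC]; ring
  · rw [hc]; ring


/-! ### The lower bound from many points of positive degree -/

lemma sq_sum_le_card_filter_mul {V : Finset ℕ} {d : ℕ → ℝ} (hd : ∀ x ∈ V, d x ≠ 0 → 1 ≤ d x) :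
    (∑ x ∈ V, d x) ^ 2 ≤ ((V.filter fun x => 1 ≤ d x).card : ℝ) * ∑ x ∈ V, d x ^ 2 := by
  have h := sum_inter_filter_of_ne_zero hd (subset_refl V)
  rw [Finset.inter_eq_right.2 (Finset.filter_subset _ _)] at h
  rw [← h]
  refine sq_sum_le_card_mul_sum_sq.trans (mul_le_mul_of_nonneg_left ?_ (Nat.cast_nonneg _))
  exact Finset.sum_le_sum_of_subset_of_nonneg (Finset.filter_subset _ _) fun _ _ _ => sq_nonneg _

lemma card_inter_le_sum {S U : Finset ℕ} {d : ℕ → ℝ} (h0 : ∀ x, 0 ≤ d x)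
    (hU : ∀ x ∈ U, 1 ≤ d x) : ((S ∩ U).card : ℝ) ≤ ∑ x ∈ S, d x := by
  rw [Finset.card_eq_sum_ones, Nat.cast_sum]
  refine (Finset.sum_le_sum fun x hx => ?_).trans
    (Finset.sum_le_sum_of_subset_of_nonneg Finset.inter_subset_left fun x _ _ => h0 x)
  simpa using hU x (Finset.mem_inter.1 hx).2

lemma pow_div_two_mul_le_choose {u M : ℕ} (hM : 1 ≤ M) (hu : 2 * M ≤ u) :
    ((u : ℝ) / (2 * M)) ^ M ≤ u.choose M := by
  have hM0 : (0 : ℝ) < M := by exact_mod_cast hM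
  refine le_trans ?_ (Nat.pow_le_choose M u)
  have hf : ((M.factorial : ℕ) : ℝ) ≤ (M : ℝ) ^ M := by exact_mod_cast Nat.factorial_le_pow M
  have hf0 : (0 : ℝ) < (M.factorial : ℕ) := by exact_mod_cast Nat.factorial_pos M
  have hu2 : (u : ℝ) / 2 ≤ ((u + 1 - M : ℕ) : ℝ) := by
    rw [div_le_iff₀ (by norm_num)]
    exact_mod_cast (by omega : u ≤ (u + 1 - M) * 2)
  calc ((u : ℝ) / (2 * M)) ^ M = (u / 2) ^ M / (M : ℝ) ^ M := by
        rw [← div_pow]; congr 1; field_simp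
    _ ≤ ((u + 1 - M : ℕ) : ℝ) ^ M / (M.factorial : ℕ) :=
        div_le_div₀ (by positivity) (pow_le_pow_left₀ (by positivity) hu2 _) hf0 hf
    _ = _ := rfl

lemma exp_neg_le_one_sub_pow {p γ : ℝ} (hγ : 0 < γ) (hp0 : 0 ≤ p) (hp : p ≤ 1 - γ) (u : ℕ) :
    Real.exp (-(u * p / γ)) ≤ (1 - p) ^ u := by
  have h1 : 0 < 1 - p := by linarith
  have h2 : Real.exp (-(p / γ)) ≤ 1 - p := by
    rw [← Real.le_log_iff_exp_le h1]
    have := Real.one_sub_inv_le_log_of_pos h1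
    refine le_trans ?_ this
    have h3 : 1 - (1 - p)⁻¹ = -(p / (1 - p)) := by field_simp; ring
    rw [h3]
    exact neg_le_neg (div_le_div_of_nonneg_left hp0 hγ (by linarith))
  calc Real.exp (-(u * p / γ)) = Real.exp (-(p / γ)) ^ u := by
        rw [← Real.exp_nat_mul]; congr 1; ring
    _ ≤ _ := pow_le_pow_left₀ (Real.exp_pos _).le h2 _

/-- A single binomial point mass, with the binomial coefficient at least (u/2M)^M; `Y` dominates the
cost 2M/(up) per forced point. -/
lemma exp_neg_le_binPr_card_inter {V U : Finset ℕ} (hU : U ⊆ V) {p γ : ℝ} (hγ : 0 < γ)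
    (hp0 : 0 < p) (hp : p ≤ 1 - γ) {M : ℕ} (hM : 1 ≤ M) (hu : 2 * M ≤ U.card) {Y : ℝ}
    (hY : 2 * M ≤ Y * (U.card * p)) :
    Real.exp (-(M * Real.log Y + U.card * p / γ)) ≤ binPr V p (fun S => M ≤ (S ∩ U).card) := by
  have hM0 : (0 : ℝ) < M := by exact_mod_cast hM
  have hu0 : (0 : ℝ) < U.card := by exact_mod_cast (by omega : 0 < U.card)
  have hY0 : 0 < Y := by
    by_contra h
    push Not at h
    have : Y * (U.card * p) ≤ 0 := mul_nonpos_of_nonpos_of_nonneg h (by positivity)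
    linarith
  refine le_trans ?_ (le_binPr_card_inter hU hp0.le (by linarith) M)
  have h1 : Real.exp (-(M * Real.log Y)) ≤ (U.card.choose M : ℝ) * p ^ M := by
    calc Real.exp (-(M * Real.log Y)) = (1 / Y) ^ M := by
          rw [← mul_neg, Real.exp_nat_mul, Real.exp_neg, Real.exp_log hY0, one_div]
      _ ≤ ((U.card : ℝ) / (2 * M) * p) ^ M := by
          refine pow_le_pow_left₀ (by positivity) ?_ _
          rw [div_mul_eq_mul_div, div_le_div_iff₀ hY0 (by positivity)]
          linarith
      _ = ((U.card : ℝ) / (2 * M)) ^ M * p ^ M := mul_pow _ _ _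
      _ ≤ _ := mul_le_mul_of_nonneg_right (pow_div_two_mul_le_choose hM hu) (by positivity)
  have h2 : Real.exp (-(U.card * p / γ)) ≤ (1 - p) ^ (U.card - M) :=
    (exp_neg_le_one_sub_pow hγ hp0.le hp _).trans
      (pow_le_pow_of_le_one (by linarith) (by linarith) (Nat.sub_le _ _))
  rw [neg_add, Real.exp_add, ← mul_assoc]
  exact mul_le_mul h1 h2 (Real.exp_pos _).le (by positivity)

lemma exp_neg_le_binPr_sum_mem {V : Finset ℕ} {d : ℕ → ℝ} (h0 : ∀ x, 0 ≤ d x) {p γ : ℝ}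
    (hγ : 0 < γ) (hp0 : 0 < p) (hp : p ≤ 1 - γ) {w m t : ℝ} (hm : 1 ≤ m)
    (hw : w ≤ (V.filter fun x => 1 ≤ d x).card) (hmw : 16 * m ≤ w) (hwp : w * p ≤ m) (ht : t ≤ 2 * m) :
    Real.exp (-(3 * m * Real.log (12 * m / (w * p)) + m / γ))
      ≤ binPr V p (fun S => t ≤ ∑ x ∈ S, d x) := by
  have hw0 : 0 < w := by linarith
  -- The set is trimmed to about `w` points: with more, the factor (1-p)^|U| could cost more than
  -- exp(-m/γ).
  have hfl : ⌊w⌋₊ ≤ (V.filter fun x => 1 ≤ d x).card := by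
    exact_mod_cast (Nat.floor_le hw0.le).trans hw
  obtain ⟨U, hUV, hU⟩ := Finset.exists_subset_card_eq hfl
  have hu1 : (U.card : ℝ) ≤ w := by rw [hU]; exact Nat.floor_le hw0.le
  have hu2 : w / 2 ≤ U.card := by
    rw [hU]; linarith [Nat.lt_floor_add_one w]
  set M := ⌈2 * m⌉₊ with hM
  have hM1 : 2 * m ≤ M := Nat.le_ceil _
  have hM2 : (M : ℝ) ≤ 3 * m := by
    linarith [Nat.ceil_lt_add_one (by linarith : 0 ≤ 2 * m)]
  have hM0 : 1 ≤ M := by exact_mod_cast (by linarith : (1 : ℝ) ≤ M)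
  have hMU : 2 * M ≤ U.card := by exact_mod_cast (by linarith : 2 * (M : ℝ) ≤ U.card)
  have hY : 2 * (M : ℝ) ≤ 12 * m / (w * p) * (U.card * p) := by
    calc 2 * (M : ℝ) ≤ 6 * m := by linarith
      _ = 12 * m / (w * p) * (w / 2 * p) := by field_simp; norm_num
      _ ≤ _ := by gcongr
  have hY1 : 1 ≤ 12 * m / (w * p) := by
    rw [le_div_iff₀ (by positivity)]; linarith
  have hl := Real.log_nonneg hY1
  refine le_trans (Real.exp_le_exp.2 (neg_le_neg (add_le_add ?_ ?_)))
    ((exp_neg_le_binPr_card_inter (hUV.trans (Finset.filter_subset _ _)) hγ hp0 hp hM0 hMU hY).trans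
      (binPr_mono hp0.le (by linarith) fun S _ hS => ?_))
  · gcongr
  · refine div_le_div_of_nonneg_right (le_trans ?_ hwp) hγ.le
    gcongr
  · refine ht.trans (hM1.trans (le_trans (Nat.cast_le.2 hS) (card_inter_le_sum h0 fun x hx => ?_)))
    exact (Finset.mem_filter.1 (hUV hx)).2

lemma le_of_sq_le_mul {s S₀ u q B X C a m p : ℝ} (hp : 0 < p) (hm : 0 < m) (ha : 0 < a)
    (hB : 0 < B) (hC : 0 < C) (hu : 0 ≤ u) (hs : a * m ≤ s * p) (hS : s / 2 ≤ S₀)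
    (hSq : S₀ ^ 2 ≤ u * q) (hq : q ≤ B * (X / p)) (hX : X ≤ C * m) :
    a ^ 2 / (4 * B * C) * m / p ≤ u := by
  have h1 : a * m / p ≤ s := by rwa [div_le_iff₀ hp]
  have h2 : (a * m / p / 2) ^ 2 ≤ S₀ ^ 2 :=
    pow_le_pow_left₀ (by positivity) (by linarith) 2
  have h3 : q ≤ B * (C * m / p) :=
    hq.trans (mul_le_mul_of_nonneg_left (div_le_div_of_nonneg_right hX hp.le) hB.le)
  have h4 := h2.trans (hSq.trans (mul_le_mul_of_nonneg_left h3 hu))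
  have h5 : 0 < 4 * B * C * m / p := by positivity
  refine le_of_mul_le_mul_right ?_ h5
  calc a ^ 2 / (4 * B * C) * m / p * (4 * B * C * m / p) = 4 * (a * m / p / 2) ^ 2 := by
        field_simp; ring
    _ ≤ 4 * (u * (B * (C * m / p))) := by linarith
    _ = _ := by ring

/-- With np ≥ 1 the one-point overlaps satisfy n p^(k-2) ≤ n² p^(k-1) = O(s), and s ≥ 1 handles the
rest, where s is the mean number of traces. -/
lemma famXi_link_le {k n h : ℕ} (hk : 3 ≤ k) {p : unitInterval}
    (hnp : 1 ≤ n * (p : ℝ)) (hT : (n : ℝ) ^ 2 ≤ 64 * (k : ℝ) ^ 2 * (tailAPs k n h).card)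
    (hs : 1 ≤ (tailAPs k n h).card * (p : ℝ) ^ (k - 1)) :
    famXi (tailAPs k n h) (fun A => A \ Finset.Ioc (n - h) n) p
      ≤ 65 * (k : ℝ) ^ 4 * ((tailAPs k n h).card * (p : ℝ) ^ (k - 1)) ^ 2 := by
  have hp0 := p.2.1
  have h1 := famXi_apSets_le (by omega : 2 ≤ k) (by omega : 1 ≤ k - 1) (tailAPs_subset k n h)
    (b := fun A => A \ Finset.Ioc (n - h) n) (fun A _ => Finset.sdiff_subset)
    card_sdiff_of_mem_tailAPs p.2.1 p.2.2
  have h2 : n * (p : ℝ) ^ (k - 1 - 1) ≤ 64 * (k : ℝ) ^ 2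
      * ((tailAPs k n h).card * (p : ℝ) ^ (k - 1)) := by
    calc n * (p : ℝ) ^ (k - 1 - 1) ≤ n * (p : ℝ) ^ (k - 1 - 1) * (n * p) :=
          le_mul_of_one_le_right (by positivity) hnp
      _ = (n : ℝ) ^ 2 * ((p : ℝ) ^ (k - 1 - 1) * p) := by ring
      _ = (n : ℝ) ^ 2 * (p : ℝ) ^ (k - 1) := by
          rw [← pow_succ, Nat.sub_add_cancel (by omega)]
      _ ≤ 64 * (k : ℝ) ^ 2 * (tailAPs k n h).card * (p : ℝ) ^ (k - 1) :=
          mul_le_mul_of_nonneg_right hT (by positivity)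
      _ = _ := by ring
  refine h1.trans ?_
  set s := (tailAPs k n h).card * (p : ℝ) ^ (k - 1)
  have h3 : (k : ℝ) ^ 4 * 1 ≤ (k : ℝ) ^ 4 * s := mul_le_mul_of_nonneg_left hs (by positivity)
  have h4 := mul_le_mul_of_nonneg_left h2 (by positivity : 0 ≤ (k : ℝ) ^ 2)
  calc s * (k ^ 2 * n * (p : ℝ) ^ (k - 1 - 1) + k ^ 4)
      ≤ s * (65 * (k : ℝ) ^ 4 * s) := mul_le_mul_of_nonneg_left (by linarith) (by linarith)
    _ = _ := by ring

lemma one_le_mul_of_le_mean {k n : ℕ} (hk : 3 ≤ k) {p : unitInterval} (hp0 : 0 < (p : ℝ))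
    (h : (p : ℝ) ≤ apMean k n p) : 1 ≤ n * (p : ℝ) := by
  have h1 := h.trans (apMean_le_sq_mul_pow (by omega) p)
  have h2 : (p : ℝ) ^ k ≤ (p : ℝ) ^ 3 := pow_le_pow_of_le_one p.2.1 p.2.2 hk
  have h3 : (n : ℝ) ^ 2 * (p : ℝ) ^ k ≤ (n : ℝ) ^ 2 * (p : ℝ) ^ 3 :=
    mul_le_mul_of_nonneg_left h2 (by positivity)
  have h4 : 1 * (p : ℝ) ≤ (n * p) ^ 2 * p := by
    calc 1 * (p : ℝ) ≤ (n : ℝ) ^ 2 * (p : ℝ) ^ 3 := by rw [one_mul]; exact h1.trans h3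
      _ = _ := by ring
  have h5 := le_of_mul_le_mul_right h4 hp0
  have h6 : 0 ≤ n * (p : ℝ) := by positivity
  nlinarith

lemma famXi_apSets_le_mul_mean {k n : ℕ} (hk : 2 ≤ k) (hn : 4 * k ≤ n) {p : unitInterval}
    (hp0 : 0 < (p : ℝ)) (hm : apMean k n p ≤ n * p) :
    famXi (apSets k n) id p ≤ 65 * (k : ℝ) ^ 4 * apMean k n p := by
  have hm0 : 0 ≤ apMean k n p := by rw [apMean_eq]; positivity
  have hn0 : (0 : ℝ) < n := by exact_mod_cast (by omega : 0 < n)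
  have h1 : n * (p : ℝ) ^ (k - 1) ≤ 64 * (k : ℝ) ^ 2 := by
    refine le_of_mul_le_mul_right ?_ (by positivity : 0 < n * (p : ℝ))
    calc n * (p : ℝ) ^ (k - 1) * (n * p) = (n : ℝ) ^ 2 * ((p : ℝ) ^ (k - 1) * p) := by ring
      _ = (n : ℝ) ^ 2 * (p : ℝ) ^ k := by rw [← pow_succ, Nat.sub_add_cancel (by omega)]
      _ ≤ 64 * (k : ℝ) ^ 2 * apMean k n p := sq_mul_pow_le_apMean hk hn p
      _ ≤ _ := by gcongr
  have h2 := mul_le_mul_of_nonneg_left h1 (by positivity : 0 ≤ (k : ℝ) ^ 2)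
  refine (famXi_apSets_le_mean hk p).trans ?_
  calc apMean k n p * (k ^ 2 * n * (p : ℝ) ^ (k - 1) + k ^ 4)
      ≤ apMean k n p * (65 * (k : ℝ) ^ 4) := mul_le_mul_of_nonneg_left (by linarith) hm0
    _ = _ := by ring

set_option maxHeartbeats 1000000 in
-- The Poisson regime. With constant probability the weights have Σ d ≥ s/2 and Σ d² = O(μ/p), so by
-- Cauchy–Schwarz order μ/p points have weight at least 1. Forcing 2(1+ε)μ of them into R costs
-- order (1+ε)μ · log(1+ε) plus a multiple of (1+ε)μ; `hD` ensures that there are enough points.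
lemma exp_neg_le_apUpperTail_of_large {k n : ℕ} (hk : 3 ≤ k) (hn : 4 * k ≤ n) {γ : ℝ}
    (hγ : 0 < γ) {p : unitInterval} (hp0 : 0 < (p : ℝ)) (hpγ : (p : ℝ) ≤ 1 - γ)
    {ε a B C c : ℝ} (hε : 0 < ε) (hΦ : 1 ≤ bigPhi k n p ε) (ha : a = 1 / (64 * (k : ℝ) ^ 2))
    (hC : C = 65 * (k : ℝ) ^ 4) (hB : B = 2 * (4 * C + 1)) (hc : c = a ^ 2 / (4 * B * C))
    (hm1 : 1 ≤ (1 + ε) * apMean k n p) (hμ : apMean k n p ≤ n * p)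
    (hD : 16 / c * p * ((1 + ε) * apMean k n p) ^ 2 ≤ apMean k n p) :
    1 / B * Real.exp (-(3 * ((1 + ε) * apMean k n p) * Real.log (12 / c * (1 + ε))
      + (1 + ε) * apMean k n p / γ)) * (1 / 2)
      ≤ apUpperTail k n p ((1 + ε) * apMean k n p) := by
  obtain ⟨hVar, hm, -⟩ := bigPhi_pos_imp hΦ
  have hX0 := famXi_pos_of_apVar_pos hVar
  have hk1 : (1 : ℝ) ≤ k := by exact_mod_cast (by omega : 1 ≤ k)
  have hk4 : (1 : ℝ) ≤ (k : ℝ) ^ 4 := one_le_pow₀ hk1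
  have hC1 : 1 ≤ C := by rw [hC]; linarith
  have hB1 : 1 ≤ B := by rw [hB]; linarith
  have ha0 : 0 < a := by rw [ha]; positivity
  have ha1 : a ≤ 1 := by
    rw [ha, div_le_one (by positivity)]
    nlinarith
  have hc0 : 0 < c := by rw [hc]; positivity
  have hca : c ≤ a := by
    rw [hc, div_le_iff₀ (by positivity)]
    have : 1 ≤ 4 * B * C := by nlinarith
    nlinarith
  set m := (1 + ε) * apMean k n p with hmdef
  have hμm : apMean k n p ≤ m := by rw [hmdef]; nlinarith
  have hm2 : 1 ≤ m ^ 2 := one_le_pow₀ hm1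
  have hmm2 : m ≤ m ^ 2 := le_self_pow₀ hm1 (by norm_num)
  have hDp : 16 * m ^ 2 ≤ c * apMean k n p / p := by
    rw [le_div_iff₀ hp0]
    have := mul_le_mul_of_nonneg_left hD hc0.le
    calc 16 * m ^ 2 * p = c * (16 / c * p * m ^ 2) := by field_simp
      _ ≤ _ := this
  have haμ : (p : ℝ) ≤ a * apMean k n p := by
    have h1 : c * apMean k n p ≤ a * apMean k n p := mul_le_mul_of_nonneg_right hca hm.le
    rw [le_div_iff₀ hp0] at hDp
    have h2 : 1 * (p : ℝ) ≤ 16 * m ^ 2 * p := mul_le_mul_of_nonneg_right (by linarith) hp0.le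
    linarith
  have hnp := one_le_mul_of_le_mean hk hp0 (haμ.trans (by nlinarith))
  have hT := card_tailAPs_ge (by omega : 2 ≤ k) hn
  have hTN := card_apSets_le_card_tailAPs (by omega : 2 ≤ k) hn
  have hhn : n / (4 * k) ≤ n := Nat.div_le_self _ _
  generalize n / (4 * k) = h at *
  rw [one_div, inv_mul_le_iff₀ (by positivity)] at hT
  have hps : ((tailAPs k n h).card * (p : ℝ) ^ (k - 1)) * p
      = (tailAPs k n h).card * (p : ℝ) ^ k := by
    rw [mul_assoc, ← pow_succ, Nat.sub_add_cancel (by omega)]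
  have hμ1 : (tailAPs k n h).card * (p : ℝ) ^ k ≤ apMean k n p := by
    rw [apMean_eq]
    exact mul_le_mul_of_nonneg_right
      (Nat.cast_le.2 (Finset.card_le_card (tailAPs_subset k n h))) (by positivity)
  have has : a * apMean k n p ≤ ((tailAPs k n h).card * (p : ℝ) ^ (k - 1)) * p := by
    rw [hps, apMean_eq, ← mul_assoc, ha]
    exact mul_le_mul_of_nonneg_right hTN (by positivity)
  have hs1 : 1 ≤ (tailAPs k n h).card * (p : ℝ) ^ (k - 1) := by
    refine le_of_mul_le_mul_right ?_ hp0
    rw [one_mul]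
    exact haμ.trans has
  have hXs := famXi_link_le hk hnp hT hs1
  rw [← hC] at hXs
  have hXm := famXi_apSets_le_mul_mean (by omega : 2 ≤ k) hn hp0 hμ
  rw [← hC] at hXm
  set s := (tailAPs k n h).card * (p : ℝ) ^ (k - 1) with hs
  -- B is defined so that Cantelli's inequality gives exactly 2/B here; the Markov exception below
  -- removes 1/B.
  have g1 := le_binPr_mean_sub_le_famCount_link (t := s / 2) (by positivity) hXs
  rw [← hs] at g1
  have e1 : (s / 2) ^ 2 / (C * s ^ 2 + (s / 2) ^ 2) = 2 / B := by
    have : 0 < s := by linarith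
    rw [hB]
    field_simp
    ring
  rw [e1] at g1
  have g2 := sub_le_binPr_and_not p.2.1 p.2.2 g1
    (binPr_mul_famXi_le_sum_linkDeg_sq (h := h) hp0 hX0 (by linarith : 0 < B))
  have e2 : 1 / B ≤ 2 / B - 1 / B := le_of_eq (by ring)
  refine mul_le_apUpperTail_of_tail hhn hε hΦ (Real.exp_pos _).le rfl (e2.trans g2)
    fun S hS hG => ?_
  obtain ⟨hG1, hG2⟩ := hG
  push Not at hG2
  have hcs := sq_sum_le_card_filter_mul (V := Finset.Ioc (n - h) n)
    (d := linkDeg (tailAPs k n h) (Finset.Ioc (n - h) n) S) (fun x _ hx => one_le_linkDeg hx)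
  rw [sum_linkDeg fun A hA => card_inter_of_mem_tailAPs hA] at hcs
  have hw := le_of_sq_le_mul hp0 hm ha0 (by linarith : 0 < B) (by linarith : 0 < C)
    (Nat.cast_nonneg _) has (by linarith) hcs hG2.le hXm
  rw [← hc] at hw
  have hwp : c * apMean k n p / p * p = c * apMean k n p := by field_simp
  have e3 : 12 / c * (1 + ε) = 12 * m / (c * apMean k n p / p * p) := by
    rw [hwp, hmdef]; field_simp
  rw [e3]
  refine exp_neg_le_binPr_sum_mem (fun x => linkDeg_nonneg _ _ _ _) hγ hp0 hpγ hm1 hw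
    (by linarith) ?_ ?_
  · rw [hwp]
    nlinarith
  · rw [hmdef]
    linarith


/-! ### Combining the lower bounds -/

/-- As k ≥ 3, √μ ≤ np√p, and √p L ≤ 2 removes the logarithm; so Q L = O(φ(ε) np), which the variance
exponent dominates when np ≤ μ. -/
lemma sqrt_mul_log_le_of_np_le {k n : ℕ} (hk : 3 ≤ k) (hn : 4 * k ≤ n) {p : unitInterval}
    (hp0 : 0 < (p : ℝ)) {ε₀ ε : ℝ} (hε₀ : 0 < ε₀) (hε : ε₀ ≤ ε) (hV : 0 < apVar k n p)
    (h : n * (p : ℝ) ≤ apMean k n p) :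
    √(ε * apMean k n p) * Real.log (1 / (p : ℝ))
      ≤ 2 * ((ε₀ + 2) / (ε₀ * √ε₀)) * (65 * (k : ℝ) ^ 4)
        * (phi ε * apMean k n p ^ 2 / apVar k n p) := by
  have hε0 : 0 < ε := hε₀.trans_le hε
  have h1 := phi_mul_min_le (by omega : 2 ≤ k) hn hε0 hV
  rw [min_eq_right h] at h1
  have hL : 0 ≤ Real.log (1 / (p : ℝ)) :=
    Real.log_nonneg (by rw [le_div_iff₀ hp0]; linarith [p.2.2])
  have h2 : √(apMean k n p) ≤ n * p * √p := by
    refine Real.sqrt_le_iff.2 ⟨by positivity, ?_⟩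
    rw [mul_pow, Real.sq_sqrt hp0.le]
    calc apMean k n p ≤ (n : ℝ) ^ 2 * (p : ℝ) ^ k := apMean_le_sq_mul_pow (by omega) p
      _ ≤ (n : ℝ) ^ 2 * (p : ℝ) ^ 3 :=
          mul_le_mul_of_nonneg_left (pow_le_pow_of_le_one p.2.1 p.2.2 hk) (by positivity)
      _ = _ := by ring
  have h3 := sqrt_mul_log_one_div_le hp0
  have h4 : √(apMean k n p) * Real.log (1 / (p : ℝ)) ≤ 2 * (n * p) := by
    calc √(apMean k n p) * Real.log (1 / (p : ℝ))
        ≤ n * p * √p * Real.log (1 / (p : ℝ)) := mul_le_mul_of_nonneg_right h2 hL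
      _ = n * p * (√p * Real.log (1 / (p : ℝ))) := by ring
      _ ≤ n * p * 2 := mul_le_mul_of_nonneg_left h3 (by positivity)
      _ = _ := by ring
  have h5 := sqrt_le_mul_phi hε₀ hε
  have hφ := phi_pos hε0
  have h6 : 0 ≤ (ε₀ + 2) / (ε₀ * √ε₀) := by positivity
  calc √(ε * apMean k n p) * Real.log (1 / (p : ℝ))
      = √ε * (√(apMean k n p) * Real.log (1 / (p : ℝ))) := by
        rw [Real.sqrt_mul hε0.le, mul_assoc]
    _ ≤ (ε₀ + 2) / (ε₀ * √ε₀) * phi ε * (2 * (n * p)) :=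
        mul_le_mul h5 h4 (mul_nonneg (Real.sqrt_nonneg _) hL) (by positivity)
    _ = 2 * ((ε₀ + 2) / (ε₀ * √ε₀)) * (phi ε * (n * p)) := by ring
    _ ≤ 2 * ((ε₀ + 2) / (ε₀ * √ε₀)) * (65 * (k : ℝ) ^ 4
          * (phi ε * apMean k n p ^ 2 / apVar k n p)) :=
        mul_le_mul_of_nonneg_left h1 (by positivity)
    _ = _ := by ring

/-- The hypothesis bounds 1/p by D m (1+ε) with m = (1+ε)μ, so L is at most logarithmic in m and
1+ε; the factor √m absorbs log m. -/
lemma sqrt_mul_log_le_of_lt {p ε μ D : ℝ} (hp : 0 < p) (hp1 : p ≤ 1) (hε : 0 < ε) (hμ : 0 < μ)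
    (hD : 1 ≤ D) (hm : 1 ≤ (1 + ε) * μ) (h : μ < D * p * ((1 + ε) * μ) ^ 2) :
    √(ε * μ) * Real.log (1 / p)
      ≤ (1 + ε) * μ * (Real.log D + 2) + (1 + ε) * μ * Real.log (1 + ε) := by
  set m := (1 + ε) * μ with hmdef
  have hm0 : 0 < m := by linarith
  have hL : 0 ≤ Real.log (1 / p) := Real.log_nonneg (by rwa [le_div_iff₀ hp, one_mul])
  have h1 : Real.log (1 / p) ≤ Real.log D + Real.log m + Real.log (1 + ε) := by
    rw [← Real.log_mul (by positivity) hm0.ne', ← Real.log_mul (by positivity) (by positivity)]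
    refine Real.log_le_log (by positivity) ?_
    rw [div_le_iff₀ hp]
    refine le_of_mul_le_mul_right ?_ hμ
    calc 1 * μ ≤ D * p * m ^ 2 := by linarith
      _ = D * m * (1 + ε) * p * μ := by rw [hmdef]; ring
  have h2 : √(ε * μ) ≤ √m := Real.sqrt_le_sqrt (by rw [hmdef]; nlinarith)
  have h3 : √m ≤ m := Real.sqrt_le_iff.2 ⟨hm0.le, le_self_pow₀ hm (by norm_num)⟩
  have h4 := sqrt_mul_log_le hm0
  have h5 : √m * Real.log D ≤ m * Real.log D :=
    mul_le_mul_of_nonneg_right h3 (Real.log_nonneg hD)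
  have h6 : √m * Real.log (1 + ε) ≤ m * Real.log (1 + ε) :=
    mul_le_mul_of_nonneg_right h3 (Real.log_nonneg (by linarith))
  calc √(ε * μ) * Real.log (1 / p) ≤ √m * Real.log (1 / p) := mul_le_mul_of_nonneg_right h2 hL
    _ ≤ √m * (Real.log D + Real.log m + Real.log (1 + ε)) :=
        mul_le_mul_of_nonneg_left h1 (Real.sqrt_nonneg _)
    _ ≤ _ := by linarith

/-- The second alternative says that clustering is already cheap enough. It covers np ≤ μ and the
case of too few available tail points; otherwise the Poisson construction applies, its cost being
O(φ(ε)μ) since ε ≥ ε₀ makes (1+ε)log(1+ε) comparable to φ(ε). -/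
lemma exists_large_bound (k : ℕ) (hk : 3 ≤ k) {γ ε₀ : ℝ} (hγ : 0 < γ) (hε₀ : 0 < ε₀) :
    ∃ C : ℝ, 0 < C ∧ ∀ (n : ℕ) (p : unitInterval) (ε : ℝ), 4 * k ≤ n → 0 < (p : ℝ) →
      (p : ℝ) ≤ 1 - γ → ε₀ ≤ ε → 1 ≤ bigPhi k n p ε → 1 ≤ (1 + ε) * apMean k n p →
      Real.exp (-(C * (phi ε * apMean k n p ^ 2 / apVar k n p)))
        ≤ apUpperTail k n p ((1 + ε) * apMean k n p) ∨
      √(ε * apMean k n p) * Real.log (1 / (p : ℝ))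
        ≤ C * (phi ε * apMean k n p ^ 2 / apVar k n p) := by
  have hk1 : (1 : ℝ) ≤ k := by exact_mod_cast (by omega : 1 ≤ k)
  have hk4 : (1 : ℝ) ≤ (k : ℝ) ^ 4 := one_le_pow₀ hk1
  obtain ⟨a, ha⟩ : ∃ a : ℝ, a = 1 / (64 * (k : ℝ) ^ 2) := ⟨_, rfl⟩
  obtain ⟨C, hC⟩ : ∃ C : ℝ, C = 65 * (k : ℝ) ^ 4 := ⟨_, rfl⟩
  obtain ⟨B, hB⟩ : ∃ B : ℝ, B = 2 * (4 * C + 1) := ⟨_, rfl⟩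
  obtain ⟨c, hc⟩ : ∃ c : ℝ, c = a ^ 2 / (4 * B * C) := ⟨_, rfl⟩
  have hC1 : 1 ≤ C := by rw [hC]; linarith
  have hB1 : 1 ≤ B := by rw [hB]; linarith
  have ha0 : 0 < a := by rw [ha]; positivity
  have ha1 : a ≤ 1 := by
    rw [ha, div_le_one (by positivity)]
    nlinarith
  have hc0 : 0 < c := by rw [hc]; positivity
  have hc1 : c ≤ 1 := by
    rw [hc, div_le_one (by positivity)]
    have : 1 ≤ B * C := one_le_mul_of_one_le_of_one_le hB1 hC1
    have h2 := pow_le_one₀ (n := 2) ha0.le ha1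
    linarith
  have hD1 : 1 ≤ 16 / c := by rw [le_div_iff₀ hc0]; linarith
  have hE1 : 1 ≤ 12 / c := by rw [le_div_iff₀ hc0]; linarith
  have hlD := Real.log_nonneg hD1
  have hlE := Real.log_nonneg hE1
  set l₀ := Real.log (1 + ε₀) with hl₀
  have hl0 : 0 < l₀ := Real.log_pos (by linarith)
  set C₁ := 2 * ((ε₀ + 2) / (ε₀ * √ε₀)) * C with hC₁
  set C₂ := C / (ε₀ / (2 * (1 + ε₀))) with hC₂
  set C₃ := C₂ / l₀ * (Real.log (16 / c) + 2) + C₂ with hC₃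
  set C₄ := C₂ / l₀ * (3 * Real.log (12 / c) + 1 / γ) + 3 * C₂ with hC₄
  have hC₁0 : 0 < C₁ := by positivity
  have hC₂0 : 0 < C₂ := by positivity
  have hC₃0 : 0 < C₃ := by positivity
  have hC₄0 : 0 < C₄ := by positivity
  have hb0 : 0 < 1 / (2 * B) := by positivity
  have hb1 : 1 / (2 * B) ≤ 1 := by rw [div_le_one (by positivity)]; linarith
  have hlb := Real.log_nonpos hb0.le hb1
  refine ⟨C₁ + C₃ + (C₄ - Real.log (1 / (2 * B))), by linarith, ?_⟩
  intro n p ε hn hp0 hpγ hε hΦ hm1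
  obtain ⟨hV, hm, -⟩ := bigPhi_pos_imp hΦ
  have hε0 : 0 < ε := hε₀.trans_le hε
  have hF1 : 1 ≤ phi ε * apMean k n p ^ 2 / apVar k n p := hΦ.trans (min_le_left _ _)
  rcases le_total (n * (p : ℝ)) (apMean k n p) with hnp | hnp
  · right
    refine (sqrt_mul_log_le_of_np_le hk hn hp0 hε₀ hε hV hnp).trans
      (mul_le_mul_of_nonneg_right ?_ (by linarith))
    rw [← hC]
    linarith
  have h1 := phi_mul_min_le (by omega : 2 ≤ k) hn hε0 hV
  rw [min_eq_left hnp, ← hC] at h1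
  set F := phi ε * apMean k n p ^ 2 / apVar k n p with hF
  have hml : (1 + ε) * apMean k n p * Real.log (1 + ε) ≤ C₂ * F := by
    have h2 := mul_le_mul_of_nonneg_right (mul_log_le_phi hε₀ hε) hm.le
    rw [hC₂, div_mul_eq_mul_div, le_div_iff₀ (by positivity)]
    linarith
  have hmF : (1 + ε) * apMean k n p ≤ C₂ / l₀ * F := by
    rw [div_mul_eq_mul_div, le_div_iff₀ hl0]
    refine le_trans (mul_le_mul_of_nonneg_left ?_ (by linarith)) hml
    exact Real.log_le_log (by linarith) (by linarith)
  rcases lt_or_ge (apMean k n p) (16 / c * p * ((1 + ε) * apMean k n p) ^ 2) with hD | hD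
  · right
    refine (sqrt_mul_log_le_of_lt hp0 p.2.2 hε0 hm hD1 hm1 hD).trans ?_
    have h2 := mul_le_mul_of_nonneg_right hmF (by linarith : 0 ≤ Real.log (16 / c) + 2)
    have h3 : C₃ * F ≤ (C₁ + C₃ + (C₄ - Real.log (1 / (2 * B)))) * F :=
      mul_le_mul_of_nonneg_right (by linarith) (by linarith)
    refine le_trans ?_ h3
    rw [hC₃, add_mul]
    linarith
  · left
    have h2 := exp_neg_le_apUpperTail_of_large hk hn hγ hp0 hpγ hε0 hΦ ha hC hB hc hm1 hnp hD
    have h3 : Real.exp (-((C₁ + C₃ + (C₄ - Real.log (1 / (2 * B)))) * F))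
        ≤ Real.exp (-((C₄ - Real.log (1 / (2 * B))) * F)) :=
      Real.exp_le_exp.2 (neg_le_neg (mul_le_mul_of_nonneg_right (by linarith) (by linarith)))
    refine h3.trans ((exp_neg_mul_le_mul_exp_neg (a := 3 * ((1 + ε) * apMean k n p)
      * Real.log (12 / c * (1 + ε)) + (1 + ε) * apMean k n p / γ) hb0 hb1 hF1 ?_).trans
      (le_trans (le_of_eq ?_) h2))
    · rw [Real.log_mul (by positivity) (by positivity)]
      have h4 := mul_le_mul_of_nonneg_right hmF
        (by positivity : 0 ≤ 3 * Real.log (12 / c) + 1 / γ)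
      calc _ = (1 + ε) * apMean k n p * (3 * Real.log (12 / c) + 1 / γ)
            + 3 * ((1 + ε) * apMean k n p * Real.log (1 + ε)) := by ring
        _ ≤ C₂ / l₀ * F * (3 * Real.log (12 / c) + 1 / γ) + 3 * (C₂ * F) := by linarith
        _ = C₄ * F := by rw [hC₄]; ring
    · rw [one_div, one_div, mul_inv]
      ring

lemma exists_lower_bound (k : ℕ) (hk : 3 ≤ k) {γ : ℝ} (hγ : 0 < γ) (hγ1 : γ < 1) :
    ∃ C : ℝ, 0 < C ∧ ∀ (n : ℕ) (p : unitInterval) (ε : ℝ), 4 * k ≤ n → 0 < (p : ℝ) →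
      (p : ℝ) ≤ 1 - γ → 0 < ε → 1 ≤ bigPhi k n p ε → 1 ≤ (1 + ε) * apMean k n p →
      (1 + ε) * apMean k n p ≤ (apSets k n).card →
      Real.exp (-(C * bigPhi k n p ε)) ≤ apUpperTail k n p ((1 + ε) * apMean k n p) := by
  obtain ⟨C₁, hC₁, h1⟩ := exists_clustering_bound k hk hγ hγ1
  obtain ⟨ε₀, C₂, hε₀, hC₂, h2⟩ := exists_small_bound k (by omega) hγ hγ1
  obtain ⟨C₃, hC₃, h3⟩ := exists_large_bound k hk hγ hε₀
  refine ⟨C₁ + C₂ + C₃ + C₁ * C₃, by positivity, ?_⟩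
  intro n p ε hn hp0 hpγ hε hΦ hm1 hmN
  have k1 := h1 n p ε hp0 hpγ hε hΦ hm1 hmN
  have k2 : Real.exp (-((C₂ + C₃) * (phi ε * apMean k n p ^ 2 / apVar k n p)))
      ≤ apUpperTail k n p ((1 + ε) * apMean k n p) ∨
      √(ε * apMean k n p) * Real.log (1 / (p : ℝ))
        ≤ C₃ * (phi ε * apMean k n p ^ 2 / apVar k n p) := by
    have hF : 1 ≤ phi ε * apMean k n p ^ 2 / apVar k n p := hΦ.trans (min_le_left _ _)
    have hexp : ∀ C, C ≤ C₂ + C₃ →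
        Real.exp (-((C₂ + C₃) * (phi ε * apMean k n p ^ 2 / apVar k n p)))
          ≤ Real.exp (-(C * (phi ε * apMean k n p ^ 2 / apVar k n p))) := fun C hC =>
      Real.exp_le_exp.2 (neg_le_neg (mul_le_mul_of_nonneg_right hC (by linarith)))
    rcases le_total ε ε₀ with h | h
    · exact Or.inl ((hexp C₂ (by linarith)).trans (h2 n p ε hn hp0 hpγ hε h hΦ))
    · exact (h3 n p ε hn hp0 hpγ h hΦ hm1).imp_left fun h => (hexp C₃ (by linarith)).trans h
  unfold bigPhi at hΦ ⊢
  set F := phi ε * apMean k n p ^ 2 / apVar k n p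
  set G := √(ε * apMean k n p) * Real.log (1 / (p : ℝ))
  have hF : 1 ≤ F := hΦ.trans (min_le_left _ _)
  have hG : 1 ≤ G := hΦ.trans (min_le_right _ _)
  have hCC : 0 < C₁ * C₃ := mul_pos hC₁ hC₃
  rcases le_total F G with h | h
  · rw [min_eq_left h]
    rcases k2 with k2 | k2
    · refine le_trans (Real.exp_le_exp.2 (neg_le_neg ?_)) k2
      exact mul_le_mul_of_nonneg_right (by linarith) (by linarith)
    · refine le_trans (Real.exp_le_exp.2 (neg_le_neg ?_)) k1
      calc C₁ * G ≤ C₁ * (C₃ * F) := mul_le_mul_of_nonneg_left k2 hC₁.le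
        _ = C₁ * C₃ * F := by ring
        _ ≤ _ := mul_le_mul_of_nonneg_right (by linarith) (by linarith)
  · rw [min_eq_right h]
    refine le_trans (Real.exp_le_exp.2 (neg_le_neg ?_)) k1
    exact mul_le_mul_of_nonneg_right (by linarith) (by linarith)

lemma apCount_Icc (k n : ℕ) : apCount k n (Set.Icc 1 n) = (apSets k n).card := by
  rw [← Finset.coe_Icc, apCount_coe, famCount_eq_card_of_forall apSets_subset]


theorem mainTheorem4 (k : ℕ) (hk : 3 ≤ k) :
    ∃ (n₀ : ℕ) (α : ℝ), 0 < n₀ ∧ 1 / (6 * (k : ℝ)) < α ∧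
      ∀ γ : ℝ, 0 < γ → γ < 1 →
        ∃ c C : ℝ, 0 < c ∧ 0 < C ∧
          ∀ n : ℕ, n₀ ≤ n →
          ∀ p : unitInterval, 0 < (p : ℝ) → (p : ℝ) ≤ 1 - γ →
          ∀ ε : ℝ, (n : ℝ) ^ (-α) ≤ ε → 1 ≤ bigPhi k n p ε →
            (1 ≤ (1 + ε) * apMean k n p →
              (1 + ε) * apMean k n p ≤ apCount k n (Set.Icc 1 n) →
              Real.exp (-(C * bigPhi k n p ε)) ≤ apUpperTail k n p ((1 + ε) * apMean k n p)) ∧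
            apUpperTail k n p ((1 + ε) * apMean k n p) ≤ Real.exp (-(c * bigPhi k n p ε)) := by
  obtain ⟨n₁, hn₁, hu⟩ := exists_upper_bound k hk
  -- α = 1/16 exceeds 1/18 ≥ 1/(6k) for every k ≥ 3.
  refine ⟨max n₁ (4 * k), 1 / 16, lt_of_lt_of_le hn₁ (le_max_left _ _), ?_, ?_⟩
  · have hk3 : (3 : ℝ) ≤ k := by exact_mod_cast hk
    rw [div_lt_div_iff₀ (by positivity) (by norm_num)]
    linarith
  intro γ hγ hγ1
  obtain ⟨c, hc, hu⟩ := hu γ hγ hγ1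
  obtain ⟨C, hC, hl⟩ := exists_lower_bound k hk hγ hγ1
  refine ⟨c, C, hc, hC, fun n hn p hp0 hpγ ε hε hΦ => ⟨fun hm1 hmN => ?_, ?_⟩⟩
  · have hn0 : 0 < n := lt_of_lt_of_le hn₁ ((le_max_left _ _).trans hn)
    have hε0 : 0 < ε := lt_of_lt_of_le (Real.rpow_pos_of_pos (by exact_mod_cast hn0) _) hε
    rw [apCount_Icc] at hmN
    exact hl n p ε ((le_max_right _ _).trans hn) hp0 hpγ hε0 hΦ hm1 hmN
  · exact hu n ((le_max_left _ _).trans hn) p hp0 hpγ ε hε hΦ
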